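/- **Setting.** Let $\mathbf G\subset \mathrm{SL}_N$ be a connected semisimple algebraic $\mathbb Q$-group, $G=\mathbf G(\mathbb R)$ with Lie algebra $\mathfrak g$, let $\Gamma<\mathbf G(\mathbb Z)=\mathbf G(\mathbb Q)\cap \mathrm{SL}_N(\mathbb Z)$ be a congruence subgroup, and $X=\Gamma\backslash G$. Fix a Euclidean norm $\|\cdot\|$ on $\mathrm{Mat}_N(\mathbb R)$ with $\|[Y,Y']\|\le\|Y\|\|Y'\|$, an orthonormal basis of $\mathfrak g$, and a $G$-invariant measure $m_X\neq 0$, finite on compact sets, on $X$. For $x=\Gamma g\in X$ put $\mathrm{ht}(x)=\sup\{\|v\|^{-1}: 0\ne v\in \mathrm{Ad}(g^{-1})\mathfrak g_{\mathbb Z}\}$, where $\mathfrak g_{\mathbb Z}$ is the set of integral matrices in $\mathfrak g$, and for $d\ge 0$, $f\in C_c^\infty(X)$ let $$\mathcal S_d(f)^2=\sum_{\mathcal D}\big\|(\mathrm{ht}(\cdot)+1)^d\,\mathcal D f\big\|_{L^2(X,m_X)}^2,$$ where $\mathcal D$ runs over the monomials (words) of degree at most $d$ in the orthonormal basis, acting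 as left-invariant differential operators. Let $H<G$ be a connected semisimple subgroup without compact factors, with Lie algebra $\mathfrak h$. Fix a continuous homomorphism $\mathrm{SL}_2(\mathbb R)\to H$ that projects non-trivially onto every simple factor of $H$, and a unit vector $\mathrm z\in\mathfrak g$ such that $\{u_t=\exp(t\mathrm z):t\in\mathbb R\}$ is the image of the group of upper triangular unipotent matrices. Let $p_G>1$ and $K=20(p_G+1)$. Let $\kappa_1>0$; an $H$-invariant complement $\mathfrak r$ of an $H$-invariant subspace $\mathfrak s\subset\mathfrak g$ is called *undistorted* if $\|v+w\|^2\ge\kappa_1(\|v\|^2+\|w\|^2)$ for all $v\in\mathfrak s$, $w\in\mathfrak r$. Let $\mu$ be a probability measure on $X$. It is *$\varepsilon$-almost invariant* (with respect to $\mathcal S_d$) under $g\in G$ if $|\int f(xg)\,d\mu(x)-\int f\,d\mu|\le\varepsilon\,\mathcal S_d(f)$ for all $f\in C_c^\infty(X)$; under $Z\in\mathfrak g$ if it is so under $\exp(tZ)$ for all $|t|\le 2$; and under a Lie subalgebra $\mathfrak s$ if it is so under all $Z\in\mathfrak s$ with $\|Z\|\le 1$. A point $x\in X$ is *$[k_1,k_2]$-generic*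 (with respect to $\mathcal S_d$) if for all $n\in[k_1,k_2]\cap\mathbb Z$ and $f\in C_c^\infty(X)$ $$\Big|\frac1{(n+1)^K-n^K}\int_{n^K}^{(n+1)^K}f(xu_t)\,dt-\int f\,d\mu\Big|\le\frac1n\,\mathcal S_d(f).$$ **Proposition.** There are $d_0\in\mathbb N$ and exponents $A,\kappa>0$, depending only on $N$ and $p_G$, such that for every $d\ge d_0+1$ there is a constant $C>0$, depending only on $d$ and on the data $\mathbf G,\Gamma,\|\cdot\|,m_X,H,\mathrm z,\kappa_1,p_G$ and the basis fixed above, with the following property. Let $k_0\ge1$ and $\varepsilon>0$. Let $\mu$ be the Haar probability measure on a periodic $H$-orbit in $X$ and assume that $\mu$ is $\varepsilon$-almost invariant (with respect to $\mathcal S_d$) under a Lie algebra $\mathfrak s$ with $\mathfrak h\subset\mathfrak s\subset\mathfrak g$. Let $\mathfrak r$ be an undistorted $H$-invariant complement to $\mathfrak s$ in $\mathfrak g$. Suppose that there are $x_1,x_2\in X$ with $x_2=x_1\exp(r)$ for some $r\in\mathfrak r$ with $$\varepsilon^{1/4}\le\|r\|\le1,$$ and such that $x_1,x_2$ are $[k_0,\varepsilon^{-1}]$-generic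 with respect to $\mathcal S_d$. Then $\mu$ is $C\,k_0^{A}\|r\|^{\kappa}$-almost invariant (with respect to $\mathcal S_d$) under some $Z\in\mathfrak r$ with $\|Z\|=1$. -/

import Mathlib

attribute [local instance] LieRing.ofAssociativeRing

namespace EffEqui

open TrivSqZeroExt

/-- The group of `N × N` matrices of determinant one over `R`. -/
abbrev SL (N : ℕ) (R : Type) [CommRing R] : Type := Matrix.SpecialLinearGroup (Fin N) R

/-- The common zeros in `SL_N(R)` of a set of rational polynomials in the matrix entries. -/
def zeroLocus {N : ℕ} (E : Set (MvPolynomial (Fin N × Fin N) ℚ)) (R : Type) [CommRing R]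
    [Algebra ℚ R] : Set (SL N R) :=
  {A | ∀ q ∈ E, MvPolynomial.aeval
    (fun ij : Fin N × Fin N => (A : Matrix (Fin N) (Fin N) R) ij.1 ij.2) q = 0}

/-- An algebraic `ℚ`-subgroup of `SL_N`: a system of rational polynomial equations whose solutions
form a subgroup of `SL_N(R)` for every commutative `ℚ`-algebra `R`. -/
structure QGroup (N : ℕ) where
  eqs : Set (MvPolynomial (Fin N × Fin N) ℚ)
  one_mem' : ∀ (R : Type) [CommRing R] [Algebra ℚ R], (1 : SL N R) ∈ zeroLocus eqs R
  mul_mem' : ∀ (R : Type) [CommRing R] [Algebra ℚ R] (A B : SL N R),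
    A ∈ zeroLocus eqs R → B ∈ zeroLocus eqs R → A * B ∈ zeroLocus eqs R
  inv_mem' : ∀ (R : Type) [CommRing R] [Algebra ℚ R] (A : SL N R),
    A ∈ zeroLocus eqs R → A⁻¹ ∈ zeroLocus eqs R

namespace QGroup

variable {N : ℕ} (GG : QGroup N)

/-- The group of `R`-points. -/
def points (R : Type) [CommRing R] [Algebra ℚ R] : Subgroup (SL N R) where
  carrier := zeroLocus GG.eqs R
  mul_mem' := fun {A B} hA hB => GG.mul_mem' R A B hA hB
  one_mem' := GG.one_mem' R
  inv_mem' := fun {A} hA => GG.inv_mem' R A hA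

/-- The ideal of the polynomial ring over `ℚ` generated by the equations of the group, including
`det = 1`. -/
noncomputable def ideal : Ideal (MvPolynomial (Fin N × Fin N) ℚ) :=
  Ideal.span (GG.eqs ∪ {(Matrix.mvPolynomialX (Fin N) (Fin N) ℚ).det - 1})

/-- The group is connected (as a scheme): the spectrum of its coordinate ring is connected. -/
def IsConnected : Prop :=
  ConnectedSpace (PrimeSpectrum (MvPolynomial (Fin N × Fin N) ℚ ⧸ GG.ideal))

theorem map_mem {R S : Type} [CommRing R] [Algebra ℚ R] [CommRing S] [Algebra ℚ S]
    (f : R →ₐ[ℚ] S) {A : SL N R} (hA : A ∈ GG.points R) :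
    Matrix.SpecialLinearGroup.map (f : R →+* S) A ∈ GG.points S := by
  intro q hq
  have h := congrArg f (hA q hq)
  rw [map_zero] at h
  exact (MvPolynomial.comp_aeval_apply _ f q).symm.trans h

theorem descend {R S : Type} [CommRing R] [Algebra ℚ R] [CommRing S] [Algebra ℚ S]
    (f : R →ₐ[ℚ] S) (hf : Function.Injective f) (M : Matrix (Fin N) (Fin N) R) {A : SL N S}
    (hA : A ∈ GG.points S) (h : A.1 = M.map f) : ∃ B ∈ GG.points R, B.1 = M := by
  have hd : M.det = 1 := by
    apply hf
    rw [map_one, ← A.2, h]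
    exact f.toRingHom.map_det M
  refine ⟨⟨M, hd⟩, fun q hq => hf ?_, rfl⟩
  have h1 := hA q hq
  rw [h] at h1
  rw [map_zero]
  exact (MvPolynomial.comp_aeval_apply (fun ij : Fin N × Fin N => M ij.1 ij.2) f q).trans h1

theorem inr_mul_inr_matrix {R : Type} [CommRing R] (X Y : Matrix (Fin N) (Fin N) R) :
    (X.map inr : Matrix (Fin N) (Fin N) (DualNumber R)) * Y.map inr = 0 := by
  ext i j <;> simp [Matrix.mul_apply]

/-- The inclusion `ε ↦ ε₁ ε₂` of dual numbers into doubly dual numbers. -/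
noncomputable def dbl : DualNumber ℝ →ₐ[ℚ] DualNumber (DualNumber ℝ) where
  toFun a := inl (inl a.fst) + inr (inr a.snd)
  map_one' := by ext <;> simp
  map_mul' a b := by ext <;> simp [mul_comm]
  map_zero' := by ext <;> simp
  map_add' a b := by ext <;> simp
  commutes' r := by
    ext <;> simp [TrivSqZeroExt.algebraMap_eq_inl']

/-- The inclusion of constants into the dual numbers. -/
noncomputable def cst (R : Type) [CommRing R] [Algebra ℚ R] : R →ₐ[ℚ] DualNumber R where
  toFun a := inl a
  map_one' := by ext <;> simp
  map_mul' a b := by ext <;> simp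
  map_zero' := by ext <;> simp
  map_add' a b := by ext <;> simp
  commutes' r := by
    ext <;> simp [TrivSqZeroExt.algebraMap_eq_inl']

/-- `ε ↦ ε₂`, the outer variable. -/
noncomputable def outer {R S : Type} [CommRing R] [CommRing S] [Algebra ℚ R] [Algebra ℚ S]
    (f : R →ₐ[ℚ] S) : DualNumber R →ₐ[ℚ] DualNumber S where
  toFun a := inl (f a.fst) + inr (f a.snd)
  map_one' := by ext <;> simp
  map_mul' a b := by ext <;> simp
  map_zero' := by ext <;> simp
  map_add' a b := by ext <;> simp
  commutes' r := by
    ext <;> simp [TrivSqZeroExt.algebraMap_eq_inl']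


/-- The matrix of the `R`-point `1 + ε X`. -/
def tangent {R : Type} [CommRing R] (X : Matrix (Fin N) (Fin N) R) :
    Matrix (Fin N) (Fin N) (DualNumber R) := 1 + X.map inr

theorem tangent_mul {R : Type} [CommRing R] (X Y : Matrix (Fin N) (Fin N) R) :
    tangent X * tangent Y = tangent (X + Y) := by
  have h : ((X + Y).map inr : Matrix (Fin N) (Fin N) (DualNumber R)) = X.map inr + Y.map inr := by
    ext i j <;> simp
  simp only [tangent, h, mul_add, add_mul, inr_mul_inr_matrix, one_mul, mul_one]
  abel

theorem tangent_map {R S : Type} [CommRing R] [CommRing S] [Algebra ℚ R] [Algebra ℚ S]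
    (f : R →ₐ[ℚ] S) (X : Matrix (Fin N) (Fin N) R) :
    (tangent X).map (outer f) = tangent (X.map f) := by
  ext i j <;> by_cases h : i = j <;> simp [tangent, outer, h]

/-- The set of real matrices `X` such that `1 + ε X` is a point over the dual numbers. -/
def IsTangent (X : Matrix (Fin N) (Fin N) ℝ) : Prop :=
  ∃ A ∈ GG.points (DualNumber ℝ), A.1 = tangent X

variable {GG}

theorem IsTangent.add {X Y : Matrix (Fin N) (Fin N) ℝ} (hX : GG.IsTangent X)
    (hY : GG.IsTangent Y) : GG.IsTangent (X + Y) := by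
  obtain ⟨A, hA, hAX⟩ := hX
  obtain ⟨B, hB, hBY⟩ := hY
  refine ⟨A * B, mul_mem hA hB, ?_⟩
  rw [← tangent_mul, ← hAX, ← hBY]
  rfl

theorem isTangent_zero : GG.IsTangent (0 : Matrix (Fin N) (Fin N) ℝ) := by
  refine ⟨1, one_mem _, ?_⟩
  ext i j <;> simp [tangent]

theorem IsTangent.smul (c : ℝ) {X : Matrix (Fin N) (Fin N) ℝ} (hX : GG.IsTangent X) :
    GG.IsTangent (c • X) := by
  obtain ⟨A, hA, hAX⟩ := hX
  refine ⟨_, GG.map_mem ((TrivSqZeroExt.map (c • LinearMap.id : ℝ →ₗ[ℝ] ℝ)).restrictScalars ℚ) hA,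
    ?_⟩
  have : (Matrix.SpecialLinearGroup.map
      (((TrivSqZeroExt.map (c • LinearMap.id : ℝ →ₗ[ℝ] ℝ)).restrictScalars ℚ :
        DualNumber ℝ →ₐ[ℚ] DualNumber ℝ) : DualNumber ℝ →+* DualNumber ℝ) A).1
      = (A.1).map (TrivSqZeroExt.map (c • LinearMap.id : ℝ →ₗ[ℝ] ℝ)) := rfl
  rw [this, hAX]
  ext i j <;> by_cases h : i = j <;> simp [tangent, h, mul_comm]

theorem IsTangent.conj {X : Matrix (Fin N) (Fin N) ℝ} (hX : GG.IsTangent X) {g : SL N ℝ}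
    (hg : g ∈ GG.points ℝ) : GG.IsTangent (g.1 * X * (g⁻¹).1) := by
  obtain ⟨A, hA, hAX⟩ := hX
  have hg' := GG.map_mem (cst ℝ) hg
  have hgi := GG.map_mem (cst ℝ) (inv_mem hg)
  refine ⟨_, mul_mem (mul_mem hg' hA) hgi, ?_⟩
  have h1 : ∀ M : Matrix (Fin N) (Fin N) ℝ, (M.map inr : Matrix _ _ (DualNumber ℝ))
      = (DualNumber.eps : DualNumber ℝ) • M.map inl := by
    intro M
    ext i j <;> simp
  have h2 : (g.1.map inl : Matrix _ _ (DualNumber ℝ)) * (g⁻¹).1.map inl = 1 := by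
    have := congrArg Subtype.val (mul_inv_cancel g)
    have h3 := congrArg (fun M : Matrix _ _ ℝ => M.map (TrivSqZeroExt.inlHom ℝ ℝ)) this
    simp only [Matrix.SpecialLinearGroup.coe_mul, Matrix.map_mul] at h3
    refine Eq.trans h3 ?_
    exact Matrix.map_one _ (map_zero _) (map_one _)
  have h4 : ((g.1 * X * (g⁻¹).1).map inl : Matrix _ _ (DualNumber ℝ))
      = g.1.map inl * X.map inl * (g⁻¹).1.map inl := by
    have : ((g.1 * X * (g⁻¹).1).map (TrivSqZeroExt.inlHom ℝ ℝ) : Matrix _ _ (DualNumber ℝ))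
      = g.1.map (TrivSqZeroExt.inlHom ℝ ℝ) * X.map (TrivSqZeroExt.inlHom ℝ ℝ)
        * (g⁻¹).1.map (TrivSqZeroExt.inlHom ℝ ℝ) := by
      rw [Matrix.map_mul, Matrix.map_mul]
    exact this
  change g.1.map inl * A.1 * (g⁻¹).1.map inl = _
  rw [hAX, tangent, tangent, h1, h1, h4, mul_add, add_mul, mul_one, h2]
  simp [Matrix.mul_smul, Matrix.smul_mul]

/-- The first of two independent infinitesimals. -/
def e₁ : DualNumber (DualNumber ℝ) := inl (inr 1)

/-- The second of two independent infinitesimals. -/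
def e₂ : DualNumber (DualNumber ℝ) := inr (inl 1)

/-- The inclusion of constants into doubly dual numbers. -/
noncomputable def dblCst : ℝ →+* DualNumber (DualNumber ℝ) :=
  (TrivSqZeroExt.inlHom (DualNumber ℝ) (DualNumber ℝ)).comp (TrivSqZeroExt.inlHom ℝ ℝ)

theorem e₁_sq : e₁ * e₁ = 0 := by ext <;> simp [e₁]

theorem e₂_sq : e₂ * e₂ = 0 := by ext <;> simp [e₂]

theorem map_e₁ (X : Matrix (Fin N) (Fin N) ℝ) :
    X.map (fun a => (inl (inr a) : DualNumber (DualNumber ℝ))) = e₁ • X.map dblCst := by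
  ext i j <;> simp [e₁, dblCst]

theorem map_e₂ (X : Matrix (Fin N) (Fin N) ℝ) :
    X.map (fun a => (inr (inl a) : DualNumber (DualNumber ℝ))) = e₂ • X.map dblCst := by
  ext i j <;> simp [e₂, dblCst]

theorem tangent_map_dbl (Z : Matrix (Fin N) (Fin N) ℝ) :
    (tangent Z).map dbl = 1 + (e₁ * e₂) • Z.map dblCst := by
  ext i j <;> by_cases h : i = j <;> simp [tangent, dbl, e₁, e₂, dblCst, h]

theorem comm_identity {R : Type} [CommRing R] {a b : R} (ha : a * a = 0) (hb : b * b = 0)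
    (M L : Matrix (Fin N) (Fin N) R) : (1 + a • M) * (1 + b • L)
      = (1 + (a * b) • (M * L - L * M)) * ((1 + b • L) * (1 + a • M)) := by
  have h121 : a * b * a = 0 := by rw [mul_right_comm, ha, zero_mul]
  have h122 : a * b * b = 0 := by rw [mul_assoc, hb, mul_zero]
  have h3 : a * b * (a * b) = 0 := by rw [← mul_assoc, h121, zero_mul]
  simp only [mul_add, add_mul, mul_one, one_mul, smul_mul_smul_comm, smul_sub, mul_comm b a,
    sub_mul, h121, h122, h3, zero_smul]
  abel

theorem exists_commutator {S : Type} [CommRing S] [Algebra ℚ S] {P Q : SL N S}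
    (hP : P ∈ GG.points S) (hQ : Q ∈ GG.points S) {a b : S} (ha : a * a = 0) (hb : b * b = 0)
    {M L : Matrix (Fin N) (Fin N) S} (hPm : P.1 = 1 + a • M) (hQm : Q.1 = 1 + b • L) :
    ∃ C ∈ GG.points S, C.1 = 1 + (a * b) • (M * L - L * M) := by
  refine ⟨P * Q * (Q * P)⁻¹, mul_mem (mul_mem hP hQ) (inv_mem (mul_mem hQ hP)), ?_⟩
  have h1 : (P * Q * (Q * P)⁻¹).1 = P.1 * Q.1 * ((Q * P)⁻¹).1 := rfl
  have h2 : (Q * P).1 = Q.1 * P.1 := rfl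
  rw [h1, hPm, hQm, comm_identity ha hb, ← hPm, ← hQm, ← h2, mul_assoc,
    ← Matrix.SpecialLinearGroup.coe_mul, mul_inv_cancel]
  simp

theorem dbl_injective : Function.Injective dbl := by
  intro a b hab
  have h1 := congrArg (fun c => c.fst.fst) hab
  have h2 := congrArg (fun c => c.snd.snd) hab
  simp [dbl] at h1 h2
  exact TrivSqZeroExt.ext h1 h2

theorem tangent_inner (X : Matrix (Fin N) (Fin N) ℝ) :
    (tangent X).map (cst (DualNumber ℝ)) = 1 + e₁ • X.map dblCst := by
  rw [← map_e₁]
  ext i j <;> by_cases h : i = j <;> simp [tangent, cst, h]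

theorem tangent_outer (X : Matrix (Fin N) (Fin N) ℝ) :
    (tangent X).map (outer (cst ℝ)) = 1 + e₂ • X.map dblCst := by
  rw [← map_e₂]
  ext i j <;> by_cases h : i = j <;> simp [tangent, outer, cst, h]

theorem IsTangent.bracket {X Y : Matrix (Fin N) (Fin N) ℝ} (hX : GG.IsTangent X)
    (hY : GG.IsTangent Y) : GG.IsTangent (X * Y - Y * X) := by
  obtain ⟨A, hA, hAX⟩ := hX
  obtain ⟨B, hB, hBY⟩ := hY
  have hP := GG.map_mem (S := DualNumber (DualNumber ℝ)) (cst (DualNumber ℝ)) hA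
  have hQ := GG.map_mem (S := DualNumber (DualNumber ℝ)) (outer (cst ℝ)) hB
  obtain ⟨C, hC, hCm⟩ := exists_commutator hP hQ e₁_sq e₂_sq
    ((congrArg (fun M => M.map (cst (DualNumber ℝ))) hAX).trans (tangent_inner X))
    ((congrArg (fun M => M.map (outer (cst ℝ))) hBY).trans (tangent_outer Y))
  refine GG.descend dbl dbl_injective _ hC ?_
  rw [hCm, tangent_map_dbl, Matrix.map_sub dblCst (fun _ _ => map_sub dblCst _ _), Matrix.map_mul,
    Matrix.map_mul]

/-- The coordinate ring of the base change of the group to `ℝ`. -/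
noncomputable def realIdeal (GG : QGroup N) : Ideal (MvPolynomial (Fin N × Fin N) ℝ) :=
  GG.ideal.map (MvPolynomial.map (algebraMap ℚ ℝ))

/-- The invariant derivation of the polynomial ring attached to a matrix. -/
noncomputable def invDer (X : Matrix (Fin N) (Fin N) ℝ) :
    Derivation ℝ (MvPolynomial (Fin N × Fin N) ℝ) (MvPolynomial (Fin N × Fin N) ℝ) :=
  MvPolynomial.mkDerivation ℝ
    (fun ij => ∑ k, MvPolynomial.X (ij.1, k) * MvPolynomial.C (X k ij.2))

theorem aeval_dual {A : Type} [CommRing A] [Algebra ℝ A] (M : Fin N × Fin N → A)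
    (X : Matrix (Fin N) (Fin N) ℝ) (q : MvPolynomial (Fin N × Fin N) ℝ) :
    MvPolynomial.aeval (fun ij => (inl (M ij) + inr (MvPolynomial.aeval M (invDer X
      (MvPolynomial.X ij))) : DualNumber A)) q
    = inl (MvPolynomial.aeval M q) + inr (MvPolynomial.aeval M (invDer X q)) := by
  induction q using MvPolynomial.induction_on with
  | C a =>
    ext <;> simp [invDer, TrivSqZeroExt.algebraMap_eq_inl']
  | add p q hp hq => 
    rw [map_add, hp, hq]
    ext <;> simp
  | mul_X p i hp =>
    rw [map_mul, hp]
    ext <;> simp [mul_comm, add_comm]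

theorem aeval_eq_zero {R : Type} [CommRing R] [Algebra ℚ R] {A : SL N R} (hA : A ∈ GG.points R)
    {q : MvPolynomial (Fin N × Fin N) ℚ}
    (hq : q ∈ GG.eqs ∪ {(Matrix.mvPolynomialX (Fin N) (Fin N) ℚ).det - 1}) :
    MvPolynomial.aeval (fun ij : Fin N × Fin N => (A : Matrix (Fin N) (Fin N) R) ij.1 ij.2) q
      = 0 := by
  rcases hq with hq | hq
  · exact hA q hq
  · rw [Set.mem_singleton_iff] at hq
    rw [hq, map_sub, map_one, AlgHom.map_det, Matrix.mvPolynomialX_mapMatrix_aeval, A.2, sub_self]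

theorem mem_points_of_aeval {R : Type} [CommRing R] [Algebra ℚ R] {M : Matrix (Fin N) (Fin N) R}
    (h : ∀ q ∈ GG.eqs ∪ {(Matrix.mvPolynomialX (Fin N) (Fin N) ℚ).det - 1},
      MvPolynomial.aeval (fun ij : Fin N × Fin N => M ij.1 ij.2) q = 0) :
    ∃ A ∈ GG.points R, (A : Matrix (Fin N) (Fin N) R) = M := by
  have hd : M.det = 1 := by
    have := h _ (Or.inr rfl)
    rw [map_sub, map_one, AlgHom.map_det, Matrix.mvPolynomialX_mapMatrix_aeval] at this
    exact sub_eq_zero.1 this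
  exact ⟨⟨M, hd⟩, fun q hq => h q (Or.inl hq), rfl⟩

theorem realIdeal_eq : GG.realIdeal = Ideal.span (MvPolynomial.map (algebraMap ℚ ℝ) ''
    (GG.eqs ∪ {(Matrix.mvPolynomialX (Fin N) (Fin N) ℚ).det - 1})) := by
  rw [realIdeal, ideal, Ideal.map_span]

theorem invDer_mem {X : Matrix (Fin N) (Fin N) ℝ} (hX : GG.IsTangent X)
    {q : MvPolynomial (Fin N × Fin N) ℝ} (hq : q ∈ GG.realIdeal) : invDer X q ∈ GG.realIdeal := by
  have hgen : ∀ q₀ ∈ GG.eqs ∪ {(Matrix.mvPolynomialX (Fin N) (Fin N) ℚ).det - 1},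
      invDer X (MvPolynomial.map (algebraMap ℚ ℝ) q₀) ∈ GG.realIdeal := by
    intro q₀ hq₀
    let A : Type := MvPolynomial (Fin N × Fin N) ℝ ⧸ GG.realIdeal
    let mk : MvPolynomial (Fin N × Fin N) ℝ →ₐ[ℝ] A := Ideal.Quotient.mkₐ ℝ GG.realIdeal
    let ξ : Fin N × Fin N → A := fun ij => mk (MvPolynomial.X ij)
    have hξ : ∀ q, MvPolynomial.aeval ξ q = mk q := by
      intro q
      have h := MvPolynomial.comp_aeval_apply
        (MvPolynomial.X : Fin N × Fin N → MvPolynomial (Fin N × Fin N) ℝ) mk q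
      rw [MvPolynomial.aeval_X_left_apply] at h
      exact h.symm
    obtain ⟨P, hP, hPm⟩ := mem_points_of_aeval (GG := GG) (R := A)
      (M := fun i j => ξ (i, j)) (by
        intro q hq
        have h1 := MvPolynomial.aeval_map_algebraMap (A := ℝ) ξ q
        refine h1.symm.trans ?_
        rw [hξ]
        refine Ideal.Quotient.eq_zero_iff_mem.2 ?_
        rw [realIdeal_eq]
        exact Ideal.subset_span ⟨q, hq, rfl⟩)
    obtain ⟨T, hT, hTm⟩ := hX
    have hT' := GG.map_mem (S := DualNumber A) (outer ((Algebra.ofId ℝ A).restrictScalars ℚ)) hT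
    have hP' := GG.map_mem (S := DualNumber A) (cst A) hP
    have h0 := aeval_eq_zero (mul_mem hP' hT') hq₀
    rw [← MvPolynomial.aeval_map_algebraMap (A := ℝ)] at h0
    have h2 := aeval_dual ξ X (MvPolynomial.map (algebraMap ℚ ℝ) q₀)
    have hent : (fun ij : Fin N × Fin N => ((Matrix.SpecialLinearGroup.map (S := DualNumber A)
        (cst A : A →+* DualNumber A) P * Matrix.SpecialLinearGroup.map (S := DualNumber A)
        (outer ((Algebra.ofId ℝ A).restrictScalars ℚ) : DualNumber ℝ →+* DualNumber A) T :
          SL N (DualNumber A)) : Matrix (Fin N) (Fin N) (DualNumber A)) ij.1 ij.2)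
        = fun ij => (inl (ξ ij) + inr (MvPolynomial.aeval ξ (invDer X
      (MvPolynomial.X ij))) : DualNumber A) := by
      funext ⟨i, j⟩
      have e1 : ((Matrix.SpecialLinearGroup.map (S := DualNumber A) (cst A : A →+* DualNumber A) P : SL N _) :
          Matrix (Fin N) (Fin N) (DualNumber A)) = Matrix.of fun i j => inl (ξ (i, j)) := by
        change (P : Matrix (Fin N) (Fin N) A).map inl = _
        rw [hPm]
        rfl
      have e2 : ((Matrix.SpecialLinearGroup.map (S := DualNumber A) (outer ((Algebra.ofId ℝ A).restrictScalars ℚ) :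
          DualNumber ℝ →+* DualNumber A) T : SL N _) : Matrix (Fin N) (Fin N) (DualNumber A))
          = tangent (X.map (algebraMap ℝ A)) := by
        change (T.1).map (outer ((Algebra.ofId ℝ A).restrictScalars ℚ)) = _
        rw [hTm, tangent_map]
        rfl
      rw [Matrix.SpecialLinearGroup.coe_mul, e1, e2, tangent, mul_add, mul_one, invDer,
        MvPolynomial.mkDerivation_X]
      ext <;> simp [Matrix.mul_apply, TrivSqZeroExt.fst_sum, TrivSqZeroExt.snd_sum, ξ]
    rw [hent, h2] at h0
    have h3 := congrArg TrivSqZeroExt.snd h0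
    simp only [snd_add, snd_inl, snd_inr, zero_add, snd_zero, hξ] at h3
    exact Ideal.Quotient.eq_zero_iff_mem.1 h3
  rw [realIdeal_eq] at hq
  induction hq using Submodule.span_induction with
  | mem x hx =>
    obtain ⟨q₀, hq₀, rfl⟩ := hx
    exact hgen q₀ hq₀
  | zero => simp
  | add x y _ _ hx hy => rw [map_add]; exact add_mem hx hy
  | smul a x hx' hx =>
    rw [smul_eq_mul, Derivation.leibniz, smul_eq_mul, smul_eq_mul]
    refine add_mem (Ideal.mul_mem_left _ _ hx) (Ideal.mul_mem_right _ _ ?_)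
    rw [realIdeal_eq]
    exact hx'

section

open scoped Matrix.Norms.Operator

theorem hasDerivAt_aeval_exp (X : Matrix (Fin N) (Fin N) ℝ) (q : MvPolynomial (Fin N × Fin N) ℝ)
    (t : ℝ) :
    HasDerivAt (fun t : ℝ => MvPolynomial.aeval
      (fun ij : Fin N × Fin N => (NormedSpace.exp (t • X)) ij.1 ij.2) q)
      (MvPolynomial.aeval (fun ij : Fin N × Fin N => (NormedSpace.exp (t • X)) ij.1 ij.2)
        (invDer X q)) t := by
  induction q using MvPolynomial.induction_on with
  | C a => simpa [invDer] using hasDerivAt_const t a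
  | add p q hp hq =>
    simp only [map_add]
    exact hp.add hq
  | mul_X p i hp =>
    have h1 := hasDerivAt_exp_smul_const (𝕂 := ℝ) X t
    have h2 : HasDerivAt (fun t : ℝ => (NormedSpace.exp (t • X)) i.1 i.2)
        ((NormedSpace.exp (t • X) * X) i.1 i.2) t := by
      have h3 := (hasDerivAt_pi.1 h1 i.1)
      exact hasDerivAt_pi.1 h3 i.2
    have h4 := hp.mul h2
    simp only [map_mul, MvPolynomial.aeval_X, Derivation.leibniz, smul_eq_mul, map_add]
    convert! h4 using 1
    simp [invDer, Matrix.mul_apply]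
    ring

theorem aeval_exp_eq_zero {X : Matrix (Fin N) (Fin N) ℝ} (hX : GG.IsTangent X)
    {q : MvPolynomial (Fin N × Fin N) ℝ} (hq : q ∈ GG.realIdeal) (t : ℝ) :
    MvPolynomial.aeval (fun ij : Fin N × Fin N => (NormedSpace.exp (t • X)) ij.1 ij.2) q
      = (0 : ℝ) := by
  set φ : MvPolynomial (Fin N × Fin N) ℝ → ℝ → ℝ := fun q t => MvPolynomial.aeval
      (fun ij : Fin N × Fin N => (NormedSpace.exp (t • X)) ij.1 ij.2) q with hφ
  have hone : ∀ q ∈ GG.realIdeal, φ q 0 = 0 := by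
    intro q hq
    rw [realIdeal_eq] at hq
    induction hq using Submodule.span_induction with
    | mem x hx =>
      obtain ⟨q₀, hq₀, rfl⟩ := hx
      have h1 := aeval_eq_zero (one_mem (GG.points ℝ)) hq₀
      rw [← MvPolynomial.aeval_map_algebraMap (A := ℝ)] at h1
      simpa [hφ] using h1
    | zero => simp [hφ]
    | add x y _ _ hx hy =>
      simp only [hφ, map_add] at hx hy ⊢
      rw [hx, hy, add_zero]
    | smul a x _ hx =>
      simp only [hφ, smul_eq_mul, map_mul] at hx ⊢
      rw [hx, mul_zero]
  have hder : ∀ n : ℕ, ∀ q ∈ GG.realIdeal, iteratedDeriv n (φ q) 0 = 0 := by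
    intro n
    induction n with
    | zero => simpa using hone
    | succ n ih =>
      intro q hq
      have : deriv (φ q) = φ (invDer X q) := by
        funext t
        exact (hasDerivAt_aeval_exp X q t).deriv
      rw [iteratedDeriv_succ', this]
      exact ih _ (invDer_mem hX hq)
  have han : AnalyticOnNhd ℝ (φ q) Set.univ := by
    refine AnalyticOnNhd.aeval_mvPolynomial (fun ij t _ => ?_) q
    have h1 : AnalyticAt ℝ (fun t : ℝ => NormedSpace.exp (t • X)) t := by
      have h2 : AnalyticAt ℝ (fun t : ℝ => t • X) t := analyticAt_id.smul analyticAt_const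
      exact AnalyticAt.comp (g := NormedSpace.exp) (f := fun t : ℝ => t • X)
        (NormedSpace.exp_analytic (𝕂 := ℝ) (t • X)) h2
    let L : Matrix (Fin N) (Fin N) ℝ →ₗ[ℝ] ℝ :=
      { toFun := fun M => M ij.1 ij.2, map_add' := fun _ _ => rfl, map_smul' := fun _ _ => rfl }
    exact (L.toContinuousLinearMap.analyticAt _).comp h1
  have hev : φ q =ᶠ[nhds 0] 0 := by
    have h1 := (han 0 (Set.mem_univ _)).hasFPowerSeriesAt
    have h2 : FormalMultilinearSeries.ofScalars ℝ
        (fun n ↦ iteratedDeriv n (φ q) 0 / n.factorial) = 0 := by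
      ext n
      simp [FormalMultilinearSeries.ofScalars, hder n q hq]
    rw [h2] at h1
    exact h1.eventually_eq_zero
  have := han.eqOn_zero_of_preconnected_of_eventuallyEq_zero isPreconnected_univ
    (Set.mem_univ 0) hev (Set.mem_univ t)
  exact this

end

theorem IsTangent.exp_mem {X : Matrix (Fin N) (Fin N) ℝ} (hX : GG.IsTangent X) :
    ∃ A ∈ GG.points ℝ, (A : Matrix (Fin N) (Fin N) ℝ) = NormedSpace.exp X := by
  refine mem_points_of_aeval fun q hq => ?_
  rw [← MvPolynomial.aeval_map_algebraMap (A := ℝ)]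
  have h := aeval_exp_eq_zero hX (q := MvPolynomial.map (algebraMap ℚ ℝ) q)
    (by rw [realIdeal_eq]; exact Ideal.subset_span ⟨q, hq, rfl⟩) 1
  simpa using h

variable (GG)

/-- The Lie algebra of the real points: the matrices `X` for which `1 + ε X` is a point over the
real dual numbers. -/
noncomputable def lie : LieSubalgebra ℝ (Matrix (Fin N) (Fin N) ℝ) where
  carrier := {X | GG.IsTangent X}
  add_mem' := fun hX hY => IsTangent.add hX hY
  zero_mem' := isTangent_zero
  smul_mem' := fun c _ hX => IsTangent.smul c hX
  lie_mem' := fun hX hY => IsTangent.bracket hX hY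

variable {GG}

/-- The exponential map from the Lie algebra to the group of real points. -/
noncomputable def exp (Z : GG.lie) : GG.points ℝ :=
  ⟨⟨NormedSpace.exp (Z : Matrix (Fin N) (Fin N) ℝ), by
      obtain ⟨A, _, h⟩ := IsTangent.exp_mem Z.2
      exact h ▸ A.2⟩, by
      obtain ⟨A, hA, h⟩ := IsTangent.exp_mem Z.2
      have : A = ⟨NormedSpace.exp (Z : Matrix (Fin N) (Fin N) ℝ), h ▸ A.2⟩ := Subtype.ext h
      exact this ▸ hA⟩

/-- The adjoint action `X ↦ g X g⁻¹`. -/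
noncomputable def Ad (g : GG.points ℝ) (Z : GG.lie) : GG.lie :=
  ⟨(g : SL N ℝ).1 * (Z : Matrix (Fin N) (Fin N) ℝ) * ((g : SL N ℝ)⁻¹).1,
    IsTangent.conj Z.2 g.2⟩

end QGroup

/-- The inclusion of `SL_N(ℤ)` into `SL_N(ℝ)`. -/
noncomputable def intToReal (N : ℕ) : SL N ℤ →* SL N ℝ := Matrix.SpecialLinearGroup.map (Int.castRingHom ℝ)

namespace QGroup

variable {N : ℕ} (GG : QGroup N)

/-- `Γ` is a congruence subgroup of the group of integral points: it consists of integral points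
and contains all integral points congruent to the identity modulo some `m ≥ 1`. -/
def IsCongruence (Γ : Subgroup (SL N ℤ)) : Prop :=
  (∀ γ ∈ Γ, intToReal N γ ∈ GG.points ℝ) ∧
  ∃ m : ℕ, 0 < m ∧ ∀ γ : SL N ℤ, intToReal N γ ∈ GG.points ℝ →
    Matrix.SpecialLinearGroup.map (Int.castRingHom (ZMod m)) γ = 1 → γ ∈ Γ

/-- `Γ` as a subgroup of the group of real points. -/
noncomputable def discrete (Γ : Subgroup (SL N ℤ)) : Subgroup (GG.points ℝ) :=
  (Γ.map (intToReal N)).subgroupOf (GG.points ℝ)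

/-- The quotient `Γ \ G` of the group of real points, with the quotient topology. -/
noncomputable def Space (Γ : Subgroup (SL N ℤ)) : Type := Quotient (QuotientGroup.rightRel (GG.discrete Γ))

variable {GG} {Γ : Subgroup (SL N ℤ)}

instance : TopologicalSpace (GG.Space Γ) :=
  inferInstanceAs (TopologicalSpace (Quotient (QuotientGroup.rightRel (GG.discrete Γ))))

instance : MeasurableSpace (GG.Space Γ) := borel _

instance : BorelSpace (GG.Space Γ) := ⟨rfl⟩

/-- The point `Γ g`. -/
noncomputable def proj (Γ : Subgroup (SL N ℤ)) (g : GG.points ℝ) : GG.Space Γ :=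
  Quotient.mk (QuotientGroup.rightRel (GG.discrete Γ)) g

/-- The right action `(Γ a, g) ↦ Γ a g`. -/
noncomputable def act (x : GG.Space Γ) (g : GG.points ℝ) : GG.Space Γ :=
  Quotient.map (sa := QuotientGroup.rightRel (GG.discrete Γ))
    (sb := QuotientGroup.rightRel (GG.discrete Γ)) (fun a => a * g) (by
      intro a b h
      have h' := QuotientGroup.rightRel_apply.1 h
      refine QuotientGroup.rightRel_apply.2 ?_
      simpa [mul_assoc] using h') x

end QGroup

/-- A Euclidean norm on the `N × N` matrices (given by its inner product) with
`‖[X, Y]‖ ≤ ‖X‖ ‖Y‖`. -/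
structure EuclideanNorm (N : ℕ) where
  form : LinearMap.BilinForm ℝ (Matrix (Fin N) (Fin N) ℝ)
  symm : ∀ X Y, form X Y = form Y X
  pos : ∀ X, X ≠ 0 → 0 < form X X
  bracket_le : ∀ X Y, √(form (X * Y - Y * X) (X * Y - Y * X)) ≤ √(form X X) * √(form Y Y)

/-- The norm itself. -/
noncomputable def EuclideanNorm.norm {N : ℕ} (E : EuclideanNorm N)
    (X : Matrix (Fin N) (Fin N) ℝ) : ℝ := √(E.form X X)

namespace QGroup

open MeasureTheory
open scoped ContDiff

variable {N : ℕ} {GG : QGroup N} {Γ : Subgroup (SL N ℤ)}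

/-- The height in the cusp of `x = Γ g`: the supremum of `‖v‖⁻¹` over the non-zero
`v ∈ Ad(g⁻¹) 𝔤_ℤ`, where `𝔤_ℤ` is the set of integral matrices in the Lie algebra. (The set below
does not depend on the representative `g`, since `Γ` consists of integral matrices.) -/
noncomputable def height (E : EuclideanNorm N) (x : GG.Space Γ) : ℝ :=
  sSup {c : ℝ | ∃ (g : GG.points ℝ) (v : GG.lie), proj Γ g = x ∧ v ≠ 0 ∧
    (∀ i j, ∃ n : ℤ, (v : Matrix (Fin N) (Fin N) ℝ) i j = n) ∧ c = (E.norm (Ad g⁻¹ v))⁻¹}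

/-- Smooth compactly supported real functions on `Γ \ G`; smoothness is expressed in exponential
coordinates around each point. -/
structure IsTestFunction (f : GG.Space Γ → ℝ) : Prop where
  continuous : Continuous f
  hasCompactSupport : HasCompactSupport f
  smooth : ∀ (x : GG.Space Γ) (n : ℕ) (L : (Fin n → ℝ) →ₗ[ℝ] GG.lie),
    ContDiff ℝ ∞ (fun a : Fin n → ℝ => f (act x (exp (L a))))

/-- The derivative of `f` in the direction of the left-invariant vector field of `Z`. -/
noncomputable def lieDeriv (Z : GG.lie) (f : GG.Space Γ → ℝ) (x : GG.Space Γ) : ℝ :=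
  deriv (fun t : ℝ => f (act x (exp (t • Z)))) 0

/-- An orthonormal basis of the Lie algebra. -/
def IsOrthonormal (E : EuclideanNorm N)
    (b : Module.Basis (Fin (Module.finrank ℝ GG.lie)) ℝ GG.lie) : Prop :=
  ∀ i j, E.form (b i) (b j) = if i = j then 1 else 0

/-- The differential operator of the monomial `b (w 0) b (w 1) ⋯ b (w (k - 1))`. -/
noncomputable def monomialDeriv (b : Module.Basis (Fin (Module.finrank ℝ GG.lie)) ℝ GG.lie)
    {k : ℕ} (w : Fin k → Fin (Module.finrank ℝ GG.lie)) (f : GG.Space Γ → ℝ) : GG.Space Γ → ℝ :=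
  (List.ofFn w).foldr (fun i F => lieDeriv (b i) F) f

/-- The `L²`-Sobolev norm of degree `d`:
`S_d(f)² = ∑_D ‖(height + 1)^d D f‖²`, over the monomials `D` of degree at most `d`. -/
noncomputable def sobolev (E : EuclideanNorm N)
    (b : Module.Basis (Fin (Module.finrank ℝ GG.lie)) ℝ GG.lie) (m : Measure (GG.Space Γ))
    (d : ℕ) (f : GG.Space Γ → ℝ) : ℝ :=
  √(∑ k ∈ Finset.range (d + 1), ∑ w : Fin k → Fin (Module.finrank ℝ GG.lie),
    ∫ x, ((height E x + 1) ^ d * monomialDeriv b w f x) ^ 2 ∂m)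

/-- A `G`-invariant (Haar) measure on `Γ \ G`, with any normalization. -/
structure IsInvariantMeasure (m : Measure (GG.Space Γ)) : Prop where
  ne_zero : m ≠ 0
  finite_on_compacts : ∀ C : Set (GG.Space Γ), IsCompact C → m C < ⊤
  invariant : ∀ g : GG.points ℝ, m.map (fun x => act x g) = m

/-- `μ` is `ε`-almost invariant under a group element, with respect to a norm `S` on test
functions. -/
def AlmostInvariant (S : (GG.Space Γ → ℝ) → ℝ) (μ : Measure (GG.Space Γ)) (ε : ℝ)
    (g : GG.points ℝ) : Prop :=
  ∀ f : GG.Space Γ → ℝ, IsTestFunction f → |(∫ x, f (act x g) ∂μ) - ∫ x, f x ∂μ| ≤ ε * S f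

/-- `μ` is `ε`-almost invariant under an element of the Lie algebra. -/
def LieAlmostInvariant (S : (GG.Space Γ → ℝ) → ℝ) (μ : Measure (GG.Space Γ)) (ε : ℝ)
    (Z : GG.lie) : Prop :=
  ∀ t : ℝ, |t| ≤ 2 → AlmostInvariant S μ ε (exp (t • Z))

/-- `μ` is `ε`-almost invariant under a Lie subalgebra. -/
def SubalgebraAlmostInvariant (E : EuclideanNorm N) (S : (GG.Space Γ → ℝ) → ℝ)
    (μ : Measure (GG.Space Γ)) (ε : ℝ) (s : LieSubalgebra ℝ GG.lie) : Prop :=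
  ∀ Z ∈ s, E.norm Z ≤ 1 → LieAlmostInvariant S μ ε Z

/-- The connected Lie subgroup with Lie algebra `h`: the subgroup generated by `exp h`. -/
noncomputable def connectedSubgroup (h : LieSubalgebra ℝ GG.lie) : Subgroup (GG.points ℝ) :=
  Subgroup.closure (exp '' (h : Set GG.lie))

/-- The group `H` has no compact factors: it has no non-trivial compact connected normal
subgroup. -/
def NoCompactFactors (H : Subgroup (GG.points ℝ)) : Prop :=
  ∀ L : Subgroup (GG.points ℝ), L ≤ H → (∀ a ∈ H, ∀ l ∈ L, a * l * a⁻¹ ∈ L) →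
    IsCompact (L : Set (GG.points ℝ)) → _root_.IsConnected (L : Set (GG.points ℝ)) → L = ⊥

/-- `z` is a unit vector whose one-parameter group is the image of the upper unipotent group under
a homomorphism from `SL_2(ℝ)` to the connected group `H` with Lie algebra `h` which projects
non-trivially onto every simple factor of `H`, that is, acts non-trivially on every minimal ideal
of `h`. -/
def IsUnipotentDirection (E : EuclideanNorm N) (h : LieSubalgebra ℝ GG.lie) (z : GG.lie) : Prop :=
  E.norm z = 1 ∧ ∃ φ : SL 2 ℝ →* GG.points ℝ, Continuous φ ∧
    (∀ a, φ a ∈ connectedSubgroup h) ∧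
    (∀ I : LieIdeal ℝ h, IsAtom I → ∃ a, ∃ Y : h, Y ∈ I ∧ Ad (φ a) (Y : GG.lie) ≠ Y) ∧
    Set.range (fun t : ℝ => exp (t • z)) =
      φ '' {a : SL 2 ℝ | a.1 0 0 = 1 ∧ a.1 1 0 = 0 ∧ a.1 1 1 = 1}

/-- `r` is an `H`-invariant complement of `s` that is undistorted with constant `κ₁`. -/
structure IsUndistortedComplement (E : EuclideanNorm N) (κ₁ : ℝ) (H : Subgroup (GG.points ℝ))
    (s r : Submodule ℝ GG.lie) : Prop where
  isCompl : IsCompl s r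
  invariant : ∀ a ∈ H, ∀ w ∈ r, Ad a w ∈ r
  undistorted : ∀ v ∈ s, ∀ w ∈ r,
    κ₁ * (E.norm v ^ 2 + E.norm w ^ 2) ≤ E.norm ((v + w : GG.lie) : Matrix (Fin N) (Fin N) ℝ) ^ 2

/-- `μ` is the Haar probability measure on a periodic `H`-orbit: an `H`-invariant probability
measure which gives full measure to a single orbit `xH`. -/
structure IsPeriodicOrbitMeasure (H : Subgroup (GG.points ℝ)) (μ : Measure (GG.Space Γ)) :
    Prop where
  isProbability : IsProbabilityMeasure μ
  invariant : ∀ a ∈ H, μ.map (fun x => act x a) = μ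
  orbit : ∃ x : GG.Space Γ, μ {y | ∃ a ∈ H, y = act x a}ᶜ = 0

/-- The discrepancy of `f` at `x` along the one-parameter group of `z`, over the time interval
`[n ^ K, (n + 1) ^ K]`. -/
noncomputable def discrepancy (K : ℝ) (z : GG.lie) (μ : Measure (GG.Space Γ)) (n : ℝ)
    (f : GG.Space Γ → ℝ) (x : GG.Space Γ) : ℝ :=
  1 / ((n + 1) ^ K - n ^ K) * (∫ t in (n ^ K)..((n + 1) ^ K), f (act x (exp (t • z))))
    - ∫ y, f y ∂μ

/-- `x` is `[k₁, k₂]`-generic with respect to the norm `S` on test functions. -/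
def IsGeneric (K : ℝ) (z : GG.lie) (S : (GG.Space Γ → ℝ) → ℝ) (μ : Measure (GG.Space Γ))
    (k₁ k₂ : ℝ) (x : GG.Space Γ) : Prop :=
  ∀ n : ℤ, k₁ ≤ n → (n : ℝ) ≤ k₂ → ∀ f : GG.Space Γ → ℝ, IsTestFunction f →
    |discrepancy K z μ n f x| ≤ 1 / (n : ℝ) * S f

end QGroup

end EffEqui

/-! ### The real points as a closed subgroup of a normed algebra. -/

namespace EffEqui.QGroup

open Filter Topology

variable {N : ℕ} {GG : QGroup N}

/-! Write `x₂ = x₁ exp v` and `ρ = ‖v‖`. Along the unipotent flow the displacement is `Ad(u_{-t})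
v`, because `x₁ exp(v) u_t = x₁ u_t exp(Ad(u_{-t}) v)`. Since `z` is a nilpotent matrix, this is a
polynomial curve in `t` with a number of coefficients bounded in terms of `N`.

The curve starts at size comparable to `ρ`. There is an integer `n`, at most a constant times `ρ⁻²`,
such that `Y`, the value of the curve at `n^K`, satisfies `‖Y‖ ≪ ρ^κ` and `n ‖Y‖ ≫ ρ^(-κ)`, and such
that on `[n^K, (n+1)^K]` the curve stays within `O(‖Y‖/n)` of `Y` (`exists_slow_time`). If `n` lies
in the window of genericity, both orbit averages of a test function over this interval are within
`O(1/n)` of its space average. One orbit is the other one displaced by nearly `exp Y`, so `μ` is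
`O(1/n)`-almost invariant under `exp Y` (`exists_almostInvariant`). Iterating up to `2/‖Y‖` times
reaches all times `|t| ≤ 2` in the direction of `Y` with error `O(1/(n‖Y‖) + ‖Y‖) = O(ρ^κ)`
(`exists_lieAlmostInvariant`). The direction is conjugate to `v` by an element of `H`, hence lies in
the `H`-invariant space `𝔯`. If `n` leaves the window, then `k₀ ρ^κ` is bounded below, because `ε ≤
ρ⁴`, and the trivial bound suffices (`one_le_mul_rpow`). These steps are put together in
`exists_additional_invariance`.

The argument needs the Sobolev norm to control the supremum and the Lipschitz constant of a test
function, uniformly on the non-compact quotient, and to be stable under bounded translations. Most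
of the file proves this. The orbit map at `x` is injective at scale `1/(ht(x)+1)`
(`exists_injectivity_radius`): a short element of the stabilizer of `x` gives, through the trace
form, a short vector of `Ad(g⁻¹) 𝔤_ℤ`. At that scale, averages over orbit balls are bounded by
integrals against the invariant measure (`exists_lintegral_ball_le`). A one-dimensional estimate
repeated in coordinates of the second kind bounds a value by such averages of derivatives, and the
weight `(ht+1)^d` compensates the small volume of the box (`exists_abs_le_sobolev`). The Lipschitz
bound `exists_abs_act_sub_le` applies this to first derivatives. -/

/-- The real matrices as a normed algebra, with the operator norm of the supremum norm. -/
def EndN (N : ℕ) : Type := Matrix (Fin N) (Fin N) ℝ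

noncomputable instance EndN.normedRing : NormedRing (EndN N) := Matrix.linftyOpNormedRing (n := Fin N) (α := ℝ)

noncomputable instance EndN.normedAlgebra : NormedAlgebra ℝ (EndN N) :=
  Matrix.linftyOpNormedAlgebra (R := ℝ) (n := Fin N) (α := ℝ)

/-- The identification of matrices with elements of the normed algebra. -/
noncomputable def emb (N : ℕ) : Matrix (Fin N) (Fin N) ℝ ≃ₐ[ℝ] EndN N where
  toFun X := X
  invFun X := X
  map_mul' _ _ := rfl
  map_add' _ _ := rfl
  commutes' _ := rfl

/-- Only an inequality, because for `N = 0` the algebra is the zero ring. -/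
theorem EndN.norm_one_le : ‖(1 : EndN N)‖ ≤ 1 := by
  rcases isEmpty_or_nonempty (Fin N) with h | h
  · have : (1 : EndN N) = 0 := (Matrix.subsingleton_of_empty_left : Subsingleton
      (Matrix (Fin N) (Fin N) ℝ)).elim _ _
    rw [this, norm_zero]
    exact zero_le_one
  · exact (Matrix.linfty_opNormOneClass (n := Fin N) (α := ℝ)).norm_one.le

attribute [irreducible] EndN.normedRing EndN.normedAlgebra

noncomputable instance EndN.normedAddCommGroup : NormedAddCommGroup (EndN N) :=
  NonUnitalNormedRing.toNormedAddCommGroup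

noncomputable instance EndN.addCommGroup : AddCommGroup (EndN N) :=
  NormedAddCommGroup.toAddCommGroup

noncomputable instance : NormedAlgebra ℚ (EndN N) := NormedAlgebra.restrictScalars ℚ ℝ _

instance : FiniteDimensional ℝ (EndN N) := Module.Finite.equiv (emb N).toLinearEquiv

instance : CompleteSpace (EndN N) := FiniteDimensional.complete ℝ _

theorem continuous_emb : Continuous (emb N) :=
  (emb N).toLinearMap.continuous_of_finiteDimensional

theorem continuous_emb_symm : Continuous (emb N).symm :=
  (emb N).symm.toLinearMap.continuous_of_finiteDimensional

theorem isHomeomorph_emb : IsHomeomorph (emb N) :=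
  (Homeomorph.mk (emb N).toEquiv continuous_emb continuous_emb_symm).isHomeomorph

theorem emb_exp (X : Matrix (Fin N) (Fin N) ℝ) :
    emb N (NormedSpace.exp X) = NormedSpace.exp (emb N X) := by
  open scoped Matrix.Norms.Operator in
  exact NormedSpace.map_exp (emb N) continuous_emb X

/-- The endomorphism given by a real point. -/
noncomputable def mat (g : GG.points ℝ) : EndN N := emb N (g : SL N ℝ).1

@[simp] theorem mat_mul (g h : GG.points ℝ) : mat (g * h) = mat g * mat h :=
  map_mul (emb N) _ _

@[simp] theorem mat_one : mat (1 : GG.points ℝ) = 1 := map_one (emb N)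

theorem mat_injective : Function.Injective (mat : GG.points ℝ → _) :=
  fun _ _ h => Subtype.ext (Subtype.ext ((emb N).injective h))

@[simp] theorem mat_mul_mat_inv (g : GG.points ℝ) : mat g * mat g⁻¹ = 1 := by
  rw [← mat_mul, mul_inv_cancel, mat_one]

@[simp] theorem mat_inv_mul_mat (g : GG.points ℝ) : mat g⁻¹ * mat g = 1 := by
  rw [← mat_mul, inv_mul_cancel, mat_one]

@[simp] theorem mat_exp (Z : GG.lie) :
    mat (exp Z) = NormedSpace.exp (emb N (Z : Matrix (Fin N) (Fin N) ℝ)) := emb_exp _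

theorem emb_Ad (g : GG.points ℝ) (Z : GG.lie) :
    emb N (Ad g Z : Matrix (Fin N) (Fin N) ℝ) = mat g * emb N Z * mat g⁻¹ := by
  rw [mat, mat, ← map_mul, ← map_mul]
  rfl

theorem isEmbedding_mat : IsEmbedding (mat : GG.points ℝ → _) :=
  isHomeomorph_emb.isEmbedding.comp (IsEmbedding.subtypeVal.comp IsEmbedding.subtypeVal)

theorem continuous_mat : Continuous (mat : GG.points ℝ → _) := isEmbedding_mat.continuous

/-- The image is cut out of the matrices by polynomial equations, `det = 1` included. Closedness
makes the metric on the group proper and drives the closed-subgroup argument below. -/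
theorem isClosed_range_mat : IsClosed (Set.range (mat : GG.points ℝ → _)) := by
  have h : Set.range (fun g : GG.points ℝ => (g : SL N ℝ).1) = {M : Matrix (Fin N) (Fin N) ℝ |
      ∀ q ∈ GG.eqs ∪ {(Matrix.mvPolynomialX (Fin N) (Fin N) ℚ).det - 1},
      MvPolynomial.aeval (fun ij : Fin N × Fin N => M ij.1 ij.2) q = (0 : ℝ)} := by
    ext M
    constructor
    · rintro ⟨g, rfl⟩ q hq
      exact aeval_eq_zero g.2 hq
    · intro hM
      obtain ⟨A, hA, hAM⟩ := mem_points_of_aeval (GG := GG) hM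
      exact ⟨⟨A, hA⟩, hAM⟩
  have h2 : Set.range (mat : GG.points ℝ → _)
      = emb N '' Set.range (fun g : GG.points ℝ => (g : SL N ℝ).1) := by
    rw [← Set.range_comp]
    rfl
  rw [h2]
  refine isHomeomorph_emb.isClosedMap _ ?_
  rw [h]
  simp only [Set.ofPred_forall]
  refine isClosed_iInter fun q => isClosed_iInter fun _ => isClosed_eq ?_ continuous_const
  have h1 : Continuous fun M : Matrix (Fin N) (Fin N) ℝ => fun ij : Fin N × Fin N => M ij.1 ij.2 :=
    continuous_pi fun ij => continuous_id.matrix_elem ij.1 ij.2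
  have h2 : Continuous fun v : Fin N × Fin N → ℝ => MvPolynomial.aeval v q := by
    simp_rw [MvPolynomial.aeval_def, MvPolynomial.eval₂_eq']
    fun_prop
  exact h2.comp h1

theorem isClosedEmbedding_mat : IsClosedEmbedding (mat : GG.points ℝ → _) :=
  ⟨isEmbedding_mat, isClosed_range_mat⟩

/-- The real points carry the distance of the operator norm. -/
noncomputable instance : MetricSpace (GG.points ℝ) := isEmbedding_mat.comapMetricSpace mat

theorem isometry_mat : Isometry (mat : GG.points ℝ → _) :=
  Isometry.of_dist_eq fun _ _ => rfl

theorem dist_eq (g h : GG.points ℝ) : dist g h = ‖mat g - mat h‖ := by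
  rw [← isometry_mat.dist_eq, dist_eq_norm]

instance : ProperSpace (GG.points ℝ) where
  isCompact_closedBall x r := by
    have h := (isClosedEmbedding_mat (GG := GG)).isCompact_preimage
      (isCompact_closedBall (mat x) r)
    rwa [isometry_mat.preimage_closedBall] at h

noncomputable instance : MeasurableSpace (GG.points ℝ) := borel _

instance : BorelSpace (GG.points ℝ) := ⟨rfl⟩

/-- An equation of the group that holds along `t ↦ exp(tX)` can be differentiated at `t = 0`. Its
value and its derivative there are the two components of the same equation at `1 + εX` over the dual
numbers. -/
theorem mem_lie_of_forall_exp {X : Matrix (Fin N) (Fin N) ℝ}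
    (h : ∀ t : ℝ, NormedSpace.exp (t • emb N X) ∈ Set.range (mat : GG.points ℝ → _)) : X ∈ GG.lie := by
  have key : ∀ q ∈ GG.eqs ∪ {(Matrix.mvPolynomialX (Fin N) (Fin N) ℚ).det - 1},
      MvPolynomial.aeval (fun ij : Fin N × Fin N => tangent X ij.1 ij.2) q
        = (0 : DualNumber ℝ) := by
    intro q hq
    rw [← MvPolynomial.aeval_map_algebraMap (A := ℝ)]
    set Q := MvPolynomial.map (algebraMap ℚ ℝ) q with hQ
    have hz : ∀ t : ℝ, MvPolynomial.aeval
        (fun ij : Fin N × Fin N => (NormedSpace.exp (t • X)) ij.1 ij.2) Q = (0 : ℝ) := by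
      intro t
      obtain ⟨g, hg⟩ := h t
      rw [← map_smul, ← emb_exp] at hg
      rw [← (emb N).injective hg, hQ, MvPolynomial.aeval_map_algebraMap]
      exact aeval_eq_zero g.2 hq
    have hd := hasDerivAt_aeval_exp X Q 0
    have hd0 : MvPolynomial.aeval (fun ij : Fin N × Fin N => (NormedSpace.exp ((0 : ℝ) • X))
        ij.1 ij.2) (invDer X Q) = 0 := by
      refine hd.unique ?_
      simp only [hz]
      exact hasDerivAt_const 0 0
    have h0 := hz 0
    rw [zero_smul, NormedSpace.exp_zero] at h0 hd0
    have hdual := aeval_dual (fun ij : Fin N × Fin N => (1 : Matrix (Fin N) (Fin N) ℝ) ij.1 ij.2)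
      X Q
    rw [h0, hd0] at hdual
    have he : (fun ij : Fin N × Fin N => tangent X ij.1 ij.2) = fun ij : Fin N × Fin N =>
        (TrivSqZeroExt.inl ((1 : Matrix (Fin N) (Fin N) ℝ) ij.1 ij.2) + TrivSqZeroExt.inr
          (MvPolynomial.aeval (fun ij : Fin N × Fin N => (1 : Matrix (Fin N) (Fin N) ℝ) ij.1 ij.2)
            (invDer X (MvPolynomial.X ij))) : DualNumber ℝ) := by
      funext ⟨i, j⟩
      by_cases hij : i = j <;>
        simp [invDer, tangent, MvPolynomial.mkDerivation_X, Matrix.one_apply, hij]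
    rw [he, hdual]
    simp
  obtain ⟨A, hA, hAM⟩ := mem_points_of_aeval (GG := GG) (M := tangent X) key
  exact ⟨A, hA, hAM⟩

theorem exp_neg_mem_range {X : EndN N}
    (h : NormedSpace.exp X ∈ Set.range (mat : GG.points ℝ → _)) :
    NormedSpace.exp (-X) ∈ Set.range (mat : GG.points ℝ → _) := by
  obtain ⟨g, hg⟩ := h
  refine ⟨g⁻¹, ?_⟩
  have h1 : mat g * NormedSpace.exp (-X) = 1 := by
    rw [hg, ← NormedSpace.exp_add_of_commute (Commute.refl X).neg_right, add_neg_cancel,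
      NormedSpace.exp_zero]
  calc mat g⁻¹ = mat g⁻¹ * (mat g * NormedSpace.exp (-X)) := by rw [h1, mul_one]
    _ = NormedSpace.exp (-X) := by rw [← mul_assoc, mat_inv_mul_mat, one_mul]

theorem exp_nsmul_mem_range {X : EndN N}
    (h : NormedSpace.exp X ∈ Set.range (mat : GG.points ℝ → _)) (k : ℕ) :
    NormedSpace.exp ((k : ℝ) • X) ∈ Set.range (mat : GG.points ℝ → _) := by
  obtain ⟨g, hg⟩ := h
  refine ⟨g ^ k, ?_⟩
  rw [Nat.cast_smul_eq_nsmul, NormedSpace.exp_nsmul, ← hg]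
  induction k with
  | zero => simp
  | succ k ih => rw [pow_succ, pow_succ, mat_mul, ih]

/-- A complement of the Lie algebra contains no small logarithm of a non-trivial point. -/
theorem exists_eq_zero_of_exp_mem {W : Submodule ℝ (EndN N)}
    (hW : Disjoint (GG.lie.toSubmodule.map (emb N).toLinearMap) W) : ∃ ρ > 0, ∀ w ∈ W, ‖w‖ < ρ →
      NormedSpace.exp w ∈ Set.range (mat : GG.points ℝ → _) → w = 0 := by
  by_contra! hcon
  have hpos : ∀ k : ℕ, (0 : ℝ) < 1 / (k + 1) := fun k => by positivity
  choose w hwW hwρ hwmem hw0 using fun k : ℕ => hcon _ (hpos k)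
  have hn : ∀ k, 0 < ‖w k‖ := fun k => norm_pos_iff.2 (hw0 k)
  set u : ℕ → EndN N := fun k => ‖w k‖⁻¹ • w k with hu
  have hus : ∀ k, u k ∈ Metric.sphere (0 : EndN N) 1 := by
    intro k
    simp [hu, norm_smul, (hn k).ne']
  obtain ⟨v, hv, φ, hφ, hlim⟩ := (isCompact_sphere (0 : EndN N) 1).tendsto_subseq hus
  have hw_lim : Tendsto (fun k => ‖w (φ k)‖) atTop (𝓝 0) :=
    (squeeze_zero (fun k => norm_nonneg (w k)) (fun k => (hwρ k).le)
      tendsto_one_div_add_atTop_nhds_zero_nat).comp hφ.tendsto_atTop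
  have hvW : v ∈ W :=
    (Submodule.closed_of_finiteDimensional W).mem_of_tendsto hlim
      (Eventually.of_forall fun k => W.smul_mem _ (hwW _))
  -- The normalized logarithms accumulate at a unit vector `v` of `W`. Since `w (φ k)` tends to `0`,
  -- `exp(tv)` is the limit of the integer powers `exp(w)^⌊t/‖w‖⌋`, which stay in the closed group.
  -- Hence `v` is also in the Lie algebra, against `‖v‖ = 1`.
  have hnonneg : ∀ t : ℝ, 0 ≤ t →
      NormedSpace.exp (t • v) ∈ Set.range (mat : GG.points ℝ → _) := by
    intro t ht
    have h1 : Tendsto (fun k => ((⌊t / ‖w (φ k)‖⌋₊ : ℝ) * ‖w (φ k)‖)) atTop (𝓝 t) := by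
      rw [tendsto_iff_norm_sub_tendsto_zero]
      refine squeeze_zero (fun _ => norm_nonneg _) (fun k => ?_) hw_lim
      have h2 := Nat.floor_le (div_nonneg ht (hn (φ k)).le)
      have h3 := Nat.lt_floor_add_one (t / ‖w (φ k)‖)
      rw [le_div_iff₀ (hn _)] at h2
      rw [div_lt_iff₀ (hn _)] at h3
      rw [Real.norm_eq_abs, abs_le]
      constructor <;> linarith
    have h4 : Tendsto (fun k => NormedSpace.exp ((⌊t / ‖w (φ k)‖⌋₊ : ℝ) • w (φ k))) atTop
        (𝓝 (NormedSpace.exp (t • v))) := by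
      refine ((NormedSpace.exp_continuous (𝔸 := EndN N)).tendsto _).comp ?_
      refine (h1.smul hlim).congr fun k => ?_
      simp only [hu, Function.comp_apply, smul_smul]
      rw [mul_assoc, mul_inv_cancel₀ (hn _).ne', mul_one]
    exact isClosed_range_mat.mem_of_tendsto h4
      (Eventually.of_forall fun k => exp_nsmul_mem_range (hwmem _) _)
  have hvl : v ∈ GG.lie.toSubmodule.map (emb N).toLinearMap := by
    refine ⟨(emb N).symm v, mem_lie_of_forall_exp fun t => ?_, (emb N).apply_symm_apply v⟩
    rw [AlgEquiv.apply_symm_apply]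
    rcases le_total 0 t with ht | ht
    · exact hnonneg t ht
    · have := exp_neg_mem_range (hnonneg (-t) (by linarith))
      rwa [← neg_smul, neg_neg] at this
  have hv0 : v = 0 := Submodule.disjoint_def.1 hW v hvl hvW
  simp [hv0] at hv

end EffEqui.QGroup

/-! ### Charts at the identity and a local logarithm. -/

namespace EffEqui.QGroup

open scoped ContDiff
open Filter Topology

variable {N : ℕ} {GG : QGroup N}

instance : FiniteDimensional ℝ GG.lie :=
  inferInstanceAs (FiniteDimensional ℝ GG.lie.toSubmodule)

/-- The coordinate space of the Lie algebra. -/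
abbrev Coord (GG : QGroup N) : Type := Fin (Module.finrank ℝ GG.lie) → ℝ

variable (b : Module.Basis (Fin (Module.finrank ℝ GG.lie)) ℝ GG.lie)

/-- The element of the Lie algebra with given coordinates. -/
noncomputable def lin : Coord GG →ₗ[ℝ] GG.lie := b.equivFun.symm

theorem lin_apply (a : Coord GG) : lin b a = ∑ i, a i • b i := by
  simp [lin, Module.Basis.equivFun_symm_apply]

/-- `lin` with values in the matrices. -/
noncomputable def linMat : Coord GG →L[ℝ] EndN N :=
  ((emb N).toLinearMap ∘ₗ GG.lie.toSubmodule.subtype ∘ₗ lin b).toContinuousLinearMap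

theorem linMat_apply (a : Coord GG) : linMat b a = emb N (lin b a : Matrix (Fin N) (Fin N) ℝ) := rfl

theorem linMat_injective : Function.Injective (linMat b) :=
  (emb N).injective.comp (Subtype.val_injective.comp b.equivFun.symm.injective)

theorem linMat_range : LinearMap.range (linMat b : Coord GG →ₗ[ℝ] EndN N)
    = GG.lie.toSubmodule.map (emb N).toLinearMap := by
  ext X
  constructor
  · rintro ⟨a, rfl⟩
    exact ⟨_, (lin b a).2, rfl⟩
  · rintro ⟨Y, hY, rfl⟩
    exact ⟨b.equivFun ⟨Y, hY⟩, congrArg (emb N)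
      (congrArg Subtype.val (b.equivFun.symm_apply_apply ⟨Y, hY⟩))⟩

/-- A map with injective strict derivative on a finite-dimensional space is locally bi-Lipschitz. -/
theorem exists_bilipschitz_of_hasStrictFDerivAt {E F : Type*} [NormedAddCommGroup E]
    [NormedSpace ℝ E] [FiniteDimensional ℝ E] [NormedAddCommGroup F] [NormedSpace ℝ F]
    {Φ : E → F} {L : E →L[ℝ] F} (hΦ : HasStrictFDerivAt Φ L 0) (hL : Function.Injective L) :
    ∃ r > 0, ∃ K > 0, ∀ e ∈ Metric.ball (0 : E) r, ∀ e' ∈ Metric.ball (0 : E) r,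
      ‖Φ e - Φ e'‖ ≤ K * ‖e - e'‖ ∧ ‖e - e'‖ ≤ K * ‖Φ e - Φ e'‖ := by
  obtain ⟨K, hK, hanti⟩ := (L : E →ₗ[ℝ] F).exists_antilipschitzWith
    (LinearMap.ker_eq_bot.2 hL)
  have hK' : (0 : ℝ) < K := hK
  have hlo : ∀ e, ‖e‖ ≤ K * ‖L e‖ := fun e => by
    simpa [dist_eq_norm] using! hanti.le_mul_dist e 0
  set c : ℝ := (2 * K)⁻¹ with hc
  have hc0 : 0 < c := by positivity
  have hev := hΦ.isLittleO.def hc0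
  rw [nhds_prod_eq] at hev
  obtain ⟨r, hr, hball⟩ := Metric.eventually_nhds_iff_ball.1 (by rwa [← nhds_prod_eq] at hev)
  refine ⟨r, hr, max (2 * K) (‖L‖ + c), lt_max_of_lt_left (by positivity), ?_⟩
  intro e he e' he'
  have h1 := hball (e, e') (by
    rw [← ball_prod_same]
    exact ⟨he, he'⟩)
  simp only at h1
  have h2 := hlo (e - e')
  have h3 := (L).le_opNorm (e - e')
  have h4 := norm_sub_norm_le (L (e - e')) (Φ e - Φ e')
  have h5 := norm_sub_norm_le (Φ e - Φ e') (L (e - e'))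
  rw [norm_sub_rev (L (e - e'))] at h4
  constructor
  · refine le_trans ?_ (mul_le_mul_of_nonneg_right (le_max_right _ _) (norm_nonneg _))
    linarith
  · refine le_trans ?_ (mul_le_mul_of_nonneg_right (le_max_left _ _) (norm_nonneg _))
    have h6 : K * (c * ‖e - e'‖) = ‖e - e'‖ / 2 := by
      rw [hc]; field_simp
    have h7 : K * ‖L (e - e')‖ ≤ K * (‖Φ e - Φ e'‖ + c * ‖e - e'‖) :=
      mul_le_mul_of_nonneg_left (by linarith) hK'.le
    rw [mul_add, h6] at h7
    linarith

/-- A parametrization of a neighbourhood of `1` with the derivative of the exponential map. -/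
structure IsChart (Φ : Coord GG → GG.points ℝ) : Prop where
  map_zero : Φ 0 = 1
  deriv : HasStrictFDerivAt (fun a => mat (Φ a)) (linMat b) 0

/-- A linear left inverse of `linMat`. -/
noncomputable def coordProj : EndN N →L[ℝ] Coord GG :=
  ((linMat b : Coord GG →ₗ[ℝ] EndN N).exists_leftInverse_of_injective
    (LinearMap.ker_eq_bot.2 (linMat_injective b))).choose.toContinuousLinearMap

theorem coordProj_linMat (a : Coord GG) : coordProj b (linMat b a) = a :=
  LinearMap.congr_fun ((linMat b : Coord GG →ₗ[ℝ]
    EndN N).exists_leftInverse_of_injective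
    (LinearMap.ker_eq_bot.2 (linMat_injective b))).choose_spec a

theorem hasStrictFDerivAt_exp_zero :
    HasStrictFDerivAt (NormedSpace.exp : EndN N → EndN N)
      (ContinuousLinearMap.id ℝ (EndN N)) 0 :=
  _root_.hasStrictFDerivAt_exp_zero (𝕂 := ℝ)

theorem contDiff_exp :
    ContDiff ℝ ∞ (NormedSpace.exp : EndN N → EndN N) := by
  rw [contDiff_iff_contDiffAt]
  intro X
  exact (NormedSpace.exp_analytic (𝕂 := ℝ) X).contDiffAt

theorem isChart_exp : IsChart b (fun a => exp (lin b a)) where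
  map_zero := mat_injective (by simp)
  deriv := by
    have h : HasStrictFDerivAt (NormedSpace.exp : EndN N → EndN N)
      (ContinuousLinearMap.id ℝ (EndN N)) (linMat b 0) := by
      rw [map_zero]
      exact hasStrictFDerivAt_exp_zero
    refine (h.comp (0 : Coord GG) (linMat b).hasStrictFDerivAt).congr_of_eventuallyEq ?_
    exact Eventually.of_forall fun a => (mat_exp _).symm

/-- The ordered product of the one-parameter groups of the basis vectors listed. -/
noncomputable def prodExp : List (Fin (Module.finrank ℝ GG.lie)) → Coord GG → GG.points ℝ
  | [], _ => 1
  | i :: l, a => exp (a i • b i) * prodExp l a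

theorem prodExp_zero (l : List (Fin (Module.finrank ℝ GG.lie))) : prodExp b l 0 = 1 := by
  induction l with
  | nil => rfl
  | cons i l ih =>
    rw [prodExp, ih, mul_one]
    exact mat_injective (by simp)

theorem hasStrictFDerivAt_prodExp (l : List (Fin (Module.finrank ℝ GG.lie))) :
    HasStrictFDerivAt (fun a => mat (prodExp b l a)) ((l.map fun i =>
      (ContinuousLinearMap.proj i : Coord GG →L[ℝ] ℝ).smulRight
        (emb N (b i : Matrix (Fin N) (Fin N) ℝ))).sum) 0 := by
  induction l with
  | nil => simpa [prodExp] using! hasStrictFDerivAt_const (𝕜 := ℝ) (1 : EndN N) (0 : Coord GG)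
  | cons i l ih =>
    set P := (ContinuousLinearMap.proj i : Coord GG →L[ℝ] ℝ).smulRight
        (emb N (b i : Matrix (Fin N) (Fin N) ℝ)) with hP
    have h1 : HasStrictFDerivAt (fun a : Coord GG => mat (exp (a i • b i))) P 0 := by
      have h : HasStrictFDerivAt (NormedSpace.exp : EndN N → EndN N)
          (ContinuousLinearMap.id ℝ (EndN N)) (P 0) := by
        rw [map_zero]
        exact hasStrictFDerivAt_exp_zero
      refine (h.comp (0 : Coord GG) P.hasStrictFDerivAt).congr_of_eventuallyEq ?_
      refine Eventually.of_forall fun a => ?_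
      refine Eq.trans ?_ (mat_exp _).symm
      exact congrArg NormedSpace.exp (map_smul (emb N) _ _).symm
    have h2 := h1.mul' ih
    have e1 : mat (exp ((0 : Coord GG) i • b i)) = 1 := by simp
    rw [e1, prodExp_zero] at h2
    simp only [prodExp, mat_mul, List.map_cons, List.sum_cons]
    refine HasStrictFDerivAt.congr_fderiv
      (f := fun a : Coord GG => mat (exp (a i • b i)) * mat (prodExp b l a)) h2 ?_
    refine ContinuousLinearMap.ext fun a => ?_
    simp [add_comm]
    rfl

theorem isChart_prodExp : IsChart b (prodExp b (List.finRange _)) where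
  map_zero := prodExp_zero b _
  deriv := by
    refine (hasStrictFDerivAt_prodExp b (List.finRange _)).congr_fderiv ?_
    refine ContinuousLinearMap.ext fun a => Eq.symm ?_
    rw [linMat_apply, lin_apply, ← List.sum_ofFn, List.ofFn_eq_map]
    have : ∀ l : List (Fin (Module.finrank ℝ GG.lie)),
        emb N ((l.map fun i => a i • b i).sum : GG.lie) =
        ((l.map fun i => (ContinuousLinearMap.proj i : Coord GG →L[ℝ] ℝ).smulRight
        (emb N (b i : Matrix (Fin N) (Fin N) ℝ))).sum) a := by
      intro l
      induction l with
      | nil => simp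
      | cons i l ih =>
        simp only [List.map_cons, List.sum_cons, add_apply, ← ih]
        exact (map_add (emb N) _ _).trans (congrArg₂ (· + ·) (map_smul (emb N) _ _) rfl)
    exact this _

variable {b}

namespace IsChart

variable {Φ : Coord GG → GG.points ℝ} (hΦ : IsChart b Φ)

include hΦ

theorem exists_bilipschitz : ∃ r > 0, ∃ K > 0, ∀ e ∈ Metric.ball (0 : Coord GG) r,
    ∀ e' ∈ Metric.ball (0 : Coord GG) r, dist (Φ e) (Φ e') ≤ K * dist e e' ∧
      dist e e' ≤ K * dist (Φ e) (Φ e') := by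
  simp only [dist_eq, dist_eq_norm]
  exact exists_bilipschitz_of_hasStrictFDerivAt hΦ.deriv (linMat_injective b)

/-- The chart covers a neighbourhood of `1` in the group of real points. -/
theorem image_mem_nhds {s : Set (Coord GG)} (hs : s ∈ 𝓝 0) : Φ '' s ∈ 𝓝 (1 : GG.points ℝ) := by
  obtain ⟨W, hW⟩ := Submodule.exists_isCompl (GG.lie.toSubmodule.map (emb N).toLinearMap)
  obtain ⟨ρ, hρ, hsmall⟩ := exists_eq_zero_of_exp_mem hW.disjoint
  -- The chart is completed by a factor `exp w`, with `w` in a complement `W` of the Lie algebra, to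
  -- a map open at the origin into all matrices. A group point near `1` is then `Φ(e) exp(w)` with
  -- `w` small; here `exp w` belongs to the group, so `w = 0`.
  set L : Coord GG × W →L[ℝ] EndN N :=
    (linMat b).comp (ContinuousLinearMap.fst ℝ _ _) +
      (W.subtypeL).comp (ContinuousLinearMap.snd ℝ _ _) with hL
  have hLs : L.range = ⊤ := by
    rw [eq_top_iff, ← hW.sup_eq_top, sup_le_iff]
    constructor
    · rw [← linMat_range b]
      rintro _ ⟨a, rfl⟩
      exact ⟨(a, 0), by simp [hL]⟩
    · intro w hw
      exact ⟨(0, ⟨w, hw⟩), by simp [hL]⟩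
  have hd : HasStrictFDerivAt (fun p : Coord GG × W =>
      mat (Φ p.1) * NormedSpace.exp (p.2 : EndN N)) L 0 := by
    have h1 : HasStrictFDerivAt (fun p : Coord GG × W => mat (Φ p.1))
        ((linMat b).comp (ContinuousLinearMap.fst ℝ (Coord GG) W)) 0 :=
      HasStrictFDerivAt.comp (g := fun a => mat (Φ a)) (0 : Coord GG × W) hΦ.deriv
        (ContinuousLinearMap.fst ℝ (Coord GG) W).hasStrictFDerivAt
    have h2 : HasStrictFDerivAt (fun p : Coord GG × W =>
        NormedSpace.exp (p.2 : EndN N))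
        ((W.subtypeL).comp (ContinuousLinearMap.snd ℝ (Coord GG) W)) 0 := by
      have hz : HasStrictFDerivAt (NormedSpace.exp : EndN N → EndN N)
          (ContinuousLinearMap.id ℝ (EndN N))
          (((W.subtypeL).comp (ContinuousLinearMap.snd ℝ (Coord GG) W)) 0) := by
        have e0 : ((W.subtypeL).comp (ContinuousLinearMap.snd ℝ (Coord GG) W)) 0 = 0 := by simp
        rw [e0]
        exact hasStrictFDerivAt_exp_zero
      have h := HasStrictFDerivAt.comp (g := (NormedSpace.exp : EndN N → _))
        (0 : Coord GG × W) (f := (W.subtypeL).comp (ContinuousLinearMap.snd ℝ (Coord GG) W))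
        (g' := ContinuousLinearMap.id ℝ _) hz
        ((W.subtypeL).comp (ContinuousLinearMap.snd ℝ (Coord GG) W)).hasStrictFDerivAt
      exact h
    have h3 := h1.mul' h2
    refine h3.congr_fderiv ?_
    refine ContinuousLinearMap.ext fun p => ?_
    simp [hL, hΦ.map_zero, add_comm]
  have hmap := hd.map_nhds_eq_of_surj hLs
  simp only [Prod.fst_zero, Prod.snd_zero, hΦ.map_zero, mat_one, Submodule.coe_zero,
    NormedSpace.exp_zero, mul_one] at hmap
  have hU : {p : Coord GG × W | p.1 ∈ s ∧ ‖(p.2 : EndN N)‖ < ρ} ∈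
      𝓝 (0 : Coord GG × W) := by
    refine Filter.inter_mem (continuous_fst.continuousAt.preimage_mem_nhds hs) ?_
    refine (isOpen_lt
      (continuous_norm.comp (continuous_subtype_val.comp continuous_snd)) continuous_const).mem_nhds ?_
    simpa using hρ
  have h4 := Filter.image_mem_map (m := fun p : Coord GG × W =>
      mat (Φ p.1) * NormedSpace.exp (p.2 : EndN N)) hU
  rw [hmap] at h4
  rw [← mat_one (GG := GG)] at h4
  have h5 := continuous_mat.continuousAt.preimage_mem_nhds h4
  refine Filter.mem_of_superset h5 ?_
  rintro g ⟨⟨e, w⟩, ⟨he, hw⟩, hg⟩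
  have hg' : mat (Φ e) * NormedSpace.exp (w : EndN N) = mat g := hg
  have h6 : mat ((Φ e)⁻¹ * g) = NormedSpace.exp (w : EndN N) := by
    rw [mat_mul, ← hg', ← mul_assoc, mat_inv_mul_mat, one_mul]
  have h7 := hsmall w w.2 hw ⟨_, h6⟩
  rw [h7, NormedSpace.exp_zero, mul_one] at hg'
  exact ⟨e, he, mat_injective hg'⟩

end IsChart

variable (b)

/-- A logarithm with values in the coordinate space, smooth near `1`. -/
theorem exists_log : ∃ Λ : EndN N → Coord GG, ContDiffAt ℝ ∞ Λ 1 ∧ Λ 1 = 0 ∧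
    ∀ᶠ g in 𝓝 (1 : GG.points ℝ), exp (lin b (Λ (mat g))) = g := by
  have hc : ContDiffAt ℝ ∞ (NormedSpace.exp : EndN N → _) 0 :=
    contDiff_exp.contDiffAt
  have hd : HasFDerivAt (NormedSpace.exp : EndN N → _)
      ((ContinuousLinearEquiv.refl ℝ (EndN N) :
        EndN N →L[ℝ] EndN N)) 0 :=
    hasStrictFDerivAt_exp_zero.hasFDerivAt
  have hn : (∞ : WithTop ℕ∞) ≠ 0 := by simp
  set ℓ := hc.localInverse hd hn
  have hl0 : ℓ 1 = 0 := by
    have := hc.localInverse_apply_image hd hn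
    rwa [NormedSpace.exp_zero] at this
  have hls : ContDiffAt ℝ ∞ ℓ 1 := by
    have := hc.to_localInverse hd hn
    rwa [NormedSpace.exp_zero] at this
  -- A linear left inverse of `linMat` forgets the directions transverse to the Lie algebra. Nothing
  -- is lost at group points near `1`, since the exponential chart covers them.
  refine ⟨fun M => coordProj b (ℓ M), (coordProj b).contDiff.contDiffAt.comp _ hls, by simp [hl0], ?_⟩
  have hev : ∀ᶠ X in 𝓝 (0 : EndN N), ℓ (NormedSpace.exp X) = X :=
    (hc.hasStrictFDerivAt' hd hn).eventually_left_inverse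
  have hev2 : ∀ᶠ a in 𝓝 (0 : Coord GG), ℓ (NormedSpace.exp (linMat b a)) = linMat b a := by
    have ht : Tendsto (linMat b) (𝓝 0) (𝓝 0) := by
      simpa using (linMat b).continuous.tendsto 0
    exact ht.eventually hev
  refine Filter.mem_of_superset ((isChart_exp b).image_mem_nhds hev2) ?_
  rintro _ ⟨a, ha, rfl⟩
  have : coordProj b (ℓ (NormedSpace.exp (linMat b a))) = a := by
    rw [ha, coordProj_linMat]
  have e : mat (exp (lin b a)) = NormedSpace.exp (linMat b a) := mat_exp _
  change exp (lin b (coordProj b (ℓ (mat (exp (lin b a)))))) = exp (lin b a)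
  rw [e, this]

end EffEqui.QGroup

/-! ### The right action on the quotient and the calculus of test functions. -/

namespace EffEqui.QGroup

open scoped ContDiff
open Filter Topology

variable {N : ℕ} {GG : QGroup N} {Γ : Subgroup (SL N ℤ)}

theorem proj_surjective : Function.Surjective (proj Γ : GG.points ℝ → GG.Space Γ) :=
  Quotient.mk_surjective

@[simp] theorem act_proj (a g : GG.points ℝ) : act (proj Γ a) g = proj Γ (a * g) := rfl

@[simp] theorem act_one (x : GG.Space Γ) : act x 1 = x := by
  obtain ⟨a, rfl⟩ := proj_surjective x
  simp

theorem act_mul (x : GG.Space Γ) (g h : GG.points ℝ) : act x (g * h) = act (act x g) h := by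
  obtain ⟨a, rfl⟩ := proj_surjective x
  simp [mul_assoc]

theorem proj_eq_iff (a c : GG.points ℝ) :
    (proj Γ a = proj Γ c) ↔ c * a⁻¹ ∈ GG.discrete Γ := by
  exact (Quotient.eq (r := QuotientGroup.rightRel (GG.discrete Γ))).trans
    QuotientGroup.rightRel_apply

theorem continuous_proj : Continuous (proj Γ : GG.points ℝ → GG.Space Γ) :=
  continuous_quotient_mk'

theorem isOpenMap_proj : IsOpenMap (proj Γ : GG.points ℝ → GG.Space Γ) := by
  intro U hU
  have h : (proj Γ : GG.points ℝ → GG.Space Γ) ⁻¹' (proj Γ '' U)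
      = ⋃ γ ∈ GG.discrete Γ, (fun g => γ * g) ⁻¹' U := by
    ext g
    simp only [Set.mem_preimage, Set.mem_image, Set.mem_iUnion, exists_prop]
    constructor
    · rintro ⟨u, hu, hug⟩
      refine ⟨u * g⁻¹, (proj_eq_iff _ _).1 hug.symm, by simpa using hu⟩
    · rintro ⟨γ, hγ, hg⟩
      exact ⟨_, hg, ((proj_eq_iff _ _).2 (by simpa using hγ)).symm⟩
  refine isOpen_coinduced.2 (?_ : IsOpen ((proj Γ : GG.points ℝ → GG.Space Γ) ⁻¹' (proj Γ '' U)))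
  rw [h]
  exact isOpen_biUnion fun γ _ => hU.preimage (continuous_const_mul γ)

theorem isOpenQuotientMap_proj : IsOpenQuotientMap (proj Γ : GG.points ℝ → GG.Space Γ) :=
  ⟨proj_surjective, continuous_proj, isOpenMap_proj⟩

instance : SecondCountableTopology (GG.Space Γ) :=
  isOpenQuotientMap_proj.isQuotientMap.secondCountableTopology isOpenMap_proj

theorem continuous_act_prod : Continuous fun p : GG.Space Γ × GG.points ℝ => act p.1 p.2 := by
  have h := (isOpenQuotientMap_proj (GG := GG) (Γ := Γ)).prodMap
    (IsOpenQuotientMap.id (X := GG.points ℝ))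
  refine h.isQuotientMap.continuous_iff.2 ?_
  exact continuous_proj.comp continuous_mul

theorem continuous_act_left (g : GG.points ℝ) : Continuous fun x : GG.Space Γ => act x g :=
  continuous_act_prod.comp (by fun_prop : Continuous fun x : GG.Space Γ => (x, g))

theorem continuous_act_right (x : GG.Space Γ) : Continuous fun g : GG.points ℝ => act x g :=
  continuous_act_prod.comp (by fun_prop : Continuous fun g : GG.points ℝ => (x, g))

theorem isOpenMap_act_right (x : GG.Space Γ) : IsOpenMap fun g : GG.points ℝ => act x g := by
  obtain ⟨a, rfl⟩ := proj_surjective x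
  exact isOpenMap_proj.comp (isOpenMap_mul_left a)

/-- The translation by `g` as a homeomorphism. -/
noncomputable def actHomeo (g : GG.points ℝ) : GG.Space Γ ≃ₜ GG.Space Γ where
  toFun x := act x g
  invFun x := act x g⁻¹
  left_inv x := by simp [← act_mul]
  right_inv x := by simp [← act_mul]
  continuous_toFun := continuous_act_left g
  continuous_invFun := continuous_act_left g⁻¹

@[simp] theorem emb_coe_smul (t : ℝ) (Z : GG.lie) :
    emb N ((t • Z : GG.lie) : Matrix (Fin N) (Fin N) ℝ) = t • emb N Z := map_smul (emb N) _ _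

@[simp] theorem emb_coe_add (Y Z : GG.lie) :
    emb N ((Y + Z : GG.lie) : Matrix (Fin N) (Fin N) ℝ) = emb N Y + emb N Z := map_add (emb N) _ _

theorem exp_zero : exp (0 : GG.lie) = 1 := mat_injective (by simp)

theorem exp_add_smul (s t : ℝ) (Z : GG.lie) : exp ((s + t) • Z) = exp (s • Z) * exp (t • Z) := by
  refine mat_injective ?_
  simp only [mat_exp, mat_mul, emb_coe_smul, emb_coe_add, add_smul]
  exact NormedSpace.exp_add_of_commute (((Commute.refl _).smul_left s).smul_right t)

theorem exp_neg (Z : GG.lie) : exp (-Z) = (exp Z)⁻¹ := by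
  have h := exp_add_smul (-1) 1 Z
  rw [neg_add_cancel, zero_smul, exp_zero, neg_smul, one_smul] at h
  exact eq_inv_of_mul_eq_one_left h.symm

theorem exp_Ad (g : GG.points ℝ) (Z : GG.lie) : exp (Ad g Z) = g * exp Z * g⁻¹ := by
  refine mat_injective ?_
  simp only [mat_exp, mat_mul, emb_Ad]
  exact NormedSpace.exp_units_conj ⟨mat g, mat g⁻¹, by simp, by simp⟩ _

theorem contDiff_mat_exp {E : Type*} [NormedAddCommGroup E] [NormedSpace ℝ E]
    [FiniteDimensional ℝ E] (L : E →ₗ[ℝ] GG.lie) : ContDiff ℝ ∞ fun a => mat (exp (L a)) := by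
  have h : ContDiff ℝ ∞ fun a => NormedSpace.exp
      (((emb N).toLinearMap ∘ₗ GG.lie.toSubmodule.subtype ∘ₗ L).toContinuousLinearMap a) :=
    contDiff_exp.comp (ContinuousLinearMap.contDiff _)
  have e : (fun a => mat (exp (L a))) = _ := funext fun a => mat_exp (L a)
  rw [e]
  exact h

theorem continuous_exp_comp {E : Type*} [NormedAddCommGroup E] [NormedSpace ℝ E]
    [FiniteDimensional ℝ E] (L : E →ₗ[ℝ] GG.lie) : Continuous fun a => exp (L a) :=
  isEmbedding_mat.continuous_iff.2 (contDiff_mat_exp L).continuous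

theorem contDiff_mat_exp_smul (Z : GG.lie) : ContDiff ℝ ∞ fun t : ℝ => mat (exp (t • Z)) :=
  contDiff_mat_exp (LinearMap.toSpanSingleton ℝ GG.lie Z)

theorem continuous_exp_smul (Z : GG.lie) : Continuous fun t : ℝ => exp (t • Z) :=
  continuous_exp_comp (LinearMap.toSpanSingleton ℝ GG.lie Z)

variable (b : Module.Basis (Fin (Module.finrank ℝ GG.lie)) ℝ GG.lie)

/-- Continuity on the quotient can be checked in exponential coordinates. -/
theorem continuous_of_exp {F : GG.Space Γ → ℝ}
    (h : ∀ x, ContinuousAt (fun a => F (act x (exp (lin b a)))) 0) : Continuous F := by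
  obtain ⟨Λ, hΛ, hΛ1, hev⟩ := exists_log (GG := GG) b
  refine isOpenQuotientMap_proj.isQuotientMap.continuous_iff.2 ?_
  rw [continuous_iff_continuousAt]
  intro g₀
  have h1 : Tendsto (fun g : GG.points ℝ => g₀⁻¹ * g) (𝓝 g₀) (𝓝 1) := by
    have := (continuous_const_mul g₀⁻¹).tendsto g₀
    rwa [inv_mul_cancel] at this
  have h2 : Tendsto (fun g : GG.points ℝ => Λ (mat (g₀⁻¹ * g))) (𝓝 g₀) (𝓝 0) := by
    have h3 : Tendsto Λ (𝓝 (mat (1 : GG.points ℝ))) (𝓝 0) := by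
      have := hΛ.continuousAt.tendsto
      rwa [hΛ1, ← mat_one (GG := GG)] at this
    exact h3.comp ((continuous_mat.tendsto _).comp h1)
  have h4 := (h (proj Γ g₀)).tendsto.comp h2
  have h5 : F (act (proj Γ g₀) (exp (lin b 0))) = F (proj Γ g₀) := by
    rw [map_zero, exp_zero, act_one]
  rw [h5] at h4
  refine h4.congr' ?_
  filter_upwards [h1.eventually hev] with g hg
  simp only [Function.comp_apply]
  rw [hg, act_proj, mul_inv_cancel_left]

namespace IsTestFunction

variable {f : GG.Space Γ → ℝ} (hf : IsTestFunction f)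

include hf

/-- A test function is smooth along smooth maps to the group. -/
theorem contDiff_comp {E : Type*} [NormedAddCommGroup E] [NormedSpace ℝ E]
    {γ : E → GG.points ℝ} (hγ : ContDiff ℝ ∞ fun a => mat (γ a)) (x : GG.Space Γ) :
    ContDiff ℝ ∞ fun a => f (act x (γ a)) := by
  let b := Module.finBasis ℝ GG.lie
  obtain ⟨Λ, hΛ, hΛ1, hev⟩ := exists_log (GG := GG) b
  rw [contDiff_iff_contDiffAt]
  intro a₀
  have hγc : Continuous γ := isEmbedding_mat.continuous_iff.2 hγ.continuous
  -- Test functions are smooth in exponential coordinates at every point. The map is therefore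
  -- recentred at `1` by `(γ a₀)⁻¹`, and its logarithm is used at the base point `x γ(a₀)`.
  have h1 : ContDiffAt ℝ ∞ (fun a => mat ((γ a₀)⁻¹ * γ a)) a₀ := by
    simp only [mat_mul]
    exact (contDiff_const.mul hγ).contDiffAt
  have h2 : ContDiffAt ℝ ∞ (fun a => Λ (mat ((γ a₀)⁻¹ * γ a))) a₀ := by
    refine ContDiffAt.comp (g := Λ) a₀ ?_ h1
    rwa [inv_mul_cancel, mat_one]
  have h3 := (hf.smooth (act x (γ a₀)) _ (lin b)).contDiffAt.comp a₀ h2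
  refine h3.congr_of_eventuallyEq ?_
  have h4 : Tendsto (fun a => (γ a₀)⁻¹ * γ a) (𝓝 a₀) (𝓝 1) := by
    have := ((continuous_const_mul (γ a₀)⁻¹).comp hγc).tendsto a₀
    simpa [Function.comp_def] using this
  filter_upwards [h4.eventually hev] with a ha
  simp only [Function.comp_apply]
  rw [ha, ← act_mul, mul_inv_cancel_left]

theorem hasDerivAt (x : GG.Space Γ) (Z : GG.lie) (t : ℝ) :
    HasDerivAt (fun s : ℝ => f (act x (exp (s • Z)))) (lieDeriv Z f (act x (exp (t • Z)))) t := by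
  have h1 : ∀ y, HasDerivAt (fun s : ℝ => f (act y (exp (s • Z)))) (lieDeriv Z f y) 0 := fun y =>
    ((hf.contDiff_comp (contDiff_mat_exp_smul Z) y).differentiable (by simp)).differentiableAt.hasDerivAt
  have h2 := h1 (act x (exp (t • Z)))
  have h3 : HasDerivAt (fun s : ℝ => s - t) 1 t := by simpa using (hasDerivAt_id t).sub_const t
  have h4 := HasDerivAt.comp (h₂ := fun s : ℝ => f (act (act x (exp (t • Z))) (exp (s • Z)))) t
    (by rwa [sub_self]) h3
  rw [mul_one] at h4
  refine h4.congr_of_eventuallyEq (Eventually.of_forall fun s => ?_)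
  simp only [Function.comp_apply]
  rw [← act_mul, ← exp_add_smul, add_sub_cancel]

/-- All these derivatives are directional derivatives at the origin of the single smooth function `c
↦ f(x exp(lin c))`, hence linear in the direction. -/
theorem lieDeriv_lin (a : Coord GG) (x : GG.Space Γ) :
    lieDeriv (lin b a) f x = ∑ i, a i * lieDeriv (b i) f x := by
  set F := fun c : Coord GG => f (act x (exp (lin b c))) with hF
  have hd : HasFDerivAt F (fderiv ℝ F 0) 0 :=
    ((hf.smooth x _ (lin b)).differentiable (by simp)).differentiableAt.hasFDerivAt
  have key : ∀ c : Coord GG, lieDeriv (lin b c) f x = fderiv ℝ F 0 c := by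
    intro c
    have h1 : HasDerivAt (fun t : ℝ => t • c) c 0 := by
      simpa using (hasDerivAt_id (0 : ℝ)).smul_const c
    have h2 := HasFDerivAt.comp_hasDerivAt (l := F) (0 : ℝ) (by rwa [zero_smul]) h1
    have h3 : (F ∘ fun t : ℝ => t • c) = fun t => f (act x (exp (t • lin b c))) := by
      funext t
      simp [hF]
    rw [h3] at h2
    exact h2.deriv
  have hb : ∀ i, lin b (Pi.single i 1) = b i := by
    intro i
    simp [lin_apply, Pi.single_apply]
  rw [key]
  conv_lhs => rw [pi_eq_sum_univ' a]
  rw [map_sum]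
  refine Finset.sum_congr rfl fun i _ => ?_
  rw [map_smul, smul_eq_mul, ← hb i, key]

/-- In exponential coordinates the derivative is the partial derivative at `t = 0` of the smooth
function `(a, t) ↦ f(x exp(La) exp(tZ))`. The support does not grow: off the support of `f`, short
pieces of the one-parameter orbit avoid it. -/
theorem lieDeriv (Z : GG.lie) : IsTestFunction (lieDeriv Z f) := by
  have hs : ∀ (x : GG.Space Γ) (n : ℕ) (L : (Fin n → ℝ) →ₗ[ℝ] GG.lie),
      ContDiff ℝ ∞ (fun a : Fin n → ℝ => QGroup.lieDeriv Z f (act x (exp (L a)))) := by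
    intro x n L
    set J : (Fin n → ℝ) × ℝ → ℝ := fun p => f (act x (exp (L p.1) * exp (p.2 • Z))) with hJ
    have hJs : ContDiff ℝ ∞ J := by
      refine hf.contDiff_comp ?_ x
      simp only [mat_mul]
      exact ((contDiff_mat_exp L).comp contDiff_fst).mul
        ((contDiff_mat_exp_smul Z).comp contDiff_snd)
    have h1 : ∀ a, QGroup.lieDeriv Z f (act x (exp (L a))) = fderiv ℝ J (a, 0) (0, 1) := by
      intro a
      have h2 : HasDerivAt (fun t : ℝ => (a, t)) (0, 1) 0 :=
        (hasDerivAt_const (0 : ℝ) a).prodMk (hasDerivAt_id 0)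
      have h3 := HasFDerivAt.comp_hasDerivAt (l := J) (0 : ℝ)
        ((hJs.differentiable (by simp)).differentiableAt.hasFDerivAt (x := (a, 0))) h2
      have h4 : (J ∘ fun t : ℝ => (a, t)) = fun t => f (act (act x (exp (L a))) (exp (t • Z))) := by
        funext t
        simp [hJ, act_mul]
      rw [h4] at h3
      exact h3.deriv
    simp only [h1]
    have h5 : ContDiff ℝ ∞ (fderiv ℝ J) := hJs.fderiv_right (by simp)
    exact (h5.comp (contDiff_id.prodMk contDiff_const)).clm_apply contDiff_const
  refine ⟨continuous_of_exp (Module.finBasis ℝ GG.lie)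
    fun x => (hs x _ _).continuous.continuousAt, ?_, hs⟩
  refine hf.hasCompactSupport.mono' fun x hx => ?_
  by_contra hxs
  refine hx ?_
  have hopen : IsOpen (tsupport f)ᶜ := (isClosed_tsupport f).isOpen_compl
  have hc : Continuous fun t : ℝ => act x (exp (t • Z)) :=
    (continuous_act_right x).comp (continuous_exp_smul Z)
  have hmem : ∀ᶠ t : ℝ in 𝓝 0, act x (exp (t • Z)) ∈ (tsupport f)ᶜ := by
    refine hc.continuousAt.eventually (hopen.mem_nhds ?_)
    simpa [exp_zero] using hxs
  have h0 : (fun t : ℝ => f (act x (exp (t • Z)))) =ᶠ[𝓝 0] fun _ => 0 :=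
    hmem.mono fun t ht => image_eq_zero_of_notMem_tsupport ht
  rw [QGroup.lieDeriv, h0.deriv_eq, deriv_const]

theorem translate (g : GG.points ℝ) : IsTestFunction fun x => f (act x g) where
  continuous := hf.continuous.comp (continuous_act_left g)
  hasCompactSupport := hf.hasCompactSupport.comp_homeomorph (actHomeo g)
  smooth x n L := by
    simp only [← act_mul]
    refine hf.contDiff_comp ?_ x
    simp only [mat_mul]
    exact (contDiff_mat_exp L).mul contDiff_const

end IsTestFunction

end EffEqui.QGroup

/-! ### The trace form and the integral structure of the Lie algebra. -/

namespace EffEqui.QGroup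

open scoped ContDiff
open Filter Topology

/-- A linear Lie algebra on which the trace form vanishes is solvable. -/
theorem isSolvable_of_trace_eq_zero {L V : Type*} [LieRing L] [LieAlgebra ℝ L]
    [AddCommGroup V] [Module ℝ V] [FiniteDimensional ℝ V]
    (φ : L →ₗ⁅ℝ⁆ Module.End ℝ V) (hφ : Function.Injective φ)
    (h : ∀ x y, LinearMap.trace ℝ V (φ x * φ y) = 0) : LieAlgebra.IsSolvable L := by
  have : FiniteDimensional ℝ L := Module.Finite.of_injective (φ : L →ₗ[ℝ] Module.End ℝ V) hφ
  let : LieRingModule L V := LieRingModule.compLieHom V φ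
  let : LieModule ℝ L V := LieModule.compLieHom V φ
  have hto : ∀ x, LieModule.toEnd ℝ L V x = φ x := fun x => rfl
  have h1 : LieModule.traceForm ℝ L V = 0 := by
    ext x y
    rw [LieModule.traceForm_apply_apply, hto, hto]
    exact h x y
  -- Cartan's criterion: the derived algebra acts by nilpotent endomorphisms of `V`. Their adjoint
  -- actions are nilpotent too, so by Engel's theorem the derived algebra is nilpotent, and `L` is
  -- solvable.
  have h2 := LieModule.isNilpotent_derivedSeries_of_traceForm_eq_zero h1
  rw [LieModule.isNilpotent_iff_forall' (R := ℝ)] at h2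
  set D := LieAlgebra.derivedSeries ℝ L 1 with hD
  have h3 : LieRing.IsNilpotent D := by
    rw [LieAlgebra.isNilpotent_iff_forall (R := ℝ)]
    intro x
    have h4 : IsNilpotent (φ (x : L)) := h2 x
    obtain ⟨k, hk⟩ := LieAlgebra.ad_nilpotent_of_nilpotent (R := ℝ) h4
    refine ⟨k, LinearMap.ext fun y => Subtype.ext (hφ ?_)⟩
    have h5 : ∀ j, φ (((LieAlgebra.ad ℝ D x ^ j) y : D) : L)
        = (LieAlgebra.ad ℝ (Module.End ℝ V) (φ x) ^ j) (φ (y : L)) := by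
      intro j
      induction j with
      | zero => simp
      | succ j ih =>
        rw [pow_succ', pow_succ', Module.End.mul_apply, Module.End.mul_apply, ← ih,
          LieAlgebra.ad_apply, LieAlgebra.ad_apply, ← LieHom.map_lie]
        rfl
    rw [h5, hk]
    simp
  obtain ⟨k, hk⟩ := LieAlgebra.IsSolvable.solvable ℝ D
  rw [LieIdeal.derivedSeries_eq_bot_iff] at hk
  refine LieAlgebra.IsSolvable.mk (R := ℝ) (k := k + 1) ?_
  rw [LieAlgebra.derivedSeries_def, LieAlgebra.derivedSeriesOfIdeal_add]
  exact hk

variable {N : ℕ} {GG : QGroup N} {Γ : Subgroup (SL N ℤ)}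

theorem bracket_mem_lie {X Y : Matrix (Fin N) (Fin N) ℝ} (hX : X ∈ GG.lie) (hY : Y ∈ GG.lie) :
    X * Y - Y * X ∈ GG.lie := GG.lie.lie_mem hX hY

/-- The trace form is non-degenerate on a semisimple linear Lie algebra. -/
theorem eq_zero_of_forall_trace (hss : LieAlgebra.IsSemisimple ℝ GG.lie) {X : GG.lie}
    (hX : ∀ Y : GG.lie, ((X : Matrix (Fin N) (Fin N) ℝ) * (Y : Matrix (Fin N) (Fin N) ℝ)).trace = 0) :
    X = 0 := by
  let I : LieIdeal ℝ GG.lie :=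
    { carrier := {X | ∀ Y : GG.lie,
        ((X : Matrix (Fin N) (Fin N) ℝ) * (Y : Matrix (Fin N) (Fin N) ℝ)).trace = 0}
      add_mem' := by
        intro a c ha hc Y
        have : ((a + c : GG.lie) : Matrix (Fin N) (Fin N) ℝ)
          = (a : Matrix (Fin N) (Fin N) ℝ) + (c : Matrix (Fin N) (Fin N) ℝ) := rfl
        rw [this, add_mul, Matrix.trace_add, ha Y, hc Y, add_zero]
      zero_mem' := by
        intro Y
        have : ((0 : GG.lie) : Matrix (Fin N) (Fin N) ℝ) = 0 := rfl
        rw [this, zero_mul, Matrix.trace_zero]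
      smul_mem' := by
        intro t a ha Y
        have : ((t • a : GG.lie) : Matrix (Fin N) (Fin N) ℝ)
          = t • (a : Matrix (Fin N) (Fin N) ℝ) := rfl
        rw [this, Matrix.smul_mul, Matrix.trace_smul, ha Y, smul_zero]
      lie_mem := by
        intro x a ha Y
        have h1 : ((⁅x, a⁆ : GG.lie) : Matrix (Fin N) (Fin N) ℝ)
          = (x : Matrix (Fin N) (Fin N) ℝ) * a - (a : Matrix (Fin N) (Fin N) ℝ) * x := rfl
        have h2 := ha ⟨_, bracket_mem_lie Y.2 x.2⟩
        simp only [mul_sub, Matrix.trace_sub] at h2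
        rw [h1, sub_mul, Matrix.trace_sub, mul_assoc, Matrix.trace_mul_comm, mul_assoc, mul_assoc]
        exact h2 }
  -- The kernel of the trace form is an ideal on which the form vanishes, hence a solvable ideal,
  -- and a semisimple algebra has none but zero.
  have hI : I = ⊥ := by
    suffices LieAlgebra.IsSolvable I from LieAlgebra.HasTrivialRadical.eq_bot_of_isSolvable I
    refine isSolvable_of_trace_eq_zero (V := Fin N → ℝ)
      ((lieEquivMatrix'.symm : Matrix (Fin N) (Fin N) ℝ ≃ₗ⁅ℝ⁆ _).toLieHom.comp
        (GG.lie.incl.comp I.incl)) ?_ ?_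
    · exact lieEquivMatrix'.symm.injective.comp
        (Subtype.val_injective.comp Subtype.val_injective)
    · intro x y
      have h := x.2 (y : GG.lie)
      rw [← Matrix.trace_toLin'_eq, Matrix.toLin'_mul] at h
      exact h
  have : X ∈ I := hX
  rw [hI] at this
  simpa using this

/-- The rational structure: entrywise `ℚ`-linear maps preserve the Lie algebra. -/
theorem map_mem_lie (μ : ℝ →ₗ[ℚ] ℝ) {X : Matrix (Fin N) (Fin N) ℝ} (hX : X ∈ GG.lie) :
    X.map μ ∈ GG.lie := by
  -- As `μ` is only `ℚ`-linear, `a + εb ↦ a + εμ(b)` is multiplicative only where `a` is rational.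
  -- The entries of `1 + εX` have this form, so the point descends to `S` and can be mapped forward.
  let S : Subalgebra ℚ (DualNumber ℝ) :=
    { carrier := {a | ∃ q : ℚ, a.fst = q}
      mul_mem' := by
        rintro a c ⟨p, hp⟩ ⟨q, hq⟩
        exact ⟨p * q, by simp [hp, hq]⟩
      add_mem' := by
        rintro a c ⟨p, hp⟩ ⟨q, hq⟩
        exact ⟨p + q, by simp [hp, hq]⟩
      algebraMap_mem' := fun r => ⟨r, by simp [TrivSqZeroExt.algebraMap_eq_inl']⟩ }
  let inc : S →ₐ[ℚ] DualNumber ℝ :=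
    { toFun := fun a => TrivSqZeroExt.inl a.1.fst + TrivSqZeroExt.inr (μ a.1.snd)
      map_one' := by ext <;> simp
      map_mul' := by
        rintro ⟨a, p, hp⟩ ⟨c, q, hq⟩
        ext
        · simp
        · have h1 : ∀ (r : ℚ) (x : ℝ), μ ((r : ℝ) * x) = (r : ℝ) * μ x := fun r x => by
            rw [← Rat.smul_def, map_smul, Rat.smul_def]
          have h2 : μ (a.snd * c.fst) = μ a.snd * c.fst := by rw [hq, mul_comm, h1, mul_comm]
          have h3 : μ (a.fst * c.snd) = a.fst * μ c.snd := by rw [hp, h1]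
          simp [h2, h3]
      map_zero' := by ext <;> simp
      map_add' := fun a c => by ext <;> simp
      commutes' := fun r => by ext <;> simp [TrivSqZeroExt.algebraMap_eq_inl'] }
  have hmem : ∀ i j, tangent X i j ∈ S := fun i j =>
    ⟨(1 : Matrix (Fin N) (Fin N) ℚ) i j, by by_cases h : i = j <;> simp [tangent, Matrix.one_apply, h]⟩
  obtain ⟨A, hA, hAX⟩ := hX
  obtain ⟨B, hB, hBX⟩ := GG.descend S.val Subtype.val_injective
    (Matrix.of fun i j => (⟨tangent X i j, hmem i j⟩ : S)) hA (by rw [hAX]; rfl)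
  refine ⟨_, GG.map_mem inc hB, ?_⟩
  change B.1.map inc = _
  rw [hBX]
  ext i j <;> by_cases h : i = j <;> simp [tangent, inc, h]

/-- A matrix with integral entries. -/
def IsIntegral (X : Matrix (Fin N) (Fin N) ℝ) : Prop := ∀ i j, ∃ n : ℤ, X i j = n

/-- Expanding the entries of `X` in a `ℚ`-basis of `ℝ` writes `X` as a finite real combination of
rational matrices. These lie in the Lie algebra by `map_mem_lie`, and clearing denominators makes
them integral. -/
theorem span_isIntegral : Submodule.span ℝ {v : GG.lie | IsIntegral (v : Matrix (Fin N) (Fin N) ℝ)}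
    = ⊤ := by
  have hrat : ∀ v : GG.lie, (∀ i j, ∃ q : ℚ, (v : Matrix (Fin N) (Fin N) ℝ) i j = q) →
      v ∈ Submodule.span ℝ {v : GG.lie | IsIntegral (v : Matrix (Fin N) (Fin N) ℝ)} := by
    intro v hv
    choose q hq using hv
    set M : ℕ := ∏ ij : Fin N × Fin N, (q ij.1 ij.2).den with hM
    have hM0 : (M : ℝ) ≠ 0 := by
      rw [hM]
      exact_mod_cast Finset.prod_ne_zero_iff.2
        fun (ij : Fin N × Fin N) _ => (q ij.1 ij.2).den_nz
    have h1 : (M : ℝ) • v ∈ Submodule.span ℝ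
        {v : GG.lie | IsIntegral (v : Matrix (Fin N) (Fin N) ℝ)} := by
      refine Submodule.subset_span fun i j => ?_
      obtain ⟨k, hk⟩ : (q i j).den ∣ M := Finset.dvd_prod_of_mem
        (fun ij : Fin N × Fin N => (q ij.1 ij.2).den) (Finset.mem_univ (i, j))
      refine ⟨k * (q i j).num, ?_⟩
      have h2 : (((M : ℝ) • v : GG.lie) : Matrix (Fin N) (Fin N) ℝ) i j
        = (M : ℝ) * (v : Matrix (Fin N) (Fin N) ℝ) i j := rfl
      have h3 : ((q i j).den : ℝ) * (q i j : ℝ) = (q i j).num := by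
        exact_mod_cast Rat.den_mul_eq_num (q i j)
      rw [h2, hq, hk]
      push_cast
      rw [← h3]
      ring
    have h2 := Submodule.smul_mem _ (M : ℝ)⁻¹ h1
    rwa [smul_smul, inv_mul_cancel₀ hM0, one_smul] at h2
  rw [eq_top_iff]
  rintro X -
  let β := Module.Basis.ofVectorSpace ℚ ℝ
  let S : Finset (Module.Basis.ofVectorSpaceIndex ℚ ℝ) := Finset.univ.biUnion
    fun ij : Fin N × Fin N => (β.repr ((X : Matrix (Fin N) (Fin N) ℝ) ij.1 ij.2)).support
  let c (k : Module.Basis.ofVectorSpaceIndex ℚ ℝ) : ℝ →ₗ[ℚ] ℝ :=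
    (Algebra.linearMap ℚ ℝ).comp (β.coord k)
  let Y (k : Module.Basis.ofVectorSpaceIndex ℚ ℝ) : GG.lie := ⟨_, map_mem_lie (c k) X.2⟩
  have hX : X = ∑ k ∈ S, (β k : ℝ) • Y k := by
    refine Subtype.ext ?_
    have h1 : ((∑ k ∈ S, (β k : ℝ) • Y k : GG.lie) : Matrix (Fin N) (Fin N) ℝ)
        = ∑ k ∈ S, (β k : ℝ) • (X : Matrix (Fin N) (Fin N) ℝ).map (c k) :=
      map_sum GG.lie.toSubmodule.subtype _ _
    rw [h1]
    ext i j
    rw [Matrix.sum_apply]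
    have h2 := β.linearCombination_repr ((X : Matrix (Fin N) (Fin N) ℝ) i j)
    rw [Finsupp.linearCombination_apply, Finsupp.sum_of_support_subset (s := S) _
      (Finset.subset_biUnion_of_mem (fun ij : Fin N × Fin N =>
        (β.repr ((X : Matrix (Fin N) (Fin N) ℝ) ij.1 ij.2)).support) (Finset.mem_univ (i, j)))
      _ (by simp)] at h2
    refine h2.symm.trans (Finset.sum_congr rfl fun k _ => ?_)
    simp [c, Rat.smul_def, mul_comm]
  rw [hX]
  refine Submodule.sum_mem _ fun k _ => Submodule.smul_mem _ _ (hrat _ fun i j => ?_)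
  exact ⟨β.coord k ((X : Matrix (Fin N) (Fin N) ℝ) i j), rfl⟩

/-- There is a basis of the Lie algebra consisting of integral matrices. -/
theorem exists_integral_basis : ∃ (ι : Type) (_ : Fintype ι) (_ : DecidableEq ι)
    (e : Module.Basis ι ℝ GG.lie), ∀ k, IsIntegral (e k : Matrix (Fin N) (Fin N) ℝ) := by
  obtain ⟨s, hs, hspan, hli⟩ := exists_linearIndependent ℝ
    {v : GG.lie | IsIntegral (v : Matrix (Fin N) (Fin N) ℝ)}
  rw [span_isIntegral] at hspan
  let e : Module.Basis s ℝ GG.lie := Module.Basis.mk hli (by simp [hspan])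
  classical
  exact ⟨s, FiniteDimensional.fintypeBasisIndex e, inferInstance, e, fun k => by
    rw [Module.Basis.mk_apply]; exact hs k.2⟩

theorem IsIntegral.trace {X : Matrix (Fin N) (Fin N) ℝ} (hX : IsIntegral X) :
    ∃ n : ℤ, X.trace = n := by
  choose n hn using hX
  exact ⟨∑ i, n i i, by simp [Matrix.trace, hn]⟩

theorem IsIntegral.mul {X Y : Matrix (Fin N) (Fin N) ℝ} (hX : IsIntegral X) (hY : IsIntegral Y) :
    IsIntegral (X * Y) := by
  choose m hm using hX
  choose n hn using hY
  exact fun i j => ⟨∑ k, m i k * n k j, by simp [Matrix.mul_apply, hm, hn]⟩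

/-- An integral representative in the Lie algebra of the functional `Y ↦ tr (B Y)`. -/
theorem exists_integral_trace (hss : LieAlgebra.IsSemisimple ℝ GG.lie) : ∃ D : ℤ, D ≠ 0 ∧
    ∀ B : Matrix (Fin N) (Fin N) ℝ, IsIntegral B → ∃ u : GG.lie,
      IsIntegral (u : Matrix (Fin N) (Fin N) ℝ) ∧ ∀ Y : GG.lie,
        ((u : Matrix (Fin N) (Fin N) ℝ) * (Y : Matrix (Fin N) (Fin N) ℝ)).trace
          = D * (B * (Y : Matrix (Fin N) (Fin N) ℝ)).trace := by
  obtain ⟨ι, _, _, e, he⟩ := exists_integral_basis (GG := GG)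
  choose T hT using fun i j => ((he i).mul (he j)).trace
  have hcoe : ∀ c : ι → ℝ, ((∑ i, c i • e i : GG.lie) : Matrix (Fin N) (Fin N) ℝ)
      = ∑ i, c i • (e i : Matrix (Fin N) (Fin N) ℝ) := fun c =>
    map_sum GG.lie.toSubmodule.subtype _ _
  have htr : ∀ (c : ι → ℝ) (k : ι), (((∑ i, c i • e i : GG.lie) : Matrix (Fin N) (Fin N) ℝ)
      * (e k : Matrix (Fin N) (Fin N) ℝ)).trace = ∑ i, c i * (T i k : ℝ) := by
    intro c k
    rw [hcoe, Finset.sum_mul, Matrix.trace_sum]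
    exact Finset.sum_congr rfl fun i _ => by rw [Matrix.smul_mul, Matrix.trace_smul, hT, smul_eq_mul]
  have hext : ∀ (P Q : Matrix (Fin N) (Fin N) ℝ),
      (∀ k, (P * (e k : Matrix (Fin N) (Fin N) ℝ)).trace
        = (Q * (e k : Matrix (Fin N) (Fin N) ℝ)).trace) →
      ∀ Y : GG.lie, (P * (Y : Matrix (Fin N) (Fin N) ℝ)).trace
        = (Q * (Y : Matrix (Fin N) (Fin N) ℝ)).trace := by
    intro P Q h Y
    rw [← e.sum_repr Y, hcoe, Finset.mul_sum, Finset.mul_sum, Matrix.trace_sum, Matrix.trace_sum]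
    exact Finset.sum_congr rfl fun i _ => by
      rw [Matrix.mul_smul, Matrix.mul_smul, Matrix.trace_smul, Matrix.trace_smul, h]
  -- `D` is the Gram determinant of the trace form in an integral basis, non-zero by non-degeneracy.
  -- Solving the linear system with the adjugate in place of the inverse keeps the coordinates of
  -- `u` integral, at the price of the factor `D`.
  let TM : Matrix ι ι ℤ := Matrix.of T
  refine ⟨TM.det, fun hdet => ?_, fun B hB => ?_⟩
  · have hdet' : (TM.map (Int.castRingHom ℝ)).det = 0 := by
      rw [← RingHom.mapMatrix_apply, ← RingHom.map_det, hdet, map_zero]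
    obtain ⟨c, hc, hc0⟩ := Matrix.exists_vecMul_eq_zero_iff.2 hdet'
    refine hc ?_
    have h1 : ∑ i, c i • e i = 0 := by
      refine eq_zero_of_forall_trace hss fun Y => ?_
      have h2 := hext (∑ i, c i • e i : GG.lie) 0 (fun k => ?_) Y
      · rw [h2, zero_mul, Matrix.trace_zero]
      · rw [htr, zero_mul, Matrix.trace_zero]
        have := congrFun hc0 k
        simpa [Matrix.vecMul, dotProduct, TM] using this
    exact funext (Fintype.linearIndependent_iff.1 e.linearIndependent c h1)
  · choose t ht using fun j => (hB.mul (he j)).trace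
    set c : ι → ℤ := Matrix.vecMul t TM.adjugate with hc
    refine ⟨∑ i, (c i : ℝ) • e i, fun i j => ?_, fun Y =>
      (hext _ ((TM.det : ℝ) • B) (fun k => ?_) Y).trans ?_⟩
    · choose m hm using he
      refine ⟨∑ k, c k * m k i j, ?_⟩
      rw [hcoe, Matrix.sum_apply]
      simp [hm]
    · rw [htr, Matrix.smul_mul, Matrix.trace_smul, ht]
      have h1 : Matrix.vecMul c TM = TM.det • t := by
        rw [hc, Matrix.vecMul_vecMul, Matrix.adjugate_mul, Matrix.vecMul_smul, Matrix.vecMul_one]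
      have h2 := congrFun h1 k
      simp only [Matrix.vecMul, dotProduct, Pi.smul_apply, smul_eq_mul, TM, Matrix.of_apply] at h2
      rw [smul_eq_mul]
      exact_mod_cast h2
    · rw [Matrix.smul_mul, Matrix.trace_smul, smul_eq_mul]

end EffEqui.QGroup

/-! ### Euclidean norms and the distortion of the adjoint action. -/

namespace EffEqui

open Filter Topology

namespace EuclideanNorm

variable {N : ℕ} (E : EuclideanNorm N)

theorem form_self_nonneg (X : Matrix (Fin N) (Fin N) ℝ) : 0 ≤ E.form X X := by
  rcases eq_or_ne X 0 with rfl | h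
  · simp
  · exact (E.pos X h).le

theorem norm_nonneg (X : Matrix (Fin N) (Fin N) ℝ) : 0 ≤ E.norm X := Real.sqrt_nonneg _

theorem sq_norm (X : Matrix (Fin N) (Fin N) ℝ) : E.norm X ^ 2 = E.form X X :=
  Real.sq_sqrt (E.form_self_nonneg X)

theorem norm_pos {X : Matrix (Fin N) (Fin N) ℝ} (hX : X ≠ 0) : 0 < E.norm X :=
  Real.sqrt_pos.2 (E.pos X hX)

theorem norm_smul (c : ℝ) (X : Matrix (Fin N) (Fin N) ℝ) : E.norm (c • X) = |c| * E.norm X := by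
  rw [norm, norm, ← Real.sqrt_sq_eq_abs, ← Real.sqrt_mul (sq_nonneg c)]
  congr 1
  simp only [map_smul, LinearMap.smul_apply, smul_eq_mul]
  ring

theorem norm_zero : E.norm 0 = 0 := by simp [norm]

theorem norm_add_le (X Y : Matrix (Fin N) (Fin N) ℝ) : E.norm (X + Y) ≤ E.norm X + E.norm Y := by
  have hcs := LinearMap.BilinForm.apply_sq_le_of_symm E.form E.form_self_nonneg
    ⟨fun X Y => E.symm X Y⟩ X Y
  have h1 : E.form X Y ≤ E.norm X * E.norm Y := by
    refine (le_abs_self _).trans (abs_le_of_sq_le_sq ?_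
      (mul_nonneg (E.norm_nonneg _) (E.norm_nonneg _)))
    rw [mul_pow, sq_norm, sq_norm]
    exact hcs
  refine (le_abs_self _).trans (abs_le_of_sq_le_sq ?_
    (add_nonneg (E.norm_nonneg _) (E.norm_nonneg _)))
  have h2 := E.symm X Y
  rw [add_sq, sq_norm, sq_norm, sq_norm]
  simp only [map_add, LinearMap.add_apply]
  linarith

theorem exists_le_norm_emb : ∃ κ : ℝ, 1 ≤ κ ∧ ∀ X : Matrix (Fin N) (Fin N) ℝ,
    E.norm X ≤ κ * ‖QGroup.emb N X‖ ∧ ‖QGroup.emb N X‖ ≤ κ * E.norm X := by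
  let B : QGroup.EndN N →ₗ[ℝ] QGroup.EndN N →ₗ[ℝ] ℝ :=
    E.form.compl₁₂ (QGroup.emb N).symm.toLinearMap (QGroup.emb N).symm.toLinearMap
  let T : QGroup.EndN N →L[ℝ] QGroup.EndN N →L[ℝ] ℝ :=
    ((LinearMap.toContinuousLinearMap : (QGroup.EndN N →ₗ[ℝ] ℝ) ≃ₗ[ℝ] _).toLinearMap ∘ₗ
      B).toContinuousLinearMap
  have hT : ∀ X : Matrix (Fin N) (Fin N) ℝ, T (QGroup.emb N X) (QGroup.emb N X) = E.form X X :=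
    fun X => rfl
  have hc : Continuous fun M : QGroup.EndN N => E.norm ((QGroup.emb N).symm M) := by
    have : (fun M : QGroup.EndN N => E.norm ((QGroup.emb N).symm M)) = fun M => √(T M M) := rfl
    rw [this]
    exact (T.continuous.clm_apply continuous_id).sqrt
  have hS := isCompact_sphere (0 : QGroup.EndN N) 1
  obtain ⟨κ₁, h₁⟩ := hS.exists_bound_of_continuousOn hc.continuousOn
  have hpos : ∀ M ∈ Metric.sphere (0 : QGroup.EndN N) 1, E.norm ((QGroup.emb N).symm M) ≠ 0 := by
    intro M hM h0
    refine (E.norm_pos ?_).ne' h0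
    intro h
    rw [map_eq_zero_iff _ (QGroup.emb N).symm.injective] at h
    simp [h] at hM
  obtain ⟨κ₂, h₂⟩ := hS.exists_bound_of_continuousOn (hc.continuousOn.inv₀ hpos)
  refine ⟨max 1 (max κ₁ κ₂), le_max_left _ _, fun X => ?_⟩
  rcases eq_or_ne X 0 with rfl | hX
  · simp [E.norm_zero]
  have hn : 0 < ‖QGroup.emb N X‖ := norm_pos_iff.2 (by simpa using hX)
  have hM : ‖QGroup.emb N X‖⁻¹ • QGroup.emb N X ∈ Metric.sphere (0 : QGroup.EndN N) 1 := by
    rw [mem_sphere_zero_iff_norm, _root_.norm_smul, norm_inv, norm_norm, inv_mul_cancel₀ hn.ne']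
  have e : E.norm ((QGroup.emb N).symm (‖QGroup.emb N X‖⁻¹ • QGroup.emb N X))
      = ‖QGroup.emb N X‖⁻¹ * E.norm X := by
    rw [map_smul, AlgEquiv.symm_apply_apply, norm_smul, abs_of_pos (inv_pos.2 hn)]
  have hX' := E.norm_pos hX
  have e1 := h₁ _ hM
  have e2 := h₂ _ hM
  rw [Pi.inv_apply] at e2
  rw [e, norm_inv] at e2
  rw [e] at e1
  rw [Real.norm_of_nonneg (by positivity)] at e1 e2
  rw [inv_mul_le_iff₀ hn] at e1
  rw [mul_inv, inv_inv, ← div_eq_mul_inv, div_le_iff₀ hX'] at e2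
  constructor
  · refine e1.trans ?_
    rw [mul_comm]
    gcongr
    exact (le_max_left _ _).trans (le_max_right _ _)
  · refine e2.trans ?_
    gcongr
    exact (le_max_right _ _).trans (le_max_right _ _)

end EuclideanNorm

namespace QGroup

variable {N : ℕ} {GG : QGroup N} {Γ : Subgroup (SL N ℤ)}

theorem Ad_mul (g h : GG.points ℝ) (Z : GG.lie) : Ad (g * h) Z = Ad g (Ad h Z) := by
  refine Subtype.ext ((emb N).injective ?_)
  simp only [emb_Ad, mat_mul, mul_inv_rev, mul_assoc]

@[simp] theorem Ad_one (Z : GG.lie) : Ad 1 Z = Z := by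
  refine Subtype.ext ((emb N).injective ?_)
  simp [emb_Ad]

/-- The adjoint action as a linear map. -/
noncomputable def AdLin (g : GG.points ℝ) : GG.lie →ₗ[ℝ] GG.lie where
  toFun := Ad g
  map_add' Y Z := by
    refine Subtype.ext ((emb N).injective ?_)
    simp only [emb_Ad, emb_coe_add, mul_add, add_mul]
  map_smul' c Z := by
    refine Subtype.ext ((emb N).injective ?_)
    simp only [emb_Ad, emb_coe_smul, RingHom.id_apply, mul_smul_comm, smul_mul_assoc]

@[simp] theorem AdLin_apply (g : GG.points ℝ) (Z : GG.lie) : AdLin g Z = Ad g Z := rfl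

theorem Ad_ne_zero (g : GG.points ℝ) {Z : GG.lie} (hZ : Z ≠ 0) : Ad g Z ≠ 0 := by
  intro h
  have h1 : AdLin g⁻¹ (AdLin g Z) = AdLin g⁻¹ 0 := congrArg _ h
  rw [map_zero, AdLin_apply, AdLin_apply, ← Ad_mul, inv_mul_cancel, Ad_one] at h1
  exact hZ h1

theorem coe_ne_zero {Z : GG.lie} (hZ : Z ≠ 0) : (Z : Matrix (Fin N) (Fin N) ℝ) ≠ 0 :=
  fun h => hZ (Subtype.ext h)

/-- A bound for the distortion of norms by the adjoint action. -/
noncomputable def distortion (κ : ℝ) (g : GG.points ℝ) : ℝ :=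
  1 + κ ^ 2 * (‖mat g - 1‖ * ‖mat g⁻¹‖ + ‖mat g⁻¹ - 1‖)

theorem one_le_distortion (κ : ℝ) (g : GG.points ℝ) : 1 ≤ distortion κ g := by
  unfold distortion
  have : 0 ≤ κ ^ 2 * (‖mat g - 1‖ * ‖mat g⁻¹‖ + ‖mat g⁻¹ - 1‖) := by positivity
  linarith

theorem continuous_distortion (κ : ℝ) : Continuous fun g : GG.points ℝ => distortion κ g := by
  have h1 := continuous_mat (GG := GG)
  have h2 : Continuous fun g : GG.points ℝ => mat g⁻¹ := h1.comp continuous_inv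
  unfold distortion
  fun_prop

theorem distortion_one (κ : ℝ) : distortion κ (1 : GG.points ℝ) = 1 := by
  simp [distortion]

/-- The constant comparing a Euclidean norm with the operator norm. -/
noncomputable def _root_.EffEqui.EuclideanNorm.ratio (E : EuclideanNorm N) : ℝ :=
  E.exists_le_norm_emb.choose

variable (E : EuclideanNorm N)

theorem one_le_ratio : 1 ≤ E.ratio := E.exists_le_norm_emb.choose_spec.1

theorem norm_le_ratio (X : Matrix (Fin N) (Fin N) ℝ) : E.norm X ≤ E.ratio * ‖emb N X‖ :=
  (E.exists_le_norm_emb.choose_spec.2 X).1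

theorem norm_emb_le_ratio (X : Matrix (Fin N) (Fin N) ℝ) : ‖emb N X‖ ≤ E.ratio * E.norm X :=
  (E.exists_le_norm_emb.choose_spec.2 X).2

/-- The bound comes from `Ad g Z - Z = (g-1) Z g⁻¹ + Z (g⁻¹-1)`. Estimating the difference yields a
factor that tends to `1` as `g → 1`, which the continuity of the height needs. -/
theorem norm_Ad_le (g : GG.points ℝ) (Z : GG.lie) :
    E.norm (Ad g Z) ≤ distortion E.ratio g * E.norm Z := by
  have h1 : E.norm (Ad g Z) ≤ E.norm Z + E.norm ((Ad g Z - Z : GG.lie) : Matrix (Fin N) (Fin N) ℝ) := by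
    have := E.norm_add_le Z ((Ad g Z - Z : GG.lie) : Matrix (Fin N) (Fin N) ℝ)
    have e : (Z : Matrix (Fin N) (Fin N) ℝ) + ((Ad g Z - Z : GG.lie) : Matrix (Fin N) (Fin N) ℝ) = Ad g Z := by
      push_cast
      abel
    rwa [e] at this
  have h2 : emb N ((Ad g Z - Z : GG.lie) : Matrix (Fin N) (Fin N) ℝ)
      = (mat g - 1) * emb N Z * mat g⁻¹ + emb N Z * (mat g⁻¹ - 1) := by
    have : emb N ((Ad g Z - Z : GG.lie) : Matrix (Fin N) (Fin N) ℝ)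
      = emb N (Ad g Z) - emb N Z := map_sub (emb N) _ _
    rw [this, emb_Ad]
    noncomm_ring
  have h3 : ‖emb N ((Ad g Z - Z : GG.lie) : Matrix (Fin N) (Fin N) ℝ)‖
      ≤ (‖mat g - 1‖ * ‖mat g⁻¹‖ + ‖mat g⁻¹ - 1‖) * ‖emb N Z‖ := by
    rw [h2]
    refine (norm_add_le _ _).trans ?_
    have e1 : ‖(mat g - 1) * emb N Z * mat g⁻¹‖ ≤ ‖mat g - 1‖ * ‖emb N Z‖ * ‖mat g⁻¹‖ :=
      (norm_mul_le _ _).trans (mul_le_mul_of_nonneg_right (norm_mul_le _ _) (norm_nonneg _))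
    have e2 : ‖emb N Z * (mat g⁻¹ - 1)‖ ≤ ‖emb N Z‖ * ‖mat g⁻¹ - 1‖ := norm_mul_le _ _
    linarith
  have h4 := norm_le_ratio E ((Ad g Z - Z : GG.lie) : Matrix (Fin N) (Fin N) ℝ)
  have h5 := norm_emb_le_ratio E (Z : Matrix (Fin N) (Fin N) ℝ)
  have hκ := one_le_ratio E
  set a := ‖mat g - 1‖ * ‖mat g⁻¹‖ + ‖mat g⁻¹ - 1‖ with ha
  have ha0 : 0 ≤ a := by positivity
  have h6 : E.norm ((Ad g Z - Z : GG.lie) : Matrix (Fin N) (Fin N) ℝ) ≤ E.ratio * (a * (E.ratio * E.norm Z)) :=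
    h4.trans (mul_le_mul_of_nonneg_left (h3.trans (mul_le_mul_of_nonneg_left h5 ha0)) (by linarith))
  rw [distortion, ← ha]
  linarith

end QGroup

end EffEqui

/-! ### The height, the injectivity radius and unimodularity. -/

namespace EffEqui.QGroup

open scoped ContDiff
open Filter Topology

variable {N : ℕ} {GG : QGroup N} {Γ : Subgroup (SL N ℤ)} (E : EuclideanNorm N)

theorem norm_mat_inv_le {g : GG.points ℝ} (hg : ‖mat g - 1‖ ≤ 1 / 2) : ‖mat g⁻¹‖ ≤ 2 := by
  have h1 : mat g⁻¹ = 1 - mat g⁻¹ * (mat g - 1) := by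
    rw [mul_sub, mat_inv_mul_mat]
    simp
  have h2 := norm_sub_le (1 : EndN N) (mat g⁻¹ * (mat g - 1))
  rw [← h1] at h2
  have h3 := norm_mul_le (mat g⁻¹) (mat g - 1)
  have h4 := EndN.norm_one_le (N := N)
  nlinarith [norm_nonneg (mat g⁻¹)]

theorem norm_mat_inv_sub_le {g : GG.points ℝ} (hg : ‖mat g - 1‖ ≤ 1 / 2) :
    ‖mat g⁻¹ - 1‖ ≤ 2 * ‖mat g - 1‖ := by
  have h1 : mat g⁻¹ - 1 = mat g⁻¹ * (1 - mat g) := by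
    rw [mul_sub, mat_inv_mul_mat, mul_one]
  rw [h1]
  refine (norm_mul_le _ _).trans ?_
  rw [norm_sub_rev]
  exact mul_le_mul_of_nonneg_right (norm_mat_inv_le hg) (norm_nonneg _)

theorem norm_mat_mul_sub_le (g h : GG.points ℝ) :
    ‖mat (g * h) - 1‖ ≤ ‖mat g - 1‖ + ‖mat h - 1‖ + ‖mat g - 1‖ * ‖mat h - 1‖ := by
  have h1 : mat (g * h) - 1 = (mat g - 1) + (mat h - 1) + (mat g - 1) * (mat h - 1) := by
    rw [mat_mul]
    noncomm_ring
  rw [h1]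
  exact (norm_add_le _ _).trans (add_le_add (norm_add_le _ _) (norm_mul_le _ _))

theorem norm_mat_le {g : GG.points ℝ} (hg : ‖mat g - 1‖ ≤ 1) : ‖mat g‖ ≤ 2 := by
  have h1 := norm_add_le (mat g - 1) 1
  rw [sub_add_cancel] at h1
  linarith [EndN.norm_one_le (N := N)]

theorem exists_norm_entry_le : ∃ c : ℝ, 0 < c ∧ ∀ (X : Matrix (Fin N) (Fin N) ℝ) i j,
    |X i j| ≤ c * ‖emb N X‖ := by
  let T : EndN N →L[ℝ] (Fin N → Fin N → ℝ) :=
    LinearMap.toContinuousLinearMap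
      { toFun := fun M i j => (emb N).symm M i j
        map_add' := fun M M' => by rw [map_add]; rfl
        map_smul' := fun c M => by rw [map_smul]; rfl }
  refine ⟨‖T‖ + 1, by positivity, fun X i j => ?_⟩
  have h1 : ‖T (emb N X) i j‖ ≤ ‖T (emb N X)‖ :=
    (norm_le_pi_norm _ j).trans (norm_le_pi_norm (T (emb N X)) i)
  have h2 := T.le_opNorm (emb N X)
  have h3 : T (emb N X) i j = X i j := rfl
  rw [h3, Real.norm_eq_abs] at h1
  nlinarith [norm_nonneg (emb N X)]

/-- Non-zero integral matrices are not short. -/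
theorem exists_le_norm_of_isIntegral : ∃ c : ℝ, 0 < c ∧ ∀ X : Matrix (Fin N) (Fin N) ℝ,
    IsIntegral X → X ≠ 0 → c ≤ E.norm X := by
  obtain ⟨c, hc, h⟩ := exists_norm_entry_le (N := N)
  have hκ := one_le_ratio E
  refine ⟨(c * E.ratio)⁻¹, by positivity, fun X hX hX0 => ?_⟩
  have : ∃ i j, X i j ≠ 0 := by
    by_contra! hcon
    exact hX0 (Matrix.ext hcon)
  obtain ⟨i, j, hij⟩ := this
  obtain ⟨n, hn⟩ := hX i j
  have hn0 : n ≠ 0 := by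
    rintro rfl
    exact hij (by simpa using hn)
  have h1 : (1 : ℝ) ≤ |X i j| := by
    rw [hn]
    exact_mod_cast Int.one_le_abs hn0
  have h2 := h X i j
  have h3 := norm_emb_le_ratio E X
  rw [inv_le_iff_one_le_mul₀ (by positivity)]
  nlinarith

theorem isIntegral_intToReal (γ : SL N ℤ) : IsIntegral (intToReal N γ).1 :=
  fun i j => ⟨γ.1 i j, rfl⟩

theorem IsIntegral.Ad {γ : GG.points ℝ} (hγ : γ ∈ GG.discrete Γ) {v : GG.lie}
    (hv : IsIntegral (v : Matrix (Fin N) (Fin N) ℝ)) :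
    IsIntegral (Ad γ v : Matrix (Fin N) (Fin N) ℝ) := by
  obtain ⟨γ₀, _, h⟩ := hγ
  have h1 : (γ : SL N ℝ) = intToReal N γ₀ := h.symm
  change IsIntegral ((γ : SL N ℝ).1 * (v : Matrix (Fin N) (Fin N) ℝ) * ((γ : SL N ℝ)⁻¹).1)
  rw [h1, ← map_inv]
  exact ((isIntegral_intToReal _).mul hv).mul (isIntegral_intToReal _)

/-- Any two representatives differ by an element of `Γ`, which preserves integrality, and non-zero
integral matrices have norm bounded below. Undoing the fixed `Ad(g₀⁻¹)` costs only its distortion.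
-/
theorem height_bddAbove (x : GG.Space Γ) : BddAbove {c : ℝ | ∃ (g : GG.points ℝ) (v : GG.lie),
    proj Γ g = x ∧ v ≠ 0 ∧ (∀ i j, ∃ n : ℤ, (v : Matrix (Fin N) (Fin N) ℝ) i j = n) ∧
      c = (E.norm (Ad g⁻¹ v))⁻¹} := by
  obtain ⟨c, hc, hcE⟩ := exists_le_norm_of_isIntegral E
  obtain ⟨g₀, rfl⟩ := proj_surjective x
  refine ⟨distortion E.ratio g₀ * c⁻¹, ?_⟩
  rintro _ ⟨g, v, hg, hv, hvi, rfl⟩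
  have hγ := (proj_eq_iff _ _).1 hg
  set w := Ad (g₀ * g⁻¹) v with hw
  have hwi : IsIntegral (w : Matrix (Fin N) (Fin N) ℝ) := IsIntegral.Ad hγ hvi
  have hw0 : w ≠ 0 := Ad_ne_zero _ hv
  have h1 := hcE _ hwi (coe_ne_zero hw0)
  have h2 : Ad g₀ (Ad g⁻¹ v) = w := by rw [hw, Ad_mul]
  have h3 := norm_Ad_le E g₀ (Ad g⁻¹ v)
  rw [h2] at h3
  have h4 := E.norm_pos (coe_ne_zero (Ad_ne_zero g⁻¹ hv))
  rw [← div_eq_mul_inv, le_div_iff₀ hc, inv_mul_le_iff₀ h4]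
  linarith

theorem height_nonneg (x : GG.Space Γ) : 0 ≤ height E x := by
  refine Real.sSup_nonneg ?_
  rintro _ ⟨g, v, -, -, -, rfl⟩
  exact inv_nonneg.2 (E.norm_nonneg _)

theorem inv_norm_le_height {g : GG.points ℝ} {v : GG.lie} (hv : v ≠ 0)
    (hvi : IsIntegral (v : Matrix (Fin N) (Fin N) ℝ)) :
    (E.norm (Ad g⁻¹ v))⁻¹ ≤ height E (proj Γ g) :=
  le_csSup (height_bddAbove E _) ⟨g, v, rfl, hv, hvi, rfl⟩

theorem height_act_le (x : GG.Space Γ) (g : GG.points ℝ) :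
    height E (act x g) ≤ distortion E.ratio g * height E x := by
  have hd := one_le_distortion E.ratio g
  refine Real.sSup_le ?_ (mul_nonneg (by linarith) (height_nonneg E x))
  rintro _ ⟨g', v, hg', hv, hvi, rfl⟩
  have hx : proj Γ (g' * g⁻¹) = x := by
    rw [← act_proj, hg', ← act_mul, mul_inv_cancel, act_one]
  have h1 := inv_norm_le_height E (Γ := Γ) (g := g' * g⁻¹) hv hvi
  rw [hx] at h1
  have h2 : Ad (g' * g⁻¹)⁻¹ v = Ad g (Ad g'⁻¹ v) := by rw [mul_inv_rev, inv_inv, Ad_mul]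
  rw [h2] at h1
  have h3 := norm_Ad_le E g (Ad g'⁻¹ v)
  have h4 := E.norm_pos (coe_ne_zero (Ad_ne_zero g'⁻¹ hv))
  have h5 := E.norm_pos (coe_ne_zero (Ad_ne_zero g (Ad_ne_zero g'⁻¹ hv)))
  refine le_trans ?_ (mul_le_mul_of_nonneg_left h1 (by linarith))
  rw [← div_eq_mul_inv, le_div_iff₀ h5, inv_mul_le_iff₀ h4]
  linarith

theorem height_le_act (x : GG.Space Γ) (g : GG.points ℝ) :
    height E x ≤ distortion E.ratio g⁻¹ * height E (act x g) := by
  have := height_act_le E (act x g) g⁻¹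
  rwa [← act_mul, mul_inv_cancel, act_one] at this

/-- The heights at `x exp(a)` and at `x` differ at most by distortion factors in either direction,
and these tend to `1` with `a → 0`. -/
theorem continuous_height : Continuous (height E : GG.Space Γ → ℝ) := by
  refine continuous_of_exp (Module.finBasis ℝ GG.lie) fun x => ?_
  have hc := continuous_exp_comp (lin (Module.finBasis ℝ GG.lie))
  have h1 : Tendsto (fun a => distortion E.ratio (exp (lin (Module.finBasis ℝ GG.lie) a))) (𝓝 0)
      (𝓝 1) := by
    have := ((continuous_distortion E.ratio).comp hc).tendsto 0
    simpa [Function.comp_def, exp_zero, distortion_one] using this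
  have h2 : Tendsto (fun a => distortion E.ratio (exp (lin (Module.finBasis ℝ GG.lie) a))⁻¹) (𝓝 0)
      (𝓝 1) := by
    have := ((continuous_distortion E.ratio).comp (continuous_inv.comp hc)).tendsto 0
    simpa [Function.comp_def, exp_zero, distortion_one] using this
  have h3 : height E (act x (exp (lin (Module.finBasis ℝ GG.lie) 0))) = height E x := by
    rw [map_zero, exp_zero, act_one]
  rw [ContinuousAt, h3]
  refine tendsto_of_tendsto_of_tendsto_of_le_of_le (g := fun a =>
    (distortion E.ratio (exp (lin (Module.finBasis ℝ GG.lie) a))⁻¹)⁻¹ * height E x)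
    (h := fun a => distortion E.ratio (exp (lin (Module.finBasis ℝ GG.lie) a)) * height E x)
    ?_ ?_ (fun a => ?_) (fun a => height_act_le E _ _)
  · simpa using (h2.inv₀ one_ne_zero).mul_const (height E x)
  · simpa using h1.mul_const (height E x)
  · have := one_le_distortion E.ratio (exp (lin (Module.finBasis ℝ GG.lie) a))⁻¹
    change _ * _ ≤ _
    rw [inv_mul_le_iff₀ (by linarith)]
    exact height_le_act E _ _

section Trace

variable (GG)

/-- The functional `M ↦ tr (M Z)`. -/
noncomputable def traceWith (Z : GG.lie) : EndN N →ₗ[ℝ] ℝ where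
  toFun M := ((emb N).symm M * (Z : Matrix (Fin N) (Fin N) ℝ)).trace
  map_add' M M' := by rw [map_add, add_mul, Matrix.trace_add]
  map_smul' c M := by rw [map_smul, smul_mul_assoc, Matrix.trace_smul, RingHom.id_apply]

variable {GG}

theorem traceWith_emb (Z : GG.lie) (X : Matrix (Fin N) (Fin N) ℝ) :
    traceWith GG Z (emb N X) = (X * (Z : Matrix (Fin N) (Fin N) ℝ)).trace := rfl

variable (b : Module.Basis (Fin (Module.finrank ℝ GG.lie)) ℝ GG.lie)

/-- The traces against the elements of a basis. -/
noncomputable def traceMap : EndN N →L[ℝ] Coord GG :=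
  LinearMap.toContinuousLinearMap (LinearMap.pi fun k => traceWith GG (b k))

theorem trace_mul_eq_zero_of_basis {X : Matrix (Fin N) (Fin N) ℝ}
    (h : ∀ k, (X * (b k : Matrix (Fin N) (Fin N) ℝ)).trace = 0) (Y : GG.lie) :
    (X * (Y : Matrix (Fin N) (Fin N) ℝ)).trace = 0 := by
  let T : GG.lie →ₗ[ℝ] ℝ := Matrix.traceLinearMap (Fin N) ℝ ℝ ∘ₗ LinearMap.mulLeft ℝ X ∘ₗ
    GG.lie.toSubmodule.subtype
  have : T = 0 := b.ext fun k => h k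
  exact LinearMap.congr_fun this Y

theorem traceWith_conj (g : GG.points ℝ) (M : EndN N) (Z : GG.lie) :
    traceWith GG (Ad g Z) M = traceWith GG Z (mat g⁻¹ * M * mat g) := by
  have h : ∀ X : Matrix (Fin N) (Fin N) ℝ, traceWith GG (Ad g Z) (emb N X)
      = traceWith GG Z (mat g⁻¹ * emb N X * mat g) := by
    intro X
    have e : mat g⁻¹ * emb N X * mat g = emb N (((g : SL N ℝ)⁻¹).1 * X * (g : SL N ℝ).1) := by
      rw [map_mul, map_mul]
      rfl
    rw [e, traceWith_emb, traceWith_emb]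
    change (X * ((g : SL N ℝ).1 * (Z : Matrix (Fin N) (Fin N) ℝ) * ((g : SL N ℝ)⁻¹).1)).trace = _
    rw [← mul_assoc, Matrix.trace_mul_comm]
    simp only [mul_assoc]
  exact h ((emb N).symm M)

variable (hss : LieAlgebra.IsSemisimple ℝ GG.lie)
include hss

theorem traceMap_linMat_injective : Function.Injective ((traceMap b).comp (linMat b)) := by
  rw [injective_iff_map_eq_zero]
  intro a ha
  refine b.equivFun.symm.map_eq_zero_iff.1 ?_
  refine eq_zero_of_forall_trace hss (trace_mul_eq_zero_of_basis b fun k => ?_)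
  exact congrFun ha k

theorem exists_norm_le_traceMap : ∃ C : ℝ, 0 < C ∧ ∀ v : GG.lie,
    ‖emb N v‖ ≤ C * ‖traceMap b (emb N v)‖ := by
  obtain ⟨K, hK, hanti⟩ := ((traceMap b).comp (linMat b) : Coord GG →ₗ[ℝ] Coord GG)
    |>.exists_antilipschitzWith (LinearMap.ker_eq_bot.2 (traceMap_linMat_injective b hss))
  refine ⟨(‖linMat b‖ + 1) * K, by positivity, fun v => ?_⟩
  have h0 := hanti.le_mul_dist (b.equivFun v) 0
  have hv : linMat b (b.equivFun v) = emb N v := by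
    rw [linMat_apply]
    exact congrArg (fun w : GG.lie => emb N (w : Matrix (Fin N) (Fin N) ℝ))
      (b.equivFun.symm_apply_apply v)
  rw [map_zero, dist_zero_right, dist_zero_right] at h0
  have h1 : ‖b.equivFun v‖ ≤ K * ‖traceMap b (emb N v)‖ := by
    rw [← hv]
    exact h0
  have h2 := (linMat b).le_opNorm (b.equivFun v)
  rw [hv] at h2
  have h3 : (0 : ℝ) < K := hK
  have h4 := norm_nonneg (linMat b)
  have h5 := norm_nonneg (b.equivFun v)
  nlinarith

/-- Near the identity, a point is determined by its traces against the Lie algebra. -/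
theorem exists_eq_one_of_trace : ∃ ρ : ℝ, 0 < ρ ∧ ∀ g : GG.points ℝ, ‖mat g - 1‖ < ρ →
    traceMap b (mat g - 1) = 0 → g = 1 := by
  have hd := (isChart_exp b).deriv
  have h1 : HasStrictFDerivAt (fun a => traceMap b (mat (exp (lin b a))))
      ((traceMap b).comp (linMat b)) 0 := (traceMap b).hasStrictFDerivAt.comp 0 hd
  obtain ⟨r, hr, K, hK, hbi⟩ :=
    exists_bilipschitz_of_hasStrictFDerivAt h1 (traceMap_linMat_injective b hss)
  obtain ⟨ρ, hρ, hsub⟩ := Metric.mem_nhds_iff.1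
    ((isChart_exp b).image_mem_nhds (Metric.ball_mem_nhds 0 hr))
  refine ⟨ρ, hρ, fun g hg ht => ?_⟩
  obtain ⟨a, ha, rfl⟩ := hsub (show g ∈ Metric.ball 1 ρ by rwa [Metric.mem_ball, dist_eq, mat_one])
  have h2 := (hbi a ha 0 (Metric.mem_ball_self hr)).2
  simp only [map_zero, exp_zero, mat_one] at h2
  rw [← map_sub, ht, norm_zero, mul_zero, sub_zero] at h2
  have h3 : a = 0 := norm_le_zero_iff.1 h2
  change exp (lin b a) = 1
  rw [h3, map_zero, exp_zero]

/-- The orbit map at `x` is injective at the scale `1 / (height x + 1)`. -/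
theorem exists_injectivity_radius : ∃ c : ℝ, 0 < c ∧ ∀ (x : GG.Space Γ) (g₁ g₂ : GG.points ℝ),
    ‖mat g₁ - 1‖ ≤ c / (height E x + 1) → ‖mat g₂ - 1‖ ≤ c / (height E x + 1) →
    act x g₁ = act x g₂ → g₁ = g₂ := by
  have b := Module.finBasis ℝ GG.lie
  obtain ⟨D, hD0, hD⟩ := exists_integral_trace (GG := GG) hss
  obtain ⟨ρ, hρ, hone⟩ := exists_eq_one_of_trace b hss
  obtain ⟨C, hC, hCv⟩ := exists_norm_le_traceMap b hss
  have hκ := one_le_ratio E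
  set C' : ℝ := E.ratio * C * |(D : ℝ)| * (‖traceMap b‖ + 1) with hC'
  have hD' : 0 < |(D : ℝ)| := abs_pos.2 (by exact_mod_cast hD0)
  have hC'0 : 0 < C' := by positivity
  set c : ℝ := min (1 / 2) (min (ρ / 8) (1 / (8 * C'))) with hc
  have hc0 : 0 < c := by positivity
  refine ⟨c, hc0, fun x g₁ g₂ h₁ h₂ hact => ?_⟩
  obtain ⟨g, rfl⟩ := proj_surjective x
  have hh := height_nonneg E (proj Γ g)
  set δ := c / (height E (proj Γ g) + 1) with hδ
  have hδ0 : 0 < δ := by positivity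
  have hδc : δ ≤ c := div_le_self hc0.le (by linarith)
  -- the quotient of the two elements
  set γ' := g₂ * g₁⁻¹ with hγ'
  have hc2 : c ≤ 1 / 2 := min_le_left _ _
  have hγn : ‖mat γ' - 1‖ ≤ 4 * δ := by
    have e1 := norm_mat_mul_sub_le g₂ g₁⁻¹
    have e2 := norm_mat_inv_sub_le (h₁.trans (hδc.trans hc2))
    have e3 := norm_nonneg (mat g₂ - 1)
    have e4 := norm_nonneg (mat g₁⁻¹ - 1)
    nlinarith
  have hmem : g * γ' * g⁻¹ ∈ GG.discrete Γ := by
    have h3 := (proj_eq_iff _ _).1 (show proj Γ (g * g₁) = proj Γ (g * g₂) from hact)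
    rw [hγ']
    simpa [mul_assoc] using h3
  obtain ⟨γ₀, hγ₀, hγe⟩ := id hmem
  have hγe' : ((g * γ' * g⁻¹ : GG.points ℝ) : SL N ℝ) = intToReal N γ₀ := hγe.symm
  have hBi : IsIntegral ((intToReal N γ₀).1 - 1) := by
    intro i j
    obtain ⟨n, hn⟩ := isIntegral_intToReal γ₀ i j
    exact ⟨n - if i = j then 1 else 0, by
      rw [Matrix.sub_apply, hn, Matrix.one_apply]
      split_ifs <;> simp⟩
  have hBe : emb N ((intToReal N γ₀).1 - 1) = mat (g * γ' * g⁻¹) - 1 := by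
    rw [map_sub, map_one, mat, hγe']
  -- The matrix `γ - 1` is integral but usually not in `𝔤`. It is replaced by the integral `u` in
  -- `𝔤` that represents `Y ↦ D tr((γ-1)Y)`. Then `Ad(g⁻¹) u` represents `D (γ'-1)` in the same way,
  -- so its norm is `O(‖γ'-1‖)`.
  obtain ⟨u, hui, hu⟩ := hD _ hBi
  have htr : ∀ Z : GG.lie, traceWith GG Z (emb N (Ad g⁻¹ u)) = D * traceWith GG Z (mat γ' - 1) := by
    intro Z
    have h4 := hu (Ad g Z)
    rw [← traceWith_emb, ← traceWith_emb, hBe, traceWith_conj, traceWith_conj] at h4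
    have e1 : mat g⁻¹ * (mat (g * γ' * g⁻¹) - 1) * mat g = mat γ' - 1 := by
      rw [mul_sub, sub_mul, ← mat_mul, ← mat_mul, mul_one, mat_inv_mul_mat]
      congr 2
      group
    rw [e1] at h4
    rw [emb_Ad, inv_inv, h4]
  have hmap : traceMap b (emb N (Ad g⁻¹ u)) = (D : ℝ) • traceMap b (mat γ' - 1) :=
    funext fun k => htr (b k)
  have hγ1 : γ' = 1 := by
    -- If `u = 0`, all traces of `γ' - 1` against `𝔤` vanish, and these are injective near `1`. If
    -- `u ≠ 0`, the height bounds `‖Ad(g⁻¹) u‖` below, contradicting `‖γ'-1‖ ≤ 4δ` by the choice of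
    -- `c`.
    by_cases hu0 : u = 0
    · refine hone γ' (lt_of_le_of_lt hγn ?_) ?_
      · have : c ≤ ρ / 8 := (min_le_right _ _).trans (min_le_left _ _)
        linarith
      · have : Ad g⁻¹ u = 0 := by rw [hu0, ← AdLin_apply, map_zero]
        rw [this, ZeroMemClass.coe_zero, map_zero, map_zero] at hmap
        exact (smul_eq_zero.1 hmap.symm).resolve_left (by exact_mod_cast hD0)
    · exfalso
      have h5 := inv_norm_le_height E (Γ := Γ) (g := g) hu0 hui
      have h6 := E.norm_pos (coe_ne_zero (Ad_ne_zero g⁻¹ hu0))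
      have h7 : E.norm (Ad g⁻¹ u) ≤ C' * ‖mat γ' - 1‖ := by
        refine (norm_le_ratio E _).trans ?_
        have h8 := hCv (Ad g⁻¹ u)
        rw [hmap, norm_smul, Real.norm_eq_abs] at h8
        have h9 := (traceMap b).le_opNorm (mat γ' - 1)
        have h10 : ‖traceMap b (mat γ' - 1)‖ ≤ (‖traceMap b‖ + 1) * ‖mat γ' - 1‖ := by
          linarith [norm_nonneg (mat γ' - 1)]
        calc E.ratio * ‖emb N (Ad g⁻¹ u)‖ 
            ≤ E.ratio * (C * (|(D : ℝ)| * ((‖traceMap b‖ + 1) * ‖mat γ' - 1‖))) := by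
              refine mul_le_mul_of_nonneg_left (h8.trans ?_) (by linarith)
              gcongr
          _ = C' * ‖mat γ' - 1‖ := by rw [hC']; ring
      rw [inv_le_iff_one_le_mul₀ h6] at h5
      have h11 : C' * c ≤ 1 / 8 := by
        have : c ≤ 1 / (8 * C') := (min_le_right _ _).trans (min_le_right _ _)
        rw [le_div_iff₀ (by positivity)] at this
        linarith
      have h12 : δ * (height E (proj Γ g) + 1) = c := div_mul_cancel₀ _ (by positivity)
      have h13 : E.norm (Ad g⁻¹ u) ≤ C' * (4 * δ) :=
        h7.trans (mul_le_mul_of_nonneg_left hγn hC'0.le)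
      have h14 : height E (proj Γ g) * E.norm (Ad g⁻¹ u)
          ≤ (height E (proj Γ g) + 1) * (C' * (4 * δ)) :=
        mul_le_mul (by linarith) h13 (E.norm_nonneg _) (by linarith)
      have h15 : (height E (proj Γ g) + 1) * (C' * (4 * δ)) = 4 * (C' * c) := by
        rw [← h12]; ring
      linarith
  exact (mul_inv_eq_one.1 hγ1).symm

/-- The adjoint action preserves volumes. -/
theorem abs_det_AdLin (g : GG.points ℝ) : |LinearMap.det (AdLin g)| = 1 := by
  let T : GG.lie →ₗ[ℝ] Module.Dual ℝ GG.lie := LinearMap.mk₂ ℝ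
    (fun X Y : GG.lie => ((X : Matrix (Fin N) (Fin N) ℝ) * (Y : Matrix (Fin N) (Fin N) ℝ)).trace)
    (fun X Y Z => by simp [add_mul]) (fun c X Y => by simp)
    (fun X Y Z => by simp [mul_add]) (fun c X Y => by simp)
  have hT : Function.Injective T := by
    rw [injective_iff_map_eq_zero]
    exact fun X hX => eq_zero_of_forall_trace hss fun Y => LinearMap.congr_fun hX Y
  let e : GG.lie ≃ₗ[ℝ] Module.Dual ℝ GG.lie :=
    LinearMap.linearEquivOfInjective T hT Subspace.dual_finrank_eq.symm
  -- The trace form is invariant, so it identifies `Ad g⁻¹` with the transpose of `Ad g`. The two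
  -- have the same determinant, and the product of their determinants is `1`.
  have he : ∀ X, (AdLin g).dualMap (e X) = e (AdLin g⁻¹ X) := by
    intro X
    ext Y
    change traceWith GG (Ad g Y) (emb N X) = traceWith GG Y (emb N (Ad g⁻¹ X))
    rw [traceWith_conj, emb_Ad, inv_inv]
  have h1 : (AdLin g).dualMap = (e : GG.lie →ₗ[ℝ] _) ∘ₗ AdLin g⁻¹ ∘ₗ (e.symm : _ →ₗ[ℝ] GG.lie) := by
    refine LinearMap.ext fun X => ?_
    have := he (e.symm X)
    rw [e.apply_symm_apply] at this
    exact this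
  have h2 := congrArg LinearMap.det h1
  rw [LinearMap.det_dualMap, LinearMap.det_conj] at h2
  have h3 : AdLin g⁻¹ ∘ₗ AdLin g = LinearMap.id := by
    refine LinearMap.ext fun X => ?_
    rw [LinearMap.comp_apply, AdLin_apply, AdLin_apply, ← Ad_mul, inv_mul_cancel, Ad_one,
      LinearMap.id_apply]
  have h4 := congrArg LinearMap.det h3
  rw [LinearMap.det_comp, LinearMap.det_id, ← h2] at h4
  rw [abs_eq zero_le_one]
  exact mul_self_eq_one_iff.1 h4

end Trace

end EffEqui.QGroup

/-! ### Hausdorff measure on the group against the invariant measure. -/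

namespace EffEqui.QGroup

open Filter Topology MeasureTheory
open scoped ENNReal NNReal

variable {N : ℕ} {GG : QGroup N} {Γ : Subgroup (SL N ℤ)}

variable (GG) in
/-- The Hausdorff measure on the group of real points, in the dimension of the group. -/
noncomputable def haus : Measure (GG.points ℝ) := μH[(Module.finrank ℝ GG.lie : ℝ)]

theorem mem_ball_one {g : GG.points ℝ} {δ : ℝ} : g ∈ Metric.ball (1 : GG.points ℝ) δ ↔
    ‖mat g - 1‖ < δ := by
  rw [Metric.mem_ball, dist_eq, mat_one]

/-- The metric is not left invariant, but left multiplication by `u` is Lipschitz with constant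
`‖u‖`. Near `1`, Hausdorff measure is thus invariant up to the factor `2^dim`, enough for it to
serve as a Haar measure. -/
theorem haus_image_mul_le {u : GG.points ℝ} (hu : ‖mat u‖ ≤ 2) (A : Set (GG.points ℝ)) :
    haus GG ((fun g => u * g) '' A) ≤ 2 ^ Module.finrank ℝ GG.lie * haus GG A := by
  have hL : LipschitzOnWith 2 (fun g : GG.points ℝ => u * g) A := by
    refine LipschitzOnWith.of_dist_le_mul fun g _ h _ => ?_
    rw [dist_eq, dist_eq, mat_mul, mat_mul, ← mul_sub]
    exact (norm_mul_le _ _).trans (mul_le_mul_of_nonneg_right hu (norm_nonneg _))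
  have := hL.hausdorffMeasure_image_le (d := (Module.finrank ℝ GG.lie : ℝ)) (by positivity)
  rwa [ENNReal.rpow_natCast] at this

theorem haus_le_preimage {u : GG.points ℝ} (hu : ‖mat u‖ ≤ 2) (A : Set (GG.points ℝ)) :
    haus GG A ≤ 2 ^ Module.finrank ℝ GG.lie * haus GG ((fun g => u * g) ⁻¹' A) := by
  have := haus_image_mul_le hu ((fun g => u * g) ⁻¹' A)
  rwa [Set.image_preimage_eq A (mul_left_surjective u)] at this

theorem haus_preimage_le {u : GG.points ℝ} (hu : ‖mat u⁻¹‖ ≤ 2) (A : Set (GG.points ℝ)) :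
    haus GG ((fun g => u * g) ⁻¹' A) ≤ 2 ^ Module.finrank ℝ GG.lie * haus GG A := by
  have := haus_image_mul_le hu A
  rwa [show (fun g => u⁻¹ * g) '' A = (fun g => u * g) ⁻¹' A from
    congrFun (Set.image_eq_preimage_of_inverse (fun g => by simp) (fun g => by simp)) A] at this

section Charts

variable {b : Module.Basis (Fin (Module.finrank ℝ GG.lie)) ℝ GG.lie} {Φ : Coord GG → GG.points ℝ}

/-- Charts at the identity compare the Lebesgue and Hausdorff measures. -/
theorem IsChart.exists_measure_comparison (hΦ : IsChart b Φ) : ∃ r : ℝ, 0 < r ∧ ∃ K : ℝ≥0, 1 ≤ K ∧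
    (∀ e ∈ Metric.ball (0 : Coord GG) r, dist (Φ e) 1 ≤ K * ‖e‖ ∧ ‖e‖ ≤ K * dist (Φ e) 1) ∧
    ∀ S ⊆ Metric.ball (0 : Coord GG) r,
      haus GG (Φ '' S) ≤ K ^ Module.finrank ℝ GG.lie * volume S ∧
      volume S ≤ K ^ Module.finrank ℝ GG.lie * haus GG (Φ '' S) := by
  obtain ⟨r, hr, K, hK, h⟩ := hΦ.exists_bilipschitz
  set K' : ℝ≥0 := max 1 K.toNNReal with hK'
  have hKK : K ≤ K' := by
    rw [hK', NNReal.coe_max, Real.coe_toNNReal _ hK.le]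
    exact le_max_right _ _
  have hv : (volume : Measure (Coord GG)) = μH[(Module.finrank ℝ GG.lie : ℝ)] := by
    rw [← MeasureTheory.hausdorffMeasure_pi_real, Fintype.card_fin]
  refine ⟨r, hr, K', le_max_left _ _, fun e he => ?_, fun S hS => ⟨?_, ?_⟩⟩
  · have := h e he 0 (Metric.mem_ball_self hr)
    rw [hΦ.map_zero, dist_zero_right] at this
    exact ⟨this.1.trans (by gcongr), this.2.trans (by gcongr)⟩
  · have hL : LipschitzOnWith K' Φ S := LipschitzOnWith.of_dist_le_mul fun x hx y hy =>
      (h x (hS hx) y (hS hy)).1.trans (by gcongr)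
    have := hL.hausdorffMeasure_image_le (d := (Module.finrank ℝ GG.lie : ℝ)) (by positivity)
    rwa [ENNReal.rpow_natCast, ← hv] at this
  · have hinj : Set.InjOn Φ S := by
      intro x hx y hy hxy
      have := (h x (hS hx) y (hS hy)).2
      rw [hxy, dist_self, mul_zero] at this
      exact dist_le_zero.1 this
    have hL : LipschitzOnWith K' (Function.invFunOn Φ S) (Φ '' S) := by
      refine LipschitzOnWith.of_dist_le_mul ?_
      rintro _ ⟨x, hx, rfl⟩ _ ⟨y, hy, rfl⟩
      rw [hinj.leftInvOn_invFunOn hx, hinj.leftInvOn_invFunOn hy]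
      exact (h x (hS hx) y (hS hy)).2.trans (by gcongr)
    have := hL.hausdorffMeasure_image_le (d := (Module.finrank ℝ GG.lie : ℝ)) (by positivity)
    rwa [ENNReal.rpow_natCast, ← hv, hinj.invFunOn_image subset_rfl] at this

theorem volume_ball_coord {r : ℝ} (hr : 0 < r) : volume (Metric.ball (0 : Coord GG) r)
    = ENNReal.ofReal ((2 * r) ^ Module.finrank ℝ GG.lie) := by
  rw [Real.volume_pi_ball _ hr, Fintype.card_fin]

variable (GG) in
/-- The Hausdorff measure of small balls. -/
theorem exists_haus_ball : ∃ δ₀ : ℝ, 0 < δ₀ ∧ ∃ C : ℝ, 0 < C ∧ ∀ δ : ℝ, 0 < δ → δ ≤ δ₀ →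
    haus GG (Metric.ball 1 δ) ≤ ENNReal.ofReal (C * δ ^ Module.finrank ℝ GG.lie) ∧
    ENNReal.ofReal (δ ^ Module.finrank ℝ GG.lie) ≤ ENNReal.ofReal C * haus GG (Metric.ball 1 δ) := by
  have hΦ := isChart_exp (Module.finBasis ℝ GG.lie)
  set Φ := fun a => exp (lin (Module.finBasis ℝ GG.lie) a) with hΦd
  obtain ⟨r, hr, K, hK, hd, hS⟩ := hΦ.exists_measure_comparison
  have hK0 : (0 : ℝ) < K := lt_of_lt_of_le one_pos hK
  have hK1 : (1 : ℝ) ≤ K := hK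
  obtain ⟨ρ, hρ, hsub⟩ := Metric.mem_nhds_iff.1 (hΦ.image_mem_nhds (Metric.ball_mem_nhds 0 hr))
  set n := Module.finrank ℝ GG.lie with hn
  have hKn : ∀ a : ℝ, (K : ℝ≥0∞) ^ n * ENNReal.ofReal a = ENNReal.ofReal (K ^ n * a) := by
    intro a
    rw [ENNReal.ofReal_mul (by positivity), ENNReal.ofReal_pow (by positivity),
      ENNReal.ofReal_coe_nnreal]
  refine ⟨min ρ (r / K / 2), by positivity, (2 * K * K) ^ n, by positivity, fun δ hδ hδ₀ => ⟨?_, ?_⟩⟩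
  · have h1 : Metric.ball (1 : GG.points ℝ) δ
        ⊆ Φ '' (Metric.ball 0 (K * δ) ∩ Metric.ball 0 r) := by
      intro g hg
      obtain ⟨e, he, rfl⟩ := hsub (Metric.ball_subset_ball (hδ₀.trans (min_le_left _ _)) hg)
      refine ⟨e, ⟨?_, he⟩, rfl⟩
      rw [mem_ball_zero_iff]
      refine (hd e he).2.trans_lt ?_
      gcongr
      exact hg
    calc haus GG (Metric.ball 1 δ) ≤ _ := measure_mono h1
      _ ≤ K ^ n * volume (Metric.ball 0 (K * δ) ∩ Metric.ball (0 : Coord GG) r) :=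
          (hS _ Set.inter_subset_right).1
      _ ≤ K ^ n * volume (Metric.ball (0 : Coord GG) (K * δ)) := by
          gcongr
          exact Set.inter_subset_left
      _ = _ := by
          rw [volume_ball_coord (by positivity), hKn]
          congr 1
          ring
  · have hδr : δ / K < r := by
      have : δ ≤ r / K / 2 := hδ₀.trans (min_le_right _ _)
      have h2 : r / K ≤ r := div_le_self hr.le hK1
      have h3 : δ / K ≤ δ := div_le_self hδ.le hK1
      linarith
    have hb : Metric.ball (0 : Coord GG) (δ / K) ⊆ Metric.ball 0 r :=
      Metric.ball_subset_ball hδr.le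
    have h1 : Φ '' Metric.ball 0 (δ / K) ⊆ Metric.ball 1 δ := by
      rintro _ ⟨e, he, rfl⟩
      rw [Metric.mem_ball]
      refine (hd e (hb he)).1.trans_lt ?_
      rw [mem_ball_zero_iff, lt_div_iff₀ hK0] at he
      linarith
    have h2 := ((hS _ hb).2).trans (mul_le_mul_right (measure_mono h1) _)
    rw [volume_ball_coord (by positivity)] at h2
    have h3 : ENNReal.ofReal (δ ^ n) ≤ (K : ℝ≥0∞) ^ n * ENNReal.ofReal ((2 * (δ / K)) ^ n) := by
      rw [hKn]
      refine ENNReal.ofReal_le_ofReal ?_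
      rw [← mul_pow]
      gcongr
      rw [mul_left_comm, mul_div_cancel₀ _ hK0.ne']
      linarith
    refine h3.trans ((mul_le_mul_right h2 _).trans ?_)
    rw [← mul_assoc, ENNReal.ofReal_pow (by positivity), ← mul_pow]
    gcongr
    rw [← ENNReal.ofReal_coe_nnreal, ← ENNReal.ofReal_mul (by positivity)]
    refine ENNReal.ofReal_le_ofReal ?_
    nlinarith

end Charts

section Fubini

theorem IsInvariantMeasure.isLocallyFinite {m : Measure (GG.Space Γ)} (hm : IsInvariantMeasure m) :
    IsLocallyFiniteMeasure m where
  finiteAtNhds x := by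
    refine ⟨(fun g => act x g) '' Metric.closedBall 1 1, ?_, hm.finite_on_compacts _
      ((isCompact_closedBall 1 1).image (continuous_act_right x))⟩
    have h1 := (isOpenMap_act_right x) _ (Metric.isOpen_ball (x := (1 : GG.points ℝ)) (ε := 1))
    refine mem_of_superset (h1.mem_nhds ⟨1, Metric.mem_ball_self one_pos, act_one x⟩)
      (Set.image_mono Metric.ball_subset_closedBall)

theorem IsInvariantMeasure.sigmaFinite {m : Measure (GG.Space Γ)} (hm : IsInvariantMeasure m) :
    SigmaFinite m := by
  have := hm.isLocallyFinite
  infer_instance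

theorem IsInvariantMeasure.lintegral_act {m : Measure (GG.Space Γ)} (hm : IsInvariantMeasure m)
    (g : GG.points ℝ) {h : GG.Space Γ → ℝ≥0∞} (hh : Measurable h) :
    ∫⁻ x, h (act x g) ∂m = ∫⁻ x, h x ∂m := by
  conv_rhs => rw [← hm.invariant g]
  rw [lintegral_map hh (continuous_act_left g).measurable]

theorem IsInvariantMeasure.measure_image {m : Measure (GG.Space Γ)} (hm : IsInvariantMeasure m)
    (g : GG.points ℝ) (S : Set (GG.Space Γ)) : m ((fun x => act x g) '' S) = m S := by
  have h1 : (fun x => act x g) '' S = (actHomeo g⁻¹).toMeasurableEquiv ⁻¹' S := by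
    refine congrFun (Set.image_eq_preimage_of_inverse (fun x => ?_) (fun x => ?_)) S
    · exact (actHomeo g).left_inv x
    · exact (actHomeo g).right_inv x
  rw [h1, ← MeasurableEquiv.map_apply]
  congr 1
  exact hm.invariant g⁻¹

theorem measurable_act : Measurable fun p : GG.Space Γ × GG.points ℝ => act p.1 p.2 :=
  continuous_act_prod.measurable

theorem IsInvariantMeasure.lintegral_lintegral_act {m : Measure (GG.Space Γ)}
    (hm : IsInvariantMeasure m) (ν : Measure (GG.points ℝ)) [IsFiniteMeasure ν]
    {h : GG.Space Γ → ℝ≥0∞} (hh : Measurable h) :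
    ∫⁻ y, ∫⁻ g, h (act y g) ∂ν ∂m = ν Set.univ * ∫⁻ x, h x ∂m := by
  have := hm.sigmaFinite
  rw [lintegral_lintegral_swap (f := fun y g => h (act y g)) (hh.comp measurable_act).aemeasurable]
  simp only [hm.lintegral_act _ hh]
  rw [lintegral_const, mul_comm]

/-- Double counting: integrating `h(yg)` over `y` and over `g ∈ V` gives `haus(V) ∫ h dm` by Tonelli
and invariance, and Chebyshev's inequality restricts this to `Y`. Bounds for Hausdorff averages
become bounds for `m`. -/
theorem IsInvariantMeasure.mul_measure_le {m : Measure (GG.Space Γ)}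
    (hm : IsInvariantMeasure m) {V : Set (GG.points ℝ)} (hV : haus GG V ≠ ⊤)
    {h : GG.Space Γ → ℝ≥0∞} (hh : Measurable h) {c : ℝ≥0∞} {Y : Set (GG.Space Γ)}
    (hc : ∀ y ∈ Y, c ≤ ∫⁻ g in V, h (act y g) ∂haus GG) :
    c * m Y ≤ haus GG V * ∫⁻ x, h x ∂m := by
  have := isFiniteMeasure_restrict.2 hV
  have h1 := hm.lintegral_lintegral_act ((haus GG).restrict V) hh
  rw [Measure.restrict_apply_univ] at h1
  rw [← h1]
  refine le_trans ?_ (mul_meas_ge_le_lintegral (Measurable.lintegral_prod_right'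
    (ν := (haus GG).restrict V) (hh.comp measurable_act)) c)
  gcongr
  exact hc

/-- The same double counting in the opposite direction: only points of `Y` contribute, and each
contributes at most `c`. -/
theorem IsInvariantMeasure.le_mul_measure {m : Measure (GG.Space Γ)}
    (hm : IsInvariantMeasure m) {V : Set (GG.points ℝ)} (hV : haus GG V ≠ ⊤)
    {h : GG.Space Γ → ℝ≥0∞} (hh : Measurable h) {c : ℝ≥0∞} {Y : Set (GG.Space Γ)}
    (hY : ∀ y ∉ Y, ∫⁻ g in V, h (act y g) ∂haus GG = 0)
    (hc : ∀ y ∈ Y, ∫⁻ g in V, h (act y g) ∂haus GG ≤ c) :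
    haus GG V * ∫⁻ x, h x ∂m ≤ c * m Y := by
  have := isFiniteMeasure_restrict.2 hV
  have h1 := hm.lintegral_lintegral_act ((haus GG).restrict V) hh
  rw [Measure.restrict_apply_univ] at h1
  rw [← h1]
  refine le_trans (lintegral_mono fun y => ?_) (lintegral_indicator_const_le Y c)
  by_cases hy : y ∈ Y
  · rw [Set.indicator_of_mem hy]
    exact hc y hy
  · rw [Set.indicator_of_notMem hy]
    exact (hY y hy).le

theorem setLIntegral_haus_indicator {V : Set (GG.points ℝ)}
    {M : Set (GG.Space Γ)} (hM : MeasurableSet M) (y : GG.Space Γ) :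
    ∫⁻ g in V, M.indicator (fun _ => (1 : ℝ≥0∞)) (act y g) ∂haus GG
      = haus GG ({g | act y g ∈ M} ∩ V) := by
  have h1 : MeasurableSet {g : GG.points ℝ | act y g ∈ M} :=
    (continuous_act_right y).measurable hM
  rw [← Measure.restrict_apply h1, ← lintegral_indicator_one h1]
  rfl

/-- Near some point, the measure dominates the Hausdorff measure. -/
theorem IsInvariantMeasure.exists_base_point {m : Measure (GG.Space Γ)}
    (hm : IsInvariantMeasure m) : ∃ x₀ : GG.Space Γ, ∃ c : ℝ≥0∞, c ≠ 0 ∧ ∃ δ : ℝ, 0 < δ ∧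
      ∀ A ⊆ Metric.ball (1 : GG.points ℝ) δ, c * haus GG A ≤ m ((fun g => act x₀ g) '' A) := by
  obtain ⟨δ₀, hδ₀, C, hC, hball⟩ := exists_haus_ball GG
  set δ : ℝ := min (1 / 8) (δ₀ / 8) with hδ
  have hδ0 : 0 < δ := by positivity
  have hδ8 : δ ≤ 1 / 8 := min_le_left _ _
  -- Otherwise every point would have a null neighbourhood, and `m` would vanish on a second
  -- countable space.
  obtain ⟨x₀, hx₀⟩ : ∃ x₀ : GG.Space Γ, m ((fun g => act x₀ g) '' Metric.ball 1 δ) ≠ 0 := by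
    by_contra! hcon
    refine hm.ne_zero (Measure.measure_univ_eq_zero.1
      (measure_null_of_locally_null _ fun x _ => ⟨_, mem_nhdsWithin_of_mem_nhds ?_, hcon x⟩))
    exact ((isOpenMap_act_right x) _ Metric.isOpen_ball).mem_nhds
      ⟨1, Metric.mem_ball_self hδ0, act_one x⟩
  set V := Metric.ball (1 : GG.points ℝ) (8 * δ) with hVd
  have hVb := hball (8 * δ) (by positivity) (by have := min_le_right (1 / 8) (δ₀ / 8); linarith)
  have hVt : haus GG V ≠ ⊤ := (hVb.1.trans_lt ENNReal.ofReal_lt_top).ne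
  set q : ℝ≥0∞ := 2 ^ Module.finrank ℝ GG.lie with hq
  have hq0 : q ≠ 0 := by simp [hq]
  have hqt : q ≠ ⊤ := by simp [hq]
  refine ⟨x₀, m ((fun g => act x₀ g) '' Metric.ball 1 δ) / (q * haus GG V),
    ENNReal.div_ne_zero.2 ⟨hx₀, ENNReal.mul_ne_top hqt hVt⟩, δ, hδ0, fun A hA => ?_⟩
  set S := (fun g => act x₀ g) '' A with hS
  have hM := measurableSet_toMeasurable m S
  -- The test function is the indicator of the measurable hull of `x₀A`, as `A` is arbitrary. For `y
  -- = x₀u` with `u` small, the `g ∈ V` with `yg` in it include `u⁻¹A`, of Hausdorff measure at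
  -- least `q⁻¹ haus(A)`.
  have key := hm.mul_measure_le hVt (c := q⁻¹ * haus GG A)
    (Y := (fun g => act x₀ g) '' Metric.ball 1 δ)
    (h := (toMeasurable m S).indicator fun _ => 1) (measurable_const.indicator hM) ?_
  · rw [lintegral_indicator_const hM, one_mul, measure_toMeasurable] at key
    rw [mul_comm, ← mul_div_assoc]
    refine ENNReal.div_le_of_le_mul ?_
    calc haus GG A * m ((fun g => act x₀ g) '' Metric.ball 1 δ)
        = q * (q⁻¹ * haus GG A * m ((fun g => act x₀ g) '' Metric.ball 1 δ)) := by
          rw [← mul_assoc, ← mul_assoc, ENNReal.mul_inv_cancel hq0 hqt, one_mul]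
      _ ≤ q * (haus GG V * m S) := by gcongr
      _ = m S * (q * haus GG V) := by ring
  · rintro _ ⟨u, hu, rfl⟩
    rw [mem_ball_one] at hu
    rw [setLIntegral_haus_indicator hM,
      ENNReal.inv_mul_le_iff hq0 hqt]
    refine (haus_le_preimage (norm_mat_le (g := u) (by linarith)) A).trans ?_
    gcongr
    intro g hg
    have hgA := hA hg
    rw [mem_ball_one] at hgA
    change ‖mat (u * g) - 1‖ < δ at hgA
    refine ⟨subset_toMeasurable m S ⟨u * g, hg, act_mul _ _ _⟩, ?_⟩
    rw [mem_ball_one]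
    have e : g = u⁻¹ * (u * g) := by group
    have h1 := norm_mat_mul_sub_le u⁻¹ (u * g)
    have h2 := norm_mat_inv_sub_le (g := u) (by linarith)
    rw [← e] at h1
    nlinarith [norm_nonneg (mat u⁻¹ - 1), norm_nonneg (mat (u * g) - 1)]

end Fubini

end EffEqui.QGroup

/-! ### Lower bounds for the invariant measure of orbit balls. -/

namespace EffEqui.QGroup

open Filter Topology MeasureTheory
open scoped ENNReal NNReal

variable {N : ℕ} {GG : QGroup N} {Γ : Subgroup (SL N ℤ)}

/-- The adjoint action in coordinates. -/
noncomputable def AdCoord (b : Module.Basis (Fin (Module.finrank ℝ GG.lie)) ℝ GG.lie)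
    (g : GG.points ℝ) : Coord GG →ₗ[ℝ] Coord GG :=
  (b.equivFun : GG.lie →ₗ[ℝ] Coord GG) ∘ₗ AdLin g ∘ₗ (b.equivFun.symm : Coord GG →ₗ[ℝ] GG.lie)

theorem lin_AdCoord (b : Module.Basis (Fin (Module.finrank ℝ GG.lie)) ℝ GG.lie)
    (g : GG.points ℝ) (a : Coord GG) : lin b (AdCoord b g a) = Ad g (lin b a) :=
  b.equivFun.symm_apply_apply _

theorem volume_image_AdCoord (hss : LieAlgebra.IsSemisimple ℝ GG.lie)
    (b : Module.Basis (Fin (Module.finrank ℝ GG.lie)) ℝ GG.lie)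
    (g : GG.points ℝ) (S : Set (Coord GG)) : volume (AdCoord b g '' S) = volume S := by
  have h : LinearMap.det (AdCoord b g) = LinearMap.det (AdLin g) :=
    LinearMap.det_conj (AdLin g) b.equivFun
  rw [Measure.addHaar_image_linearMap, h, abs_det_AdLin hss, ENNReal.ofReal_one, one_mul]

/-- With `x = x₀w`, translation by `w⁻¹` turns a tiny exponential box at `x` into the image of that
box under `Ad w` at `x₀`. As `Ad w` preserves volume, the constant from the base point survives for
all `x`; only the admissible radius depends on `x`. -/
theorem IsInvariantMeasure.exists_small_ball {m : Measure (GG.Space Γ)}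
    (hm : IsInvariantMeasure m) (hss : LieAlgebra.IsSemisimple ℝ GG.lie) :
    ∃ c : ℝ≥0∞, c ≠ 0 ∧ ∀ x : GG.Space Γ, ∃ ε₀ : ℝ, 0 < ε₀ ∧ ∀ ε : ℝ, 0 < ε → ε ≤ ε₀ →
      c * haus GG (Metric.ball 1 ε) ≤ m ((fun g => act x g) '' Metric.ball 1 ε) := by
  obtain ⟨x₀, c₀, hc₀, δ, hδ, hbase⟩ := hm.exists_base_point
  obtain ⟨δ₀, hδ₀, C, hC, hball⟩ := exists_haus_ball GG
  obtain ⟨b⟩ : Nonempty (Module.Basis (Fin (Module.finrank ℝ GG.lie)) ℝ GG.lie) :=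
    ⟨Module.finBasis ℝ GG.lie⟩
  obtain ⟨r, hr, K, hK, hd, hS⟩ := (isChart_exp b).exists_measure_comparison
  have hK0 : (0 : ℝ) < K := lt_of_lt_of_le one_pos hK
  have hK1 : (1 : ℝ) ≤ K := hK
  obtain ⟨g₀, rfl⟩ := proj_surjective x₀
  set q : ℝ≥0∞ := K ^ Module.finrank ℝ GG.lie * ENNReal.ofReal (C * K ^ Module.finrank ℝ GG.lie) with hq
  have hq0 : q ≠ 0 := by
    have : (K : ℝ≥0∞) ≠ 0 := by
      rw [Ne, ENNReal.coe_eq_zero]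
      exact (lt_of_lt_of_le one_pos hK).ne'
    refine mul_ne_zero (pow_ne_zero _ this) ?_
    rw [Ne, ENNReal.ofReal_eq_zero, not_le]
    positivity
  have hqt : q ≠ ⊤ := ENNReal.mul_ne_top (ENNReal.pow_ne_top ENNReal.coe_ne_top)
    ENNReal.ofReal_ne_top
  refine ⟨c₀ / q, ENNReal.div_ne_zero.2 ⟨hc₀, hqt⟩, fun x => ?_⟩
  obtain ⟨g, hg⟩ := proj_surjective (Γ := Γ) x
  -- conjugate by the element moving the base point to `x`
  set w := g₀⁻¹ * g with hw
  have hx : act (proj Γ g₀) w = x := by rw [act_proj, ← hg, hw, mul_inv_cancel_left]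
  set L : Coord GG →L[ℝ] Coord GG := (AdCoord b w).toContinuousLinearMap with hL
  set ε₀ : ℝ := min δ₀ (min r (min r (δ / (2 * K)) / (‖L‖ + 1))) with hε₀
  refine ⟨ε₀, by positivity, fun ε hε hεε => ?_⟩
  have hε1 : ε ≤ δ₀ := hεε.trans (min_le_left _ _)
  have hε2 : ε ≤ r := hεε.trans ((min_le_right _ _).trans (min_le_left _ _))
  have hε3 : (‖L‖ + 1) * ε ≤ min r (δ / (2 * K)) := by
    have : ε ≤ min r (δ / (2 * K)) / (‖L‖ + 1) :=
      hεε.trans ((min_le_right _ _).trans (min_le_right _ _))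
    rw [le_div_iff₀ (by positivity)] at this
    linarith
  have hεK : ε / K ≤ ε := div_le_self hε.le hK1
  set S := AdCoord b w '' Metric.ball 0 (ε / K) with hSd
  have hSn : ∀ e ∈ S, ‖e‖ < min r (δ / (2 * K)) := by
    rintro _ ⟨a, ha, rfl⟩
    rw [mem_ball_zero_iff] at ha
    have h1 : ‖AdCoord b w a‖ ≤ ‖L‖ * ‖a‖ := L.le_opNorm a
    nlinarith [norm_nonneg L, norm_nonneg a]
  have hSr : S ⊆ Metric.ball 0 r := fun e he => by
    rw [mem_ball_zero_iff]
    exact (hSn e he).trans_le (min_le_left _ _)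
  set A := (fun a => exp (lin b a)) '' S with hA
  have hAδ : A ⊆ Metric.ball 1 δ := by
    rintro _ ⟨e, he, rfl⟩
    rw [Metric.mem_ball]
    refine (hd e (hSr he)).1.trans_lt ?_
    have := (hSn e he).le.trans (min_le_right _ _)
    rw [le_div_iff₀ (by positivity)] at this
    nlinarith
  have hsub : (fun g => act (proj Γ g₀) g) '' A ⊆
      (fun y => act y w⁻¹) '' ((fun g => act x g) '' Metric.ball 1 ε) := by
    rintro _ ⟨_, ⟨_, ⟨a, ha, rfl⟩, rfl⟩, rfl⟩
    refine ⟨_, ⟨exp (lin b a), ?_, rfl⟩, ?_⟩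
    · rw [Metric.mem_ball]
      rw [mem_ball_zero_iff] at ha
      have har : a ∈ Metric.ball (0 : Coord GG) r := by
        rw [mem_ball_zero_iff]
        linarith
      refine (hd a har).1.trans_lt ?_
      rw [lt_div_iff₀ hK0] at ha
      linarith
    · change act (act x _) w⁻¹ = act (proj Γ g₀) (exp (lin b (AdCoord b w a)))
      rw [← hx, ← act_mul, ← act_mul, lin_AdCoord, exp_Ad, ← mul_assoc]
  have h1 := hbase A hAδ
  have h2 : m ((fun g => act (proj Γ g₀) g) '' A) ≤ m ((fun g => act x g) '' Metric.ball 1 ε) :=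
    (measure_mono hsub).trans (hm.measure_image _ _).le
  have h3 := (hS S hSr).2
  rw [hSd, volume_image_AdCoord hss, volume_ball_coord (by positivity)] at h3
  have h4 := (hball ε hε hε1).1
  have h5 : haus GG (Metric.ball 1 ε) ≤ q * haus GG A := by
    refine h4.trans ?_
    have e1 : ENNReal.ofReal (C * ε ^ Module.finrank ℝ GG.lie)
        ≤ ENNReal.ofReal (C * K ^ Module.finrank ℝ GG.lie) * ENNReal.ofReal ((2 * (ε / K)) ^ Module.finrank ℝ GG.lie) := by
      rw [← ENNReal.ofReal_mul (by positivity), mul_assoc, ← mul_pow]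
      refine ENNReal.ofReal_le_ofReal ?_
      gcongr
      rw [mul_left_comm, mul_div_cancel₀ _ hK0.ne']
      linarith
    refine e1.trans ((mul_le_mul_right h3 _).trans ?_)
    rw [hq, ← mul_assoc, mul_comm (ENNReal.ofReal _)]
  refine le_trans ?_ (h1.trans h2)
  rw [mul_comm, ← mul_div_assoc]
  refine ENNReal.div_le_of_le_mul ?_
  rw [mul_comm (haus GG _), mul_assoc]
  refine mul_le_mul_right (h5.trans ?_) _
  rw [mul_comm]

variable (E : EuclideanNorm N)

/-- Double counting against the indicator of a tiny `xB_ε` makes the radius uniform. By injectivity,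
a point `xu` of the larger ball reaches `xB_ε` only through `u⁻¹B_ε`. Hence `haus(B_δ) m(xB_ε) ≤ q
haus(B_ε) m(xB_{4δ})`. Inserting `m(xB_ε) ≥ c haus(B_ε)`, the tiny radius cancels. -/
theorem IsInvariantMeasure.exists_ball {m : Measure (GG.Space Γ)}
    (hm : IsInvariantMeasure m) (hss : LieAlgebra.IsSemisimple ℝ GG.lie) :
    ∃ c : ℝ≥0∞, c ≠ 0 ∧ ∃ c₁ : ℝ, 0 < c₁ ∧ ∀ (x : GG.Space Γ) (δ : ℝ), 0 < δ →
      δ ≤ c₁ / (height E x + 1) →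
      c * haus GG (Metric.ball 1 δ) ≤ m ((fun g => act x g) '' Metric.ball 1 (4 * δ)) := by
  obtain ⟨c, hc, hsmall⟩ := hm.exists_small_ball hss
  obtain ⟨c₀, hc₀, hinj⟩ := exists_injectivity_radius E hss (Γ := Γ)
  obtain ⟨δ₀, hδ₀, C, hC, hball⟩ := exists_haus_ball GG
  set q : ℝ≥0∞ := 2 ^ Module.finrank ℝ GG.lie with hq
  have hq0 : q ≠ 0 := by simp [hq]
  have hqt : q ≠ ⊤ := by simp [hq]
  set c₁ : ℝ := min (1 / 8) (min δ₀ (c₀ / 8)) with hc₁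
  refine ⟨c / q, ENNReal.div_ne_zero.2 ⟨hc, hqt⟩, c₁, by positivity, fun x δ hδ hδx => ?_⟩
  have hh := height_nonneg E x
  have hδ1 : δ ≤ c₁ := hδx.trans (div_le_self (by positivity) (by linarith))
  have hδ8 : δ ≤ 1 / 8 := hδ1.trans (min_le_left _ _)
  have hδ₀' : δ ≤ δ₀ := hδ1.trans ((min_le_right _ _).trans (min_le_left _ _))
  have hδc : 8 * δ ≤ c₀ / (height E x + 1) := by
    have : c₁ / (height E x + 1) ≤ (c₀ / 8) / (height E x + 1) := by
      gcongr
      exact (min_le_right _ _).trans (min_le_right _ _)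
    have e : (c₀ / 8) / (height E x + 1) = c₀ / (height E x + 1) / 8 := by ring
    rw [e] at this
    linarith
  obtain ⟨ε₀, hε₀, hε⟩ := hsmall x
  set ε := min ε₀ δ with hεd
  have hε0 : 0 < ε := by positivity
  have hεδ : ε ≤ δ := min_le_right _ _
  have h1 := hε ε hε0 (min_le_left _ _)
  set V := Metric.ball (1 : GG.points ℝ) δ with hV
  have hVt : haus GG V ≠ ⊤ := ((hball δ hδ hδ₀').1.trans_lt ENNReal.ofReal_lt_top).ne
  have hεt : haus GG (Metric.ball (1 : GG.points ℝ) ε) ≠ ⊤ :=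
    ((hball ε hε0 (hεδ.trans hδ₀')).1.trans_lt ENNReal.ofReal_lt_top).ne
  have hε00 : haus GG (Metric.ball (1 : GG.points ℝ) ε) ≠ 0 := by
    intro h0
    have := (hball ε hε0 (hεδ.trans hδ₀')).2
    rw [h0, mul_zero, nonpos_iff_eq_zero, ENNReal.ofReal_eq_zero, ← not_lt] at this
    exact this (by positivity)
  set S := (fun g => act x g) '' Metric.ball 1 ε with hS
  have hSm : MeasurableSet S := ((isOpenMap_act_right x) _ Metric.isOpen_ball).measurableSet
  have hquot : ∀ a ∈ Metric.ball (1 : GG.points ℝ) ε, ∀ g ∈ V, a * g⁻¹ ∈ Metric.ball 1 (4 * δ) := by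
    intro a ha g hg
    rw [mem_ball_one] at ha hg ⊢
    have e1 := norm_mat_mul_sub_le a g⁻¹
    have e2 := norm_mat_inv_sub_le (g := g) (by linarith)
    nlinarith [norm_nonneg (mat a - 1), norm_nonneg (mat g⁻¹ - 1)]
  have key := hm.le_mul_measure hVt (c := q * haus GG (Metric.ball 1 ε))
    (Y := (fun g => act x g) '' Metric.ball 1 (4 * δ))
    (h := S.indicator fun _ => 1) (measurable_const.indicator hSm) ?_ ?_
  · rw [lintegral_indicator_const hSm, one_mul] at key
    have h2 := (mul_le_mul_right h1 (haus GG V)).trans key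
    rw [mul_comm, ← mul_div_assoc]
    refine ENNReal.div_le_of_le_mul ?_
    have h3 : haus GG (Metric.ball 1 ε) * (haus GG V * c) ≤ haus GG (Metric.ball 1 ε) *
        (m ((fun g => act x g) '' Metric.ball 1 (4 * δ)) * q) := by
      calc _ = haus GG V * (c * haus GG (Metric.ball 1 ε)) := by ring
        _ ≤ _ := h2
        _ = _ := by ring
    exact (ENNReal.mul_le_mul_iff_right hε00 hεt).1 h3
  · intro y hy
    rw [setLIntegral_haus_indicator hSm]
    refine measure_mono_null (?_ : _ ⊆ (∅ : Set (GG.points ℝ))) measure_empty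
    rintro g ⟨⟨a, ha, hag⟩, hg⟩
    refine hy ⟨a * g⁻¹, hquot a ha g hg, ?_⟩
    change act x a = act y g at hag
    change act x (a * g⁻¹) = y
    rw [act_mul, hag, ← act_mul, mul_inv_cancel, act_one]
  · rintro _ ⟨u, hu, rfl⟩
    rw [setLIntegral_haus_indicator hSm]
    rw [mem_ball_one] at hu
    refine le_trans (measure_mono ?_) (haus_preimage_le
      (norm_mat_inv_le (g := u) (by linarith)) (Metric.ball 1 ε))
    rintro g ⟨⟨a, ha, hag⟩, hg⟩
    change act x a = act (act x u) g at hag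
    rw [← act_mul] at hag
    rw [hV, mem_ball_one] at hg
    have ha' := ha
    rw [mem_ball_one] at ha'
    have e1 := norm_mat_mul_sub_le u g
    have := hinj x a (u * g) (by linarith)
      (by nlinarith [norm_nonneg (mat u - 1), norm_nonneg (mat g - 1)]) hag
    change u * g ∈ Metric.ball 1 ε
    rwa [← this]

end EffEqui.QGroup

/-! ### Averages over orbit balls and boxes, bounded by integrals. -/

namespace EffEqui.QGroup

open Filter Topology MeasureTheory
open scoped ENNReal NNReal

variable {N : ℕ} {GG : QGroup N} {Γ : Subgroup (SL N ℤ)} (E : EuclideanNorm N)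

theorem measurable_haus_indicator_ball {h : GG.Space Γ → ℝ≥0∞} (hh : Measurable h)
    (x : GG.Space Γ) : Measurable fun g : GG.points ℝ => h (act x g) :=
  hh.comp (continuous_act_right x).measurable

theorem setLIntegral_haus_mul_le {u : GG.points ℝ} (hu : ‖mat u‖ ≤ 2) {V W : Set (GG.points ℝ)}
    (hVW : ∀ g ∈ V, u⁻¹ * g ∈ W) {k : GG.points ℝ → ℝ≥0∞} (hk : Measurable k) :
    ∫⁻ g in V, k g ∂haus GG ≤
      2 ^ Module.finrank ℝ GG.lie * ∫⁻ g in W, k (u * g) ∂haus GG := by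
  have hmeas : Measurable fun g : GG.points ℝ => u * g := (continuous_const_mul u).measurable
  have hle : (haus GG).restrict V ≤ (2 ^ Module.finrank ℝ GG.lie : ℝ≥0∞) •
      ((haus GG).restrict W).map (fun g => u * g) := by
    refine Measure.le_iff.2 fun A hA => ?_
    rw [Measure.restrict_apply hA, Measure.smul_apply, Measure.map_apply hmeas hA,
      Measure.restrict_apply (hmeas hA), smul_eq_mul]
    refine (haus_le_preimage hu (A ∩ V)).trans ?_
    gcongr
    rintro g ⟨hgA, hgV⟩
    exact ⟨hgA, by simpa using hVW _ hgV⟩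
  refine (lintegral_mono' hle le_rfl).trans ?_
  rw [lintegral_smul_measure, lintegral_map hk hmeas, smul_eq_mul]

/-- Averages over small balls are bounded by the integral, uniformly at the scale of the
injectivity radius. -/
theorem IsInvariantMeasure.exists_lintegral_ball_le {m : Measure (GG.Space Γ)}
    (hm : IsInvariantMeasure m) (hss : LieAlgebra.IsSemisimple ℝ GG.lie) :
    ∃ C : ℝ≥0∞, C ≠ ⊤ ∧ ∃ c : ℝ, 0 < c ∧ ∀ (x : GG.Space Γ) (δ : ℝ), 0 < δ →
      δ ≤ c / (height E x + 1) → ∀ h : GG.Space Γ → ℝ≥0∞, Measurable h →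
      ∫⁻ g in Metric.ball 1 δ, h (act x g) ∂haus GG ≤ C * ∫⁻ y, h y ∂m := by
  obtain ⟨c', hc', c₁, hc₁, hlow'⟩ := hm.exists_ball E hss
  obtain ⟨c, hc, hct, hcc⟩ : ∃ c : ℝ≥0∞, c ≠ 0 ∧ c ≠ ⊤ ∧ c ≤ c' :=
    ⟨min c' 1, by simp [hc'], by simp, min_le_left _ _⟩
  obtain ⟨δ₀, hδ₀, C, hC, hball⟩ := exists_haus_ball GG
  set q : ℝ≥0∞ := 2 ^ Module.finrank ℝ GG.lie with hq
  have hq0 : q ≠ 0 := by simp [hq]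
  have hqt : q ≠ ⊤ := by simp [hq]
  set M : ℝ≥0∞ := ENNReal.ofReal (C * 16 ^ Module.finrank ℝ GG.lie) * ENNReal.ofReal C with hM
  refine ⟨q * M / c, ENNReal.div_ne_top (ENNReal.mul_ne_top hqt
    (ENNReal.mul_ne_top ENNReal.ofReal_ne_top ENNReal.ofReal_ne_top)) hc,
    min c₁ (min (1 / 32) (δ₀ / 16)), by positivity, fun x δ hδ hδx h hh => ?_⟩
  have hhx := height_nonneg E x
  have hδ1 : δ ≤ min c₁ (min (1 / 32) (δ₀ / 16)) :=
    hδx.trans (div_le_self (by positivity) (by linarith))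
  have hδ32 : δ ≤ 1 / 32 := hδ1.trans ((min_le_right _ _).trans (min_le_left _ _))
  have hδ16 : δ ≤ δ₀ / 16 := hδ1.trans ((min_le_right _ _).trans (min_le_right _ _))
  have hδc : δ ≤ c₁ / (height E x + 1) := by
    refine hδx.trans ?_
    gcongr
    exact min_le_left _ _
  have h1 := (mul_le_mul_left hcc _).trans (hlow' x δ hδ hδc)
  have hV := hball (16 * δ) (by positivity) (by linarith)
  have hVt : haus GG (Metric.ball (1 : GG.points ℝ) (16 * δ)) ≠ ⊤ :=
    (hV.1.trans_lt ENNReal.ofReal_lt_top).ne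
  have hB := hball δ hδ (by linarith)
  have hBt : haus GG (Metric.ball (1 : GG.points ℝ) δ) ≠ ⊤ :=
    (hB.1.trans_lt ENNReal.ofReal_lt_top).ne
  have hB0 : haus GG (Metric.ball (1 : GG.points ℝ) δ) ≠ 0 := by
    intro h0
    have := hB.2
    rw [h0, mul_zero, nonpos_iff_eq_zero, ENNReal.ofReal_eq_zero, ← not_lt] at this
    exact this (by positivity)
  set I := ∫⁻ g in Metric.ball 1 δ, h (act x g) ∂haus GG with hI
  -- Every point of `xB_{4δ}` sees all of `xB_δ` through `B_{16δ}`, so the integral of `h` from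
  -- there is at least `q⁻¹ I`. The claim follows since `m(xB_{4δ}) ≥ c haus(B_δ)` and
  -- `haus(B_{16δ}) ≤ M haus(B_δ)`.
  have key := hm.mul_measure_le hVt (c := q⁻¹ * I)
    (Y := (fun g => act x g) '' Metric.ball 1 (4 * δ)) hh ?_
  · have h2 : haus GG (Metric.ball (1 : GG.points ℝ) (16 * δ))
        ≤ M * haus GG (Metric.ball (1 : GG.points ℝ) δ) := by
      refine hV.1.trans ?_
      rw [mul_pow, ← mul_assoc, ENNReal.ofReal_mul (by positivity), hM, mul_assoc]
      exact mul_le_mul_right hB.2 _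
    have h3 : haus GG (Metric.ball (1 : GG.points ℝ) δ) * (q⁻¹ * I * c)
        ≤ haus GG (Metric.ball (1 : GG.points ℝ) δ) * (M * ∫⁻ y, h y ∂m) := by
      calc _ = q⁻¹ * I * (c * haus GG (Metric.ball (1 : GG.points ℝ) δ)) := by ring
        _ ≤ _ := mul_le_mul_right h1 _
        _ ≤ _ := key
        _ ≤ _ := mul_le_mul_left h2 _
        _ = _ := by ring
    have h4 := (ENNReal.mul_le_mul_iff_right hB0 hBt).1 h3
    rw [mul_assoc, ENNReal.inv_mul_le_iff hq0 hqt] at h4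
    rw [← ENNReal.mul_div_right_comm, ENNReal.le_div_iff_mul_le (Or.inl hc) (Or.inl hct), mul_assoc q]
    exact h4
  · rintro _ ⟨u, hu, rfl⟩
    rw [mem_ball_one] at hu
    rw [ENNReal.inv_mul_le_iff hq0 hqt]
    have := setLIntegral_haus_mul_le (GG := GG) (norm_mat_le (g := u) (by linarith))
      (V := Metric.ball 1 δ)
      (W := Metric.ball 1 (16 * δ)) (fun g hg => ?_)
      (measurable_haus_indicator_ball hh x)
    · simpa only [act_mul] using this
    · rw [mem_ball_one] at hg ⊢
      have e1 := norm_mat_mul_sub_le u⁻¹ g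
      have e2 := norm_mat_inv_sub_le (g := u) (by linarith)
      nlinarith [norm_nonneg (mat u⁻¹ - 1), norm_nonneg (mat g - 1)]

/-- The boxes in the coordinates of the second kind. -/
theorem IsInvariantMeasure.exists_lintegral_box_le {m : Measure (GG.Space Γ)}
    (hm : IsInvariantMeasure m) (hss : LieAlgebra.IsSemisimple ℝ GG.lie)
    {b : Module.Basis (Fin (Module.finrank ℝ GG.lie)) ℝ GG.lie} {Φ : Coord GG → GG.points ℝ}
    (hΦ : IsChart b Φ) (hΦc : Continuous Φ) :
    ∃ C : ℝ≥0∞, C ≠ ⊤ ∧ ∃ c : ℝ, 0 < c ∧ ∀ (x : GG.Space Γ) (δ : ℝ), 0 < δ →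
      δ ≤ c / (height E x + 1) → ∀ h : GG.Space Γ → ℝ≥0∞, Measurable h →
      ∫⁻ a in Metric.closedBall 0 δ, h (act x (Φ a)) ≤ C * ∫⁻ y, h y ∂m := by
  obtain ⟨C, hC, c, hc, hI⟩ := hm.exists_lintegral_ball_le E hss
  obtain ⟨r, hr, K, hK, hd, hS⟩ := hΦ.exists_measure_comparison
  have hK0 : (0 : ℝ) < K := lt_of_lt_of_le one_pos hK
  refine ⟨K ^ Module.finrank ℝ GG.lie * C, ENNReal.mul_ne_top (ENNReal.pow_ne_top
    ENNReal.coe_ne_top) hC, min (c / (2 * K)) (r / 2), by positivity, fun x δ hδ hδx h hh => ?_⟩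
  have hhx := height_nonneg E x
  have hδr : δ < r := by
    have h1 : δ ≤ min (c / (2 * K)) (r / 2) := hδx.trans (div_le_self (by positivity) (by linarith))
    have := h1.trans (min_le_right _ _)
    linarith
  have hδc : 2 * K * δ ≤ c / (height E x + 1) := by
    have h1 : δ ≤ c / (2 * K) / (height E x + 1) := by
      refine hδx.trans ?_
      gcongr
      exact min_le_left _ _
    rw [div_right_comm, le_div_iff₀ (by positivity)] at h1
    linarith
  have hsub : Metric.closedBall (0 : Coord GG) δ ⊆ Metric.ball 0 r :=
    Metric.closedBall_subset_ball hδr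
  -- A bi-Lipschitz chart pushes Lebesgue measure to something dominated by Hausdorff measure on a
  -- ball of comparable radius.
  have hle : (volume.restrict (Metric.closedBall (0 : Coord GG) δ)).map Φ ≤
      (K ^ Module.finrank ℝ GG.lie : ℝ≥0∞) •
        (haus GG).restrict (Metric.ball 1 (2 * K * δ)) := by
    refine Measure.le_iff.2 fun A hA => ?_
    rw [Measure.map_apply hΦc.measurable hA, Measure.restrict_apply (hΦc.measurable hA),
      Measure.smul_apply, Measure.restrict_apply hA, smul_eq_mul]
    refine (hS _ (Set.inter_subset_right.trans hsub)).2.trans ?_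
    gcongr
    rintro _ ⟨a, ⟨haA, ha⟩, rfl⟩
    refine ⟨haA, ?_⟩
    rw [Metric.mem_ball]
    refine (hd a (hsub ha)).1.trans_lt ?_
    rw [mem_closedBall_zero_iff] at ha
    nlinarith
  have hk := measurable_haus_indicator_ball hh x
  rw [← lintegral_map (f := fun g => h (act x g)) hk hΦc.measurable]
  refine (lintegral_mono' hle le_rfl).trans ?_
  rw [lintegral_smul_measure, smul_eq_mul, mul_assoc (_ ^ _)]
  exact mul_le_mul_right (hI x _ (by positivity) hδc h hh) _

end EffEqui.QGroup

/-! ### Values bounded by box averages of derivatives. -/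

namespace EffEqui.QGroup

open scoped ContDiff ENNReal NNReal
open Filter Topology MeasureTheory

variable {N : ℕ} {GG : QGroup N} {Γ : Subgroup (SL N ℤ)}

/-- The value of a function at the endpoint of an interval is bounded by the averages of the
function and of its derivative. -/
theorem ofReal_mul_enorm_le_lintegral {g g' : ℝ → ℝ} (hg : ∀ t, HasDerivAt g (g' t) t)
    (hg' : Continuous g') {δ : ℝ} (hδ : 0 ≤ δ) (hδ1 : δ ≤ 1) :
    ENNReal.ofReal δ * ‖g 0‖ₑ ≤ ∫⁻ t in Set.Icc 0 δ, (‖g t‖ₑ + ‖g' t‖ₑ) := by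
  have hgc : Continuous g := continuous_iff_continuousAt.2 fun t => (hg t).continuousAt
  set J := ∫ s in (0 : ℝ)..δ, |g' s| with hJ
  have hJ0 : 0 ≤ J := intervalIntegral.integral_nonneg hδ fun _ _ => abs_nonneg _
  have h1 : ∀ t ∈ Set.Icc 0 δ, |g 0| ≤ |g t| + J := by
    intro t ht
    have h2 : ∫ s in (0 : ℝ)..t, g' s = g t - g 0 :=
      intervalIntegral.integral_eq_sub_of_hasDerivAt (fun s _ => hg s)
        (hg'.intervalIntegrable _ _)
    have h3 : |∫ s in (0 : ℝ)..t, g' s| ≤ ∫ s in (0 : ℝ)..t, |g' s| :=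
      intervalIntegral.abs_integral_le_integral_abs ht.1
    have h4 : ∫ s in (0 : ℝ)..t, |g' s| ≤ J :=
      intervalIntegral.integral_mono_interval le_rfl ht.1 ht.2
        (Eventually.of_forall fun _ => abs_nonneg _) (hg'.abs.intervalIntegrable _ _)
    rw [h2] at h3
    have h5 := abs_sub_abs_le_abs_sub (g 0) (g t)
    rw [abs_sub_comm] at h5
    linarith
  have h2 : δ * |g 0| ≤ (∫ t in (0 : ℝ)..δ, |g t|) + δ * J := by
    have h3 : ∫ t in (0 : ℝ)..δ, |g 0| ≤ ∫ t in (0 : ℝ)..δ, (|g t| + J) :=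
      intervalIntegral.integral_mono_on hδ (by simp)
        ((hgc.abs.add continuous_const).intervalIntegrable _ _) h1
    rw [intervalIntegral.integral_const, intervalIntegral.integral_add
      (hgc.abs.intervalIntegrable _ _) (by simp), intervalIntegral.integral_const] at h3
    simpa using h3
  have h3 : δ * |g 0| ≤ ∫ t in (0 : ℝ)..δ, (|g t| + |g' t|) := by
    rw [intervalIntegral.integral_add (hgc.abs.intervalIntegrable _ _)
      (hg'.abs.intervalIntegrable _ _)]
    nlinarith
  have h4 : Integrable (fun t => |g t| + |g' t|) (volume.restrict (Set.Icc 0 δ)) :=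
    (hgc.abs.add hg'.abs).continuousOn.integrableOn_compact isCompact_Icc
  rw [intervalIntegral.integral_of_le hδ, ← integral_Icc_eq_integral_Ioc] at h3
  have h5 := ENNReal.ofReal_le_ofReal h3
  rw [ofReal_integral_eq_lintegral_ofReal h4 (Eventually.of_forall fun t => by positivity),
    ENNReal.ofReal_mul hδ, ← Real.enorm_eq_ofReal_abs] at h5
  refine h5.trans (lintegral_mono fun t => ?_)
  rw [ENNReal.ofReal_add (abs_nonneg _) (abs_nonneg _), ← Real.enorm_eq_ofReal_abs,
    ← Real.enorm_eq_ofReal_abs]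

variable (b : Module.Basis (Fin (Module.finrank ℝ GG.lie)) ℝ GG.lie)

/-- The derivative along a word, the first letter being applied first. -/
noncomputable def wordDeriv (u : List (Fin (Module.finrank ℝ GG.lie))) (f : GG.Space Γ → ℝ) :
    GG.Space Γ → ℝ :=
  u.foldl (fun F i => lieDeriv (b i) F) f

theorem IsTestFunction.wordDeriv {f : GG.Space Γ → ℝ} (hf : IsTestFunction f)
    (u : List (Fin (Module.finrank ℝ GG.lie))) : IsTestFunction (wordDeriv b u f) := by
  induction u generalizing f with
  | nil => exact hf
  | cons i u ih => exact ih (hf.lieDeriv (b i))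

theorem monomialDeriv_eq {k : ℕ} (w : Fin k → Fin (Module.finrank ℝ GG.lie))
    (f : GG.Space Γ → ℝ) : monomialDeriv b w f = wordDeriv b (List.ofFn w).reverse f := by
  rw [monomialDeriv, wordDeriv, List.foldl_reverse]

theorem wordDeriv_eq_monomialDeriv (u : List (Fin (Module.finrank ℝ GG.lie)))
    (f : GG.Space Γ → ℝ) : wordDeriv b u f = monomialDeriv b u.reverse.get f := by
  rw [monomialDeriv_eq, List.ofFn_get, List.reverse_reverse]

theorem continuous_prodExp (l : List (Fin (Module.finrank ℝ GG.lie))) :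
    Continuous (prodExp b l) := by
  induction l with
  | nil => exact continuous_const
  | cons i l ih => exact ((continuous_exp_smul (b i)).comp (continuous_apply i)).mul ih

/-- The sum of the absolute values of the derivatives of `f` along the sublists of a word. -/
noncomputable def derivSum (l : List (Fin (Module.finrank ℝ GG.lie))) (f : GG.Space Γ → ℝ)
    (y : GG.Space Γ) : ℝ≥0∞ :=
  (l.sublists'.map fun u => ‖wordDeriv b u f y‖ₑ).sum

theorem derivSum_nil (f : GG.Space Γ → ℝ) (y : GG.Space Γ) : derivSum b [] f y = ‖f y‖ₑ := by
  simp [derivSum, wordDeriv]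

/-- Sublists of `i :: l` either skip `i` or begin with it. The recursion thus mirrors the two terms,
function and derivative, that one integration produces. -/
theorem derivSum_cons (i : Fin (Module.finrank ℝ GG.lie))
    (l : List (Fin (Module.finrank ℝ GG.lie))) (f : GG.Space Γ → ℝ) (y : GG.Space Γ) :
    derivSum b (i :: l) f y = derivSum b l f y + derivSum b l (lieDeriv (b i) f) y := by
  simp [derivSum, wordDeriv, List.sublists'_cons, Function.comp_def]

variable {b} in
theorem IsTestFunction.continuous_derivSum {f : GG.Space Γ → ℝ} (hf : IsTestFunction f)
    (l : List (Fin (Module.finrank ℝ GG.lie))) : Continuous (derivSum b l f) := by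
  unfold derivSum
  refine continuous_list_sum _ fun u _ => ?_
  exact (hf.wordDeriv b u).continuous.enorm

/-- The value at a point is bounded by the averages of derivatives over a box in the coordinates of
the second kind. -/
theorem IsTestFunction.enorm_le_lmarginal {f : GG.Space Γ → ℝ} (hf : IsTestFunction f) {δ : ℝ}
    (hδ : 0 ≤ δ) (hδ1 : δ ≤ 1) (l : List (Fin (Module.finrank ℝ GG.lie))) (hl : l.Nodup)
    (x : GG.Space Γ) (a₀ : Coord GG) :
    ENNReal.ofReal δ ^ l.length * ‖f x‖ₑ ≤ (lmarginal (fun _ => volume.restrict (Set.Icc 0 δ))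
      l.toFinset (fun a => derivSum b l f (act x (prodExp b l a)))) a₀ := by
  induction l generalizing f x a₀ with
  | nil => simp [derivSum_nil, prodExp]
  | cons i l ih =>
    rw [List.nodup_cons] at hl
    have hi : i ∉ l.toFinset := by simpa using hl.1
    have hm : ∀ {F : GG.Space Γ → ℝ}, IsTestFunction F → ∀ (y : GG.Space Γ) (l' : List _),
        Measurable fun a : Coord GG => derivSum b l F (act y (prodExp b l' a)) := fun hF y l' =>
      ((hF.continuous_derivSum l).comp ((continuous_act_right y).comp
        (continuous_prodExp b l'))).measurable
    have hm' : Measurable fun a : Coord GG =>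
        derivSum b (i :: l) f (act x (prodExp b (i :: l) a)) :=
      ((hf.continuous_derivSum (i :: l)).comp ((continuous_act_right x).comp
        (continuous_prodExp b (i :: l)))).measurable
    rw [List.toFinset_cons, lmarginal_insert _ hm' hi, List.length_cons, pow_succ, mul_assoc]
    -- One integration along `exp(t bᵢ)`, then induction at the point `x exp(t bᵢ)` for both `f` and
    -- its derivative along `bᵢ`. In coordinates of the second kind each variable moves along the
    -- one-parameter group of a basis vector, so each basis vector is differentiated at most once.
    have h1 := ofReal_mul_enorm_le_lintegral (hf.hasDerivAt x (b i))
      ((hf.lieDeriv (b i)).continuous.comp ((continuous_act_right x).comp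
        (continuous_exp_smul (b i)))) hδ hδ1
    rw [zero_smul, exp_zero, act_one] at h1
    refine (mul_le_mul_right h1 _).trans ?_
    rw [← lintegral_const_mul' _ _ (ENNReal.pow_ne_top ENNReal.ofReal_ne_top)]
    refine lintegral_mono fun t => ?_
    rw [mul_add]
    refine (add_le_add (ih hf hl.2 _ (Function.update a₀ i t))
      (ih (hf.lieDeriv (b i)) hl.2 _ (Function.update a₀ i t))).trans ?_
    rw [lmarginal, lmarginal, lmarginal, ← lintegral_add_left]
    · refine lintegral_mono fun y => le_of_eq ?_
      rw [derivSum_cons, prodExp, act_mul]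
      have : Function.updateFinset (Function.update a₀ i t) l.toFinset y i = t := by
        rw [Function.updateFinset, dif_neg hi, Function.update_self]
      rw [this]
    · exact (hm hf _ l).comp measurable_updateFinset

theorem IsTestFunction.enorm_le_lintegral {f : GG.Space Γ → ℝ} (hf : IsTestFunction f) {δ : ℝ}
    (hδ : 0 ≤ δ) (hδ1 : δ ≤ 1) (x : GG.Space Γ) :
    ENNReal.ofReal δ ^ Module.finrank ℝ GG.lie * ‖f x‖ₑ ≤ ∫⁻ a in Metric.closedBall 0 δ,
      derivSum b (List.finRange _) f (act x (prodExp b (List.finRange _) a)) := by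
  have h := hf.enorm_le_lmarginal b hδ hδ1 (List.finRange _) (List.nodup_finRange _) x 0
  rw [List.length_finRange, List.toFinset_finRange, lmarginal_univ,
    ← Measure.restrict_pi_pi] at h
  refine h.trans (lintegral_mono_set ?_)
  intro a ha
  rw [mem_closedBall_zero_iff, pi_norm_le_iff_of_nonneg hδ]
  intro i
  have := ha i (Set.mem_univ i)
  rw [Real.norm_of_nonneg this.1]
  exact this.2

end EffEqui.QGroup

/-! ### The Sobolev inequality. -/

namespace EffEqui.QGroup

open scoped ContDiff ENNReal NNReal
open Filter Topology MeasureTheory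

variable {N : ℕ} {GG : QGroup N} {Γ : Subgroup (SL N ℤ)} (E : EuclideanNorm N)
  (b : Module.Basis (Fin (Module.finrank ℝ GG.lie)) ℝ GG.lie)

theorem IsInvariantMeasure.integrable {m : Measure (GG.Space Γ)} (hm : IsInvariantMeasure m)
    {F : GG.Space Γ → ℝ} (hF : Continuous F) (hFc : HasCompactSupport F) : Integrable F m := by
  have h1 : IntegrableOn F (tsupport F) m := by
    obtain ⟨C, hC⟩ := hFc.isCompact.exists_bound_of_continuousOn hF.continuousOn
    refine Measure.integrableOn_of_bounded (hm.finite_on_compacts _ hFc.isCompact).ne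
      hF.aestronglyMeasurable (M := C) ?_
    exact (ae_restrict_iff' (isClosed_tsupport F).measurableSet).2 (Eventually.of_forall hC)
  exact (integrableOn_iff_integrable_of_support_subset (subset_tsupport F)).1 h1

theorem IsInvariantMeasure.integrable_sq {m : Measure (GG.Space Γ)} (hm : IsInvariantMeasure m)
    (d : ℕ) {F : GG.Space Γ → ℝ} (hF : IsTestFunction F) :
    Integrable (fun x => ((height E x + 1) ^ d * F x) ^ 2) m := by
  refine hm.integrable ?_ ?_
  · exact ((((continuous_height E).add continuous_const).pow d).mul hF.continuous).pow 2
  · refine hF.hasCompactSupport.mono fun x hx => ?_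
    contrapose! hx
    simp only [Function.mem_support, not_not] at hx ⊢
    simp [hx]

theorem sobolev_nonneg (m : Measure (GG.Space Γ)) (d : ℕ) (f : GG.Space Γ → ℝ) :
    0 ≤ sobolev E b m d f := Real.sqrt_nonneg _

theorem sq_sobolev (m : Measure (GG.Space Γ)) (d : ℕ) (f : GG.Space Γ → ℝ) :
    sobolev E b m d f ^ 2 = ∑ k ∈ Finset.range (d + 1),
      ∑ w : Fin k → Fin (Module.finrank ℝ GG.lie),
        ∫ x, ((height E x + 1) ^ d * monomialDeriv b w f x) ^ 2 ∂m :=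
  Real.sq_sqrt (Finset.sum_nonneg fun _ _ => Finset.sum_nonneg fun _ _ =>
    integral_nonneg fun _ => sq_nonneg _)

theorem integral_wordDeriv_le (m : Measure (GG.Space Γ)) {d : ℕ} (f : GG.Space Γ → ℝ)
    {u : List (Fin (Module.finrank ℝ GG.lie))} (hu : u.length ≤ d) :
    ∫ x, ((height E x + 1) ^ d * wordDeriv b u f x) ^ 2 ∂m ≤ sobolev E b m d f ^ 2 := by
  rw [sq_sobolev, wordDeriv_eq_monomialDeriv]
  have hnn : ∀ (k : ℕ) (w : Fin k → Fin (Module.finrank ℝ GG.lie)),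
      0 ≤ ∫ x, ((height E x + 1) ^ d * monomialDeriv b w f x) ^ 2 ∂m :=
    fun k w => integral_nonneg fun _ => sq_nonneg _
  have hk : u.reverse.length ∈ Finset.range (d + 1) := by
    rw [List.length_reverse, Finset.mem_range]
    omega
  refine le_trans ?_ (Finset.single_le_sum (f := fun k =>
    ∑ w : Fin k → Fin (Module.finrank ℝ GG.lie),
      ∫ x, ((height E x + 1) ^ d * monomialDeriv b w f x) ^ 2 ∂m)
    (fun k _ => Finset.sum_nonneg fun w _ => hnn k w) hk)
  exact Finset.single_le_sum (f := fun w : Fin u.reverse.length → _ =>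
    ∫ x, ((height E x + 1) ^ d * monomialDeriv b w f x) ^ 2 ∂m)
    (fun w _ => hnn _ w) (Finset.mem_univ u.reverse.get)

theorem lintegral_wordDeriv_le {m : Measure (GG.Space Γ)} (hm : IsInvariantMeasure m) {d : ℕ}
    {f : GG.Space Γ → ℝ} (hf : IsTestFunction f)
    {u : List (Fin (Module.finrank ℝ GG.lie))} (hu : u.length ≤ d) :
    ∫⁻ x, ENNReal.ofReal (((height E x + 1) ^ d * wordDeriv b u f x) ^ 2) ∂m
      ≤ ENNReal.ofReal (sobolev E b m d f ^ 2) := by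
  rw [← ofReal_integral_eq_lintegral_ofReal (hm.integrable_sq E d (hf.wordDeriv b u))
    (Eventually.of_forall fun _ => sq_nonneg _)]
  exact ENNReal.ofReal_le_ofReal (integral_wordDeriv_le E b m f hu)

/-- Heights are comparable at bounded distance. -/
theorem exists_height_le {S : Set (GG.points ℝ)} (hS : IsCompact S) : ∃ κ : ℝ, 1 ≤ κ ∧
    ∀ (x : GG.Space Γ), ∀ g ∈ S, height E x + 1 ≤ κ * (height E (act x g) + 1) ∧
      height E (act x g) + 1 ≤ κ * (height E x + 1) := by
  obtain ⟨C₁, h₁⟩ := hS.exists_bound_of_continuousOn (continuous_distortion E.ratio).continuousOn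
  obtain ⟨C₂, h₂⟩ := hS.exists_bound_of_continuousOn
    ((continuous_distortion E.ratio).comp continuous_inv).continuousOn
  refine ⟨max 1 (max C₁ C₂), le_max_left _ _, fun x g hg => ?_⟩
  have e1 := (le_abs_self _).trans ((h₁ g hg).trans ((le_max_left C₁ C₂).trans (le_max_right 1 _)))
  have e2 := (le_abs_self _).trans ((h₂ g hg).trans ((le_max_right C₁ C₂).trans (le_max_right 1 _)))
  have e3 : 1 ≤ max 1 (max C₁ C₂) := le_max_left _ _
  have e4 := height_nonneg E x
  have e5 := height_nonneg E (act x g)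
  have e6 := height_act_le E x g
  have e7 := height_le_act E x g
  change distortion E.ratio g⁻¹ ≤ _ at e2
  constructor <;> nlinarith

theorem lintegral_list_sum_le {α ι : Type*} [MeasurableSpace α] {ν : Measure α} (L : List ι)
    {k : ι → α → ℝ≥0∞} (hk : ∀ i ∈ L, Measurable (k i)) {Q : ℝ≥0∞}
    (hQ : ∀ i ∈ L, ∫⁻ a, k i a ∂ν ≤ Q) :
    ∫⁻ a, (L.map fun i => k i a).sum ∂ν ≤ L.length * Q := by
  induction L with
  | nil => simp
  | cons i L ih =>
    simp only [List.map_cons, List.sum_cons, List.length_cons]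
    rw [lintegral_add_left (hk i (List.mem_cons_self ..)), Nat.cast_succ, add_mul, one_mul,
      add_comm]
    exact add_le_add (ih (fun j hj => hk j (List.mem_cons_of_mem _ hj))
      fun j hj => hQ j (List.mem_cons_of_mem _ hj)) (hQ i (List.mem_cons_self ..))

/-- The Sobolev inequality: the Sobolev norm controls the supremum. -/
theorem IsInvariantMeasure.exists_abs_le_sobolev {m : Measure (GG.Space Γ)}
    (hm : IsInvariantMeasure m) (hss : LieAlgebra.IsSemisimple ℝ GG.lie) {d : ℕ}
    (hd : Module.finrank ℝ GG.lie ≤ d) : ∃ C : ℝ, 0 < C ∧ ∀ f : GG.Space Γ → ℝ,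
      IsTestFunction f → ∀ x, |f x| ≤ C * sobolev E b m d f := by
  set Ψ := prodExp b (List.finRange (Module.finrank ℝ GG.lie)) with hΨ
  obtain ⟨C₀, hC₀, c₀, hc₀, hbox⟩ := hm.exists_lintegral_box_le E hss (isChart_prodExp b)
    (continuous_prodExp b _)
  obtain ⟨κ, hκ, hheight⟩ := exists_height_le E (Γ := Γ)
    ((isCompact_closedBall (0 : Coord GG) 1).image (continuous_prodExp b (List.finRange _)))
  -- The box will have radius `δ = c / (height x + 1)`. This is admissible for the box estimate and
  -- at most `1`, so that heights on the box are comparable with that of `x`.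
  set c := min c₀ 1 with hc
  have hc0 : 0 < c := by positivity
  set B : ℝ := 2 ^ Module.finrank ℝ GG.lie * (κ ^ (2 * d) * C₀.toReal * (c ^ Module.finrank ℝ GG.lie)⁻¹ + 2 ^ Module.finrank ℝ GG.lie) with hB
  refine ⟨B, by positivity, fun f hf x => ?_⟩
  have hx := height_nonneg E x
  set H := height E x + 1 with hH
  have hH1 : 1 ≤ H := by linarith
  set δ := c / H with hδ
  have hδ0 : 0 < δ := by positivity
  have hδc : δ ≤ c := div_le_self hc0.le hH1
  have hδ1 : δ ≤ 1 := hδc.trans (min_le_right _ _)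
  have hδ2 : δ ≤ c₀ / H := by
    rw [hδ]
    gcongr
    exact min_le_left _ _
  set S := sobolev E b m d f with hS
  have hS0 : 0 ≤ S := sobolev_nonneg E b m d f
  -- A number `s > S` replaces the Sobolev norm, which might vanish and is going to be a divisor; `s
  -- → S` at the end.
  have hmain : ∀ s, S < s → |f x| ≤ B * s := by
    intro s hs
    have hs0 : 0 < s := hS0.trans_lt hs
    set α : ℝ := κ ^ (2 * d) / (H ^ (2 * d) * s) with hα
    have hα0 : 0 ≤ α := by positivity
    have hpt : ∀ (F : GG.Space Γ → ℝ), ∀ a ∈ Metric.closedBall (0 : Coord GG) δ,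
        ‖F (act x (Ψ a))‖ₑ ≤ ENNReal.ofReal α * ENNReal.ofReal
          (((height E (act x (Ψ a)) + 1) ^ d * F (act x (Ψ a))) ^ 2) + ENNReal.ofReal s := by
      intro F a ha
      have h1 := (hheight x (Ψ a) ⟨a, Metric.closedBall_subset_closedBall hδ1 ha, rfl⟩).1
      set y := act x (Ψ a) with hy
      have hy0 := height_nonneg E y
      rw [Real.enorm_eq_ofReal_abs, ← ENNReal.ofReal_mul hα0,
        ← ENNReal.ofReal_add (by positivity) hs0.le]
      refine ENNReal.ofReal_le_ofReal ?_
      have h2 : F y ^ 2 / s ≤ α * ((height E y + 1) ^ d * F y) ^ 2 := by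
        rw [hα, mul_pow, ← pow_mul, mul_comm d 2, div_mul_eq_mul_div,
          div_le_div_iff₀ hs0 (by positivity)]
        have h3 : H ^ (2 * d) ≤ (κ * (height E y + 1)) ^ (2 * d) := by gcongr
        rw [mul_pow] at h3
        have h4 := mul_le_mul_of_nonneg_right h3 (mul_nonneg (sq_nonneg (F y)) hs0.le)
        linarith
      -- This elementary inequality takes the place of Cauchy–Schwarz: it passes from the `L¹`
      -- averages on the box to the `L²` integrals of the Sobolev norm.
      have h5 : |F y| ≤ F y ^ 2 / s + s := by
        rw [div_add' _ _ _ hs0.ne', le_div_iff₀ hs0, ← sq_abs]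
        nlinarith [sq_nonneg (|F y| - s), abs_nonneg (F y)]
      linarith
    set Q : ℝ≥0∞ := ENNReal.ofReal α * (C₀ * ENNReal.ofReal (S ^ 2)) +
      ENNReal.ofReal s * ENNReal.ofReal ((2 * δ) ^ Module.finrank ℝ GG.lie) with hQ
    have hu : ∀ u ∈ (List.finRange (Module.finrank ℝ GG.lie)).sublists', ∫⁻ a in Metric.closedBall (0 : Coord GG) δ,
        ‖wordDeriv b u f (act x (Ψ a))‖ₑ ≤ Q := by
      intro u hu
      have hlen : u.length ≤ d := by
        have := (List.mem_sublists'.1 hu).length_le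
        rw [List.length_finRange] at this
        exact this.trans hd
      have hmeas : Measurable fun y => ENNReal.ofReal
          (((height E y + 1) ^ d * wordDeriv b u f y) ^ 2) :=
        (((((continuous_height E).add continuous_const).pow d).mul
          (hf.wordDeriv b u).continuous).pow 2).measurable.ennreal_ofReal
      refine (setLIntegral_mono' Metric.isClosed_closedBall.measurableSet
        (hpt (wordDeriv b u f))).trans ?_
      rw [lintegral_add_right _ measurable_const, lintegral_const_mul' _ _ ENNReal.ofReal_ne_top,
        setLIntegral_const, Real.volume_pi_closedBall _ hδ0.le, Fintype.card_fin]
      refine add_le_add (mul_le_mul_right ?_ _) le_rfl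
      exact (hbox x δ hδ0 hδ2 _ hmeas).trans
        (mul_le_mul_right (lintegral_wordDeriv_le E b hm hf hlen) _)
    have h1 := (hf.enorm_le_lintegral b hδ0.le hδ1 x).trans (lintegral_list_sum_le
      (List.finRange (Module.finrank ℝ GG.lie)).sublists' (fun u _ => ((hf.wordDeriv b u).continuous.comp
        ((continuous_act_right x).comp (continuous_prodExp b _))).enorm.measurable) hu)
    rw [List.length_sublists', List.length_finRange, hQ, ← ENNReal.ofReal_toReal hC₀,
      ← ENNReal.ofReal_mul (by positivity), ← ENNReal.ofReal_mul hα0,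
      ← ENNReal.ofReal_mul hs0.le, ← ENNReal.ofReal_add (by positivity) (by positivity),
      ← ENNReal.ofReal_natCast, ← ENNReal.ofReal_mul (by positivity), Real.enorm_eq_ofReal_abs,
      ← ENNReal.ofReal_pow hδ0.le, ← ENNReal.ofReal_mul (by positivity),
      ENNReal.ofReal_le_ofReal_iff (by positivity)] at h1
    push_cast at h1
    have h2 : α * (C₀.toReal * S ^ 2) ≤ s * (κ ^ (2 * d) * C₀.toReal * (δ ^ Module.finrank ℝ GG.lie * (c ^ Module.finrank ℝ GG.lie)⁻¹)) := by
      -- Here the weight pays for the small box: with `dim ≤ d`, `H^(-2d)` is at most `H^(-dim) =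
      -- (δ/c)^dim`, which cancels the volume factor on the left.
      have h3 : (H ^ (2 * d))⁻¹ ≤ δ ^ Module.finrank ℝ GG.lie * (c ^ Module.finrank ℝ GG.lie)⁻¹ := by
        rw [hδ, div_pow, div_mul_eq_mul_div, mul_inv_cancel₀ (by positivity), one_div]
        exact inv_anti₀ (by positivity) (pow_le_pow_right₀ hH1 (by omega))
      have h4 : S ^ 2 / s ≤ s := by
        rw [div_le_iff₀ hs0]
        nlinarith
      calc α * (C₀.toReal * S ^ 2)
          = κ ^ (2 * d) * C₀.toReal * ((H ^ (2 * d))⁻¹ * (S ^ 2 / s)) := by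
            rw [hα]
            field_simp
        _ ≤ κ ^ (2 * d) * C₀.toReal * (δ ^ Module.finrank ℝ GG.lie * (c ^ Module.finrank ℝ GG.lie)⁻¹ * s) := by gcongr
        _ = _ := by ring
    have h5 : δ ^ Module.finrank ℝ GG.lie * |f x| ≤ δ ^ Module.finrank ℝ GG.lie * (B * s) := by
      refine h1.trans ?_
      rw [hB, mul_pow]
      have : (2 : ℝ) ^ Module.finrank ℝ GG.lie * (α * (C₀.toReal * S ^ 2)) ≤ 2 ^ Module.finrank ℝ GG.lie *
          (s * (κ ^ (2 * d) * C₀.toReal * (δ ^ Module.finrank ℝ GG.lie * (c ^ Module.finrank ℝ GG.lie)⁻¹))) := by gcongr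
      linarith
    exact le_of_mul_le_mul_left h5 (by positivity)
  have hB0 : 0 < B := by positivity
  refine le_of_forall_pos_le_add fun η hη => ?_
  have := hmain (S + η / B) (by linarith [div_pos hη hB0])
  rwa [mul_add, mul_div_cancel₀ _ hB0.ne'] at this

end EffEqui.QGroup

/-! ### Translations and Lipschitz bounds for the Sobolev norm. -/

namespace EffEqui.QGroup

open scoped ContDiff ENNReal NNReal
open Filter Topology MeasureTheory

variable {N : ℕ} {GG : QGroup N} {Γ : Subgroup (SL N ℤ)} (E : EuclideanNorm N)
  (b : Module.Basis (Fin (Module.finrank ℝ GG.lie)) ℝ GG.lie)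

theorem exp_Ad_mul (g : GG.points ℝ) (Z : GG.lie) : exp (Ad g⁻¹ Z) = g⁻¹ * exp Z * g := by
  rw [exp_Ad, inv_inv]

theorem smul_Ad (g : GG.points ℝ) (t : ℝ) (Z : GG.lie) : Ad g (t • Z) = t • Ad g Z :=
  (AdLin g).map_smul t Z

theorem lieDeriv_translate (Z : GG.lie) (f : GG.Space Γ → ℝ) (g : GG.points ℝ) (x : GG.Space Γ) :
    lieDeriv Z (fun y => f (act y g)) x = lieDeriv (Ad g⁻¹ Z) f (act x g) := by
  have h : ∀ t : ℝ, act (act x (exp (t • Z))) g = act (act x g) (exp (t • Ad g⁻¹ Z)) := by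
    intro t
    rw [← smul_Ad, exp_Ad_mul, ← act_mul, ← act_mul]
    congr 1
    group
  simp only [lieDeriv, h]

theorem lieDeriv_sum {ι : Type*} (s : Finset ι) (c : ι → ℝ) {F : ι → GG.Space Γ → ℝ}
    (hF : ∀ i, IsTestFunction (F i)) (Z : GG.lie) (x : GG.Space Γ) :
    lieDeriv Z (fun y => ∑ i ∈ s, c i * F i y) x = ∑ i ∈ s, c i * lieDeriv Z (F i) x := by
  have h : HasDerivAt (fun t : ℝ => ∑ i ∈ s, c i * F i (act x (exp (t • Z))))
      (∑ i ∈ s, c i * lieDeriv Z (F i) (act x (exp ((0 : ℝ) • Z)))) 0 := by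
    refine HasDerivAt.fun_sum fun i _ => ((hF i).hasDerivAt x Z 0).const_mul (c i)
  rw [lieDeriv, h.deriv]
  simp [exp_zero]

theorem IsTestFunction.monomialDeriv {f : GG.Space Γ → ℝ} (hf : IsTestFunction f) {k : ℕ}
    (w : Fin k → Fin (Module.finrank ℝ GG.lie)) : IsTestFunction (monomialDeriv b w f) := by
  rw [monomialDeriv_eq]
  exact hf.wordDeriv b _

theorem monomialDeriv_cons {k : ℕ} (i : Fin (Module.finrank ℝ GG.lie))
    (w : Fin k → Fin (Module.finrank ℝ GG.lie)) (f : GG.Space Γ → ℝ) :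
    monomialDeriv b (Fin.cons i w : Fin (k + 1) → _) f = lieDeriv (b i) (monomialDeriv b w f) := by
  rw [monomialDeriv, List.ofFn_cons]
  rfl

theorem sum_fin_succ_fun {k : ℕ} {ι : Type*} [Fintype ι] {M : Type*} [AddCommMonoid M]
    (F : (Fin (k + 1) → ι) → M) :
    ∑ w, F w = ∑ i, ∑ w : Fin k → ι, F (Fin.cons i w) := by
  rw [← Fintype.sum_prod_type', ← (Fin.consEquiv fun _ => ι).sum_comp]
  rfl

/-- Translation by `g` turns each letter `b (w j)` into `Ad(g⁻¹) (b (w j))`, which is expanded in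
the basis. Words of the same degree result, so translation loses no derivatives. -/
theorem monomialDeriv_translate {f : GG.Space Γ → ℝ} (hf : IsTestFunction f) (g : GG.points ℝ)
    {k : ℕ} (w : Fin k → Fin (Module.finrank ℝ GG.lie)) (x : GG.Space Γ) :
    monomialDeriv b w (fun y => f (act y g)) x = ∑ w' : Fin k → Fin (Module.finrank ℝ GG.lie),
      (∏ j, b.equivFun (Ad g⁻¹ (b (w j))) (w' j)) * monomialDeriv b w' f (act x g) := by
  induction k generalizing x with
  | zero =>
    rw [Fintype.sum_unique]
    simp [monomialDeriv]
  | succ k ih =>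
    obtain ⟨i, v, rfl⟩ : ∃ i v, w = Fin.cons i v := ⟨w 0, Fin.tail w, (Fin.cons_self_tail w).symm⟩
    rw [monomialDeriv_cons, sum_fin_succ_fun]
    have h1 : monomialDeriv b v (fun y => f (act y g)) = fun x => _ := funext (ih v)
    rw [h1, lieDeriv_sum _ _ fun w' => (hf.monomialDeriv b w').translate g, Finset.sum_comm]
    refine Finset.sum_congr rfl fun w' _ => ?_
    have h2 : Ad g⁻¹ (b i) = lin b (b.equivFun (Ad g⁻¹ (b i))) :=
      (b.equivFun.symm_apply_apply _).symm
    rw [lieDeriv_translate, h2, (hf.monomialDeriv b w').lieDeriv_lin, Finset.mul_sum]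
    refine Finset.sum_congr rfl fun l _ => ?_
    rw [Fin.prod_univ_succ, monomialDeriv_cons]
    simp only [Fin.cons_zero, Fin.cons_succ]
    ring

/-- The coefficients of the adjoint action are bounded on compact sets. -/
theorem exists_abs_Ad_le {S : Set (GG.points ℝ)} (hS : IsCompact S) : ∃ A : ℝ, 1 ≤ A ∧
    ∀ g ∈ S, ∀ i j, |b.equivFun (Ad g⁻¹ (b i)) j| ≤ A := by
  obtain ⟨C₁, h₁⟩ := hS.exists_bound_of_continuousOn
    ((continuous_mat (GG := GG)).comp continuous_inv).continuousOn
  obtain ⟨C₂, h₂⟩ := hS.exists_bound_of_continuousOn (continuous_mat (GG := GG)).continuousOn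
  set B := ∑ i, ‖emb N (b i : Matrix (Fin N) (Fin N) ℝ)‖ with hB
  have hB0 : 0 ≤ B := Finset.sum_nonneg fun _ _ => norm_nonneg _
  obtain ⟨K, hK, hanti⟩ := (linMat b : Coord GG →ₗ[ℝ] EndN N).exists_antilipschitzWith
    (LinearMap.ker_eq_bot.2 (linMat_injective b))
  refine ⟨max 1 (K * (C₁ * B * C₂)), le_max_left _ _, fun g hg i j => ?_⟩
  have e1 := h₁ g hg
  have e2 := h₂ g hg
  rw [Function.comp_apply] at e1
  have e3 : ‖emb N (b i : Matrix (Fin N) (Fin N) ℝ)‖ ≤ B :=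
    Finset.single_le_sum (f := fun i => ‖emb N (b i : Matrix (Fin N) (Fin N) ℝ)‖)
      (fun _ _ => norm_nonneg _) (Finset.mem_univ i)
  have h0 := hanti.le_mul_dist (b.equivFun (Ad g⁻¹ (b i))) 0
  rw [map_zero, dist_zero_right, dist_zero_right] at h0
  have h4 : linMat b (b.equivFun (Ad g⁻¹ (b i))) = emb N (Ad g⁻¹ (b i)) :=
    congrArg (fun w : GG.lie => emb N (w : Matrix (Fin N) (Fin N) ℝ))
      (b.equivFun.symm_apply_apply _)
  change _ ≤ K * ‖linMat b (b.equivFun (Ad g⁻¹ (b i)))‖ at h0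
  rw [h4, emb_Ad, inv_inv] at h0
  refine ((norm_le_pi_norm (b.equivFun (Ad g⁻¹ (b i))) j).trans h0).trans
    (le_trans ?_ (le_max_right _ _))
  refine mul_le_mul_of_nonneg_left ?_ K.2
  refine (norm_mul_le _ _).trans ?_
  have h5 : ‖mat g⁻¹ * emb N (b i)‖ ≤ C₁ * B := (norm_mul_le _ _).trans
    (mul_le_mul e1 e3 (norm_nonneg _) ((norm_nonneg _).trans e1))
  exact mul_le_mul h5 e2 (norm_nonneg _) (mul_nonneg ((norm_nonneg _).trans e1) hB0)

theorem IsInvariantMeasure.integral_act {m : Measure (GG.Space Γ)} (hm : IsInvariantMeasure m)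
    (g : GG.points ℝ) (h : GG.Space Γ → ℝ) : ∫ x, h (act x g) ∂m = ∫ x, h x ∂m := by
  conv_rhs => rw [← hm.invariant g]
  exact ((actHomeo g).measurableEmbedding.integral_map h).symm

/-- Translations by elements of compact sets are bounded for the Sobolev norm. -/
theorem IsInvariantMeasure.exists_sobolev_translate_le {m : Measure (GG.Space Γ)}
    (hm : IsInvariantMeasure m) (d : ℕ) {S : Set (GG.points ℝ)} (hS : IsCompact S) :
    ∃ C : ℝ, 0 < C ∧ ∀ g ∈ S, ∀ f : GG.Space Γ → ℝ, IsTestFunction f →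
      sobolev E b m d (fun x => f (act x g)) ≤ C * sobolev E b m d f := by
  obtain ⟨A, hA, hAd⟩ := exists_abs_Ad_le b hS
  obtain ⟨κ, hκ, hheight⟩ := exists_height_le E (Γ := Γ) hS
  -- The first factor bounds the number of words, from Cauchy–Schwarz for the sum over them. The
  -- others are the squares of the bounds `A^d` for the coefficients and `κ^d` for the change of the
  -- weight.
  obtain ⟨Q, hQ⟩ : ∃ Q : ℝ, Q = ((Module.finrank ℝ GG.lie : ℝ) + 1) ^ d *
    (A ^ (2 * d) * κ ^ (2 * d)) := ⟨_, rfl⟩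
  have hQ0 : 0 < Q := by
    rw [hQ]
    positivity
  have hterm : ∀ g ∈ S, ∀ f : GG.Space Γ → ℝ, IsTestFunction f → ∀ k ≤ d,
      ∀ w : Fin k → Fin (Module.finrank ℝ GG.lie),
      ∫ x, ((height E x + 1) ^ d * monomialDeriv b w (fun x => f (act x g)) x) ^ 2 ∂m
        ≤ Q * sobolev E b m d f ^ 2 := by
    intro g hg f hf k hk w
    have hint : ∀ w' : Fin k → Fin (Module.finrank ℝ GG.lie), Integrable (fun x =>
        ((height E (act x g) + 1) ^ d * monomialDeriv b w' f (act x g)) ^ 2) m := by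
      intro w'
      have h1 := hm.integrable_sq E d (hf.monomialDeriv b w')
      rw [← hm.invariant g] at h1
      exact ((actHomeo g).measurableEmbedding.integrable_map_iff).1 h1
    have hpt : ∀ x, ((height E x + 1) ^ d * monomialDeriv b w (fun x => f (act x g)) x) ^ 2
        ≤ Q * ∑ w' : Fin k → Fin (Module.finrank ℝ GG.lie),
          ((height E (act x g) + 1) ^ d * monomialDeriv b w' f (act x g)) ^ 2 := by
      intro x
      have h0 := height_nonneg E x
      have h1 := (hheight x g hg).1
      rw [monomialDeriv_translate b hf, Finset.mul_sum]
      refine (sq_sum_le_card_mul_sum_sq).trans ?_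
      rw [hQ, mul_assoc, Finset.mul_sum (f := fun w' : Fin k → Fin (Module.finrank ℝ GG.lie) =>
        ((height E (act x g) + 1) ^ d * monomialDeriv b w' f (act x g)) ^ 2)]
      refine mul_le_mul ?_ (Finset.sum_le_sum fun w' _ => ?_)
        (Finset.sum_nonneg fun _ _ => sq_nonneg _) (by positivity)
      · rw [Finset.card_univ, Fintype.card_fun, Fintype.card_fin, Fintype.card_fin]
        push_cast
        calc ((Module.finrank ℝ GG.lie : ℝ)) ^ k ≤ ((Module.finrank ℝ GG.lie : ℝ) + 1) ^ k := by
              gcongr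
              linarith
          _ ≤ _ := pow_le_pow_right₀ (by simp) hk
      · set p := ∏ j, b.equivFun (Ad g⁻¹ (b (w j))) (w' j) with hp
        have h2 : |p| ≤ A ^ d := by
          rw [hp, Finset.abs_prod]
          refine (Finset.prod_le_prod (fun _ _ => abs_nonneg _)
            fun j _ => hAd g hg (w j) (w' j)).trans ?_
          rw [Finset.prod_const, Finset.card_univ, Fintype.card_fin]
          exact pow_le_pow_right₀ hA hk
        have h3 : p ^ 2 ≤ A ^ (2 * d) := by
          rw [← sq_abs, mul_comm, pow_mul]
          gcongr
        have h4 : ((height E x + 1) ^ d) ^ 2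
            ≤ κ ^ (2 * d) * ((height E (act x g) + 1) ^ d) ^ 2 := by
          rw [← pow_mul, ← pow_mul, mul_comm d 2, ← mul_pow]
          gcongr
        calc _ = p ^ 2 * (((height E x + 1) ^ d) ^ 2 * monomialDeriv b w' f (act x g) ^ 2) := by
              ring
          _ ≤ A ^ (2 * d) * ((κ ^ (2 * d) * ((height E (act x g) + 1) ^ d) ^ 2) *
              monomialDeriv b w' f (act x g) ^ 2) := by
              gcongr
          _ = _ := by ring
    calc _ ≤ ∫ x, Q * ∑ w' : Fin k → Fin (Module.finrank ℝ GG.lie),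
          ((height E (act x g) + 1) ^ d * monomialDeriv b w' f (act x g)) ^ 2 ∂m :=
          integral_mono (hm.integrable_sq E d ((hf.translate g).monomialDeriv b w))
            ((integrable_finsetSum _ fun w' _ => hint w').const_mul _) hpt
      _ = Q * ∑ w' : Fin k → Fin (Module.finrank ℝ GG.lie),
          ∫ x, ((height E x + 1) ^ d * monomialDeriv b w' f x) ^ 2 ∂m := by
          rw [integral_const_mul, integral_finsetSum _ fun w' _ => hint w']
          congr 1
          refine Finset.sum_congr rfl fun w' _ => ?_
          exact hm.integral_act g fun x => ((height E x + 1) ^ d * monomialDeriv b w' f x) ^ 2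
      _ ≤ _ := by
          refine mul_le_mul_of_nonneg_left ?_ hQ0.le
          rw [sq_sobolev]
          exact Finset.single_le_sum (f := fun k => ∑ w : Fin k → Fin (Module.finrank ℝ GG.lie),
            ∫ x, ((height E x + 1) ^ d * monomialDeriv b w f x) ^ 2 ∂m)
            (fun k _ => Finset.sum_nonneg fun w _ => integral_nonneg fun _ => sq_nonneg _)
            (Finset.mem_range.2 (by omega))
  obtain ⟨P, hP⟩ : ∃ P : ℝ, P = ∑ k ∈ Finset.range (d + 1),
    ∑ w : Fin k → Fin (Module.finrank ℝ GG.lie), Q := ⟨_, rfl⟩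
  have hP0 : 0 ≤ P := hP ▸ Finset.sum_nonneg fun _ _ => Finset.sum_nonneg fun _ _ => hQ0.le
  refine ⟨√P + 1, by positivity, fun g hg f hf => ?_⟩
  have hS0 := sobolev_nonneg E b m d f
  have h1 : sobolev E b m d (fun x => f (act x g)) ^ 2 ≤ P * sobolev E b m d f ^ 2 := by
    rw [sq_sobolev, hP, Finset.sum_mul]
    refine Finset.sum_le_sum fun k hk => ?_
    rw [Finset.sum_mul]
    refine Finset.sum_le_sum fun w _ => hterm g hg f hf k ?_ w
    have := Finset.mem_range.1 hk
    omega
  refine (le_abs_self _).trans (abs_le_of_sq_le_sq (h1.trans ?_) (by positivity))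
  rw [mul_pow]
  refine mul_le_mul_of_nonneg_right ?_ (sq_nonneg _)
  nlinarith [Real.sq_sqrt hP0, Real.sqrt_nonneg P]

/-- Test functions are Lipschitz, with constant controlled by the Sobolev norm. -/
theorem IsInvariantMeasure.exists_abs_act_sub_le {m : Measure (GG.Space Γ)}
    (hm : IsInvariantMeasure m) (hss : LieAlgebra.IsSemisimple ℝ GG.lie) {d : ℕ}
    (hd : Module.finrank ℝ GG.lie + 1 ≤ d) : ∃ C : ℝ, 0 < C ∧ ∀ f : GG.Space Γ → ℝ,
      IsTestFunction f → ∀ x g, |f (act x g) - f x| ≤ C * ‖mat g - 1‖ * sobolev E b m d f := by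
  obtain ⟨C₁, hC₁, h₁⟩ := hm.exists_abs_le_sobolev E b hss (d := d) (by omega)
  -- The supremum of a first derivative is controlled in degree `d - 1`, since one derivative is
  -- already spent; hence `dim + 1 ≤ d`.
  obtain ⟨C₂, hC₂, h₂⟩ := hm.exists_abs_le_sobolev E b hss (d := d - 1) (by omega)
  obtain ⟨r, hr, K, hK, hbi, -⟩ := (isChart_exp b).exists_measure_comparison
  obtain ⟨ρ, hρ, hsub⟩ := Metric.mem_nhds_iff.1
    ((isChart_exp b).image_mem_nhds (Metric.ball_mem_nhds 0 hr))
  -- the Sobolev norm of a derivative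
  obtain ⟨P, hP⟩ : ∃ P : ℝ, P = ∑ k ∈ Finset.range (d - 1 + 1),
    ∑ w : Fin k → Fin (Module.finrank ℝ GG.lie), (1 : ℝ) := ⟨_, rfl⟩
  have hP0 : 0 ≤ P := hP ▸ Finset.sum_nonneg fun _ _ => Finset.sum_nonneg fun _ _ => zero_le_one
  have hderiv : ∀ f : GG.Space Γ → ℝ, IsTestFunction f → ∀ i,
      sobolev E b m (d - 1) (lieDeriv (b i) f) ≤ √P * sobolev E b m d f := by
    intro f hf i
    refine (le_abs_self _).trans (abs_le_of_sq_le_sq ?_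
      (mul_nonneg (Real.sqrt_nonneg _) (sobolev_nonneg E b m d f)))
    rw [mul_pow, Real.sq_sqrt hP0, sq_sobolev, hP, Finset.sum_mul]
    refine Finset.sum_le_sum fun k hk => ?_
    rw [Finset.sum_mul]
    refine Finset.sum_le_sum fun w _ => ?_
    rw [one_mul]
    have hkd := Finset.mem_range.1 hk
    have hw : monomialDeriv b w (lieDeriv (b i) f) = wordDeriv b (i :: (List.ofFn w).reverse) f :=
      monomialDeriv_eq b w _
    rw [hw]
    refine le_trans (integral_mono (hm.integrable_sq E (d - 1) (hf.wordDeriv b _))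
      (hm.integrable_sq E d (hf.wordDeriv b _)) fun x => ?_)
      (integral_wordDeriv_le E b m f (u := i :: (List.ofFn w).reverse) (d := d) ?_)
    · have := height_nonneg E x
      change (_ * _) ^ 2 ≤ (_ * _) ^ 2
      rw [mul_pow, mul_pow]
      have : (height E x + 1) ^ (d - 1) ≤ (height E x + 1) ^ d :=
        pow_le_pow_right₀ (by linarith) (by omega)
      gcongr
    · simp
      omega
  obtain ⟨B, hB⟩ : ∃ B : ℝ, B = (Module.finrank ℝ GG.lie : ℝ) * (C₂ * √P) := ⟨_, rfl⟩
  have hexp : ∀ f : GG.Space Γ → ℝ, IsTestFunction f → ∀ x (a : Coord GG),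
      |f (act x (exp (lin b a))) - f x| ≤ B * ‖a‖ * sobolev E b m d f := by
    intro f hf x a
    have h3 : ∀ y, |lieDeriv (lin b a) f y| ≤ B * ‖a‖ * sobolev E b m d f := by
      intro y
      rw [hf.lieDeriv_lin b a y]
      refine (Finset.abs_sum_le_sum_abs _ _).trans ?_
      have h4 : ∀ i ∈ Finset.univ, |a i * lieDeriv (b i) f y|
          ≤ ‖a‖ * (C₂ * (√P * sobolev E b m d f)) := by
        intro i _
        rw [abs_mul]
        refine mul_le_mul (norm_le_pi_norm a i) ((h₂ _ (hf.lieDeriv (b i)) y).trans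
          (mul_le_mul_of_nonneg_left (hderiv f hf i) hC₂.le)) (abs_nonneg _) (norm_nonneg _)
      refine (Finset.sum_le_sum h4).trans (le_of_eq ?_)
      rw [Finset.sum_const, Finset.card_univ, Fintype.card_fin, nsmul_eq_mul, hB]
      ring
    have h5 := norm_image_sub_le_of_norm_deriv_le_segment_01'
      (f := fun t : ℝ => f (act x (exp (t • lin b a))))
      (fun t _ => (hf.hasDerivAt x (lin b a) t).hasDerivWithinAt) (fun t _ => h3 _)
    simpa [exp_zero] using h5
  refine ⟨max (B * K) (2 * C₁ / ρ), lt_max_of_lt_right (by positivity), fun f hf x g => ?_⟩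
  have hS0 := sobolev_nonneg E b m d f
  have hB0 : 0 ≤ B := by
    rw [hB]
    positivity
  -- Near `1` the element is the exponential of a vector of comparable size and the mean value
  -- inequality applies. Further away, twice the supremum of `|f|` is absorbed by `‖g - 1‖ ≥ ρ`.
  rcases lt_or_ge ‖mat g - 1‖ ρ with hg | hg
  · obtain ⟨a, ha, rfl⟩ := hsub (mem_ball_one.2 hg)
    have h6 := (hbi a ha).2
    rw [dist_eq, mat_one] at h6
    calc _ ≤ B * ‖a‖ * sobolev E b m d f := hexp f hf x a
      _ ≤ B * (K * ‖mat (exp (lin b a)) - 1‖) * sobolev E b m d f := by gcongr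
      _ = B * K * ‖mat (exp (lin b a)) - 1‖ * sobolev E b m d f := by ring
      _ ≤ _ := by
        gcongr
        exact le_max_left _ _
  · have h6 := norm_sub_le (f (act x g)) (f x)
    simp only [Real.norm_eq_abs] at h6
    have h7 := h₁ f hf x
    have h8 := h₁ f hf (act x g)
    calc _ ≤ 2 * C₁ * sobolev E b m d f := by linarith
      _ = 2 * C₁ / ρ * ρ * sobolev E b m d f := by rw [div_mul_cancel₀ _ hρ.ne']
      _ ≤ _ := by
        gcongr
        exact le_max_right _ _

end EffEqui.QGroup

/-! ### From two generic orbits to almost invariance along a one-parameter group. -/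

namespace EffEqui.QGroup

open scoped ContDiff ENNReal NNReal
open Filter Topology MeasureTheory

variable {N : ℕ} {GG : QGroup N} {Γ : Subgroup (SL N ℤ)} (E : EuclideanNorm N)
  (b : Module.Basis (Fin (Module.finrank ℝ GG.lie)) ℝ GG.lie)

variable (N) in
theorem exists_lipschitz_exp (R : ℝ) : ∃ L : ℝ, 0 < L ∧ ∀ X Y : EndN N, ‖X‖ ≤ R → ‖Y‖ ≤ R →
    ‖NormedSpace.exp X - NormedSpace.exp Y‖ ≤ L * ‖X - Y‖ := by
  have h1 : ContDiff ℝ 1 (NormedSpace.exp : EndN N → EndN N) := contDiff_exp.of_le (by simp)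
  obtain ⟨K, hK⟩ := LocallyLipschitzOn.exists_lipschitzOnWith_of_compact
    (isCompact_closedBall (0 : EndN N) R) (h1.locallyLipschitz.locallyLipschitzOn)
  refine ⟨K + 1, by positivity, fun X Y hX hY => ?_⟩
  have := hK.dist_le_mul X (by simpa using hX) Y (by simpa using hY)
  rw [dist_eq_norm, dist_eq_norm] at this
  nlinarith [norm_nonneg (X - Y)]

variable (GG) in
theorem exists_exp_mem_closedBall (R : ℝ) : ∃ M : ℝ, ∀ Z : GG.lie, ‖emb N Z‖ ≤ R →
    exp Z ∈ Metric.closedBall (1 : GG.points ℝ) M := by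
  obtain ⟨M, hM⟩ := (isCompact_closedBall (0 : EndN N) R).exists_bound_of_continuousOn
    (contDiff_exp.continuous.sub continuous_const).continuousOn (f := fun X : EndN N =>
      NormedSpace.exp X - 1)
  refine ⟨M, fun Z hZ => ?_⟩
  rw [Metric.mem_closedBall, dist_eq, mat_one, mat_exp]
  exact hM _ (by simpa using hZ)

theorem IsTestFunction.bounded {f : GG.Space Γ → ℝ} (hf : IsTestFunction f)
    (μ : Measure (GG.Space Γ)) [IsFiniteMeasure μ] : Integrable f μ := by
  obtain ⟨C, hC⟩ := hf.hasCompactSupport.isCompact.exists_bound_of_continuousOn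
    hf.continuous.continuousOn
  refine Integrable.of_bound hf.continuous.aestronglyMeasurable (max C 0)
    (Eventually.of_forall fun x => ?_)
  by_cases hx : x ∈ tsupport f
  · exact (hC x hx).trans (le_max_left _ _)
  · rw [image_eq_zero_of_notMem_tsupport hx, norm_zero]
    exact le_max_right _ _

theorem abs_integral_act_sub_le {μ : Measure (GG.Space Γ)} [IsProbabilityMeasure μ]
    {f : GG.Space Γ → ℝ} (hf : IsTestFunction f) (g h : GG.points ℝ) {B : ℝ}
    (hB : ∀ x, |f (act x g) - f (act x h)| ≤ B) :
    |(∫ x, f (act x g) ∂μ) - ∫ x, f (act x h) ∂μ| ≤ B := by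
  rw [← integral_sub ((hf.translate g).bounded μ) ((hf.translate h).bounded μ)]
  have := norm_integral_le_of_norm_le_const (μ := μ) (f := fun x => f (act x g) - f (act x h))
    (Eventually.of_forall hB)
  simpa using this

/-- An average over an interval changes by at most the supremum of the difference. -/
theorem abs_discrepancy_sub_le {K : ℝ} (hK : 1 ≤ K) (z : GG.lie) (μ : Measure (GG.Space Γ)) {n : ℝ}
    (hn : 1 ≤ n) {f f' : GG.Space Γ → ℝ} (hf : IsTestFunction f) (hf' : IsTestFunction f')
    (x x' : GG.Space Γ) {B : ℝ}
    (hB : ∀ t ∈ Set.Icc (n ^ K) ((n + 1) ^ K),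
      |f (act x (exp (t • z))) - f' (act x' (exp (t • z)))| ≤ B) :
    |(discrepancy K z μ n f x + ∫ y, f y ∂μ) - (discrepancy K z μ n f' x' + ∫ y, f' y ∂μ)| ≤ B := by
  have hlen : 0 < (n + 1) ^ K - n ^ K :=
    sub_pos.2 (Real.rpow_lt_rpow (by linarith) (by linarith) (by linarith))
  have hc : ∀ {F : GG.Space Γ → ℝ}, IsTestFunction F → ∀ y : GG.Space Γ,
      IntervalIntegrable (fun t : ℝ => F (act y (exp (t • z)))) volume (n ^ K) ((n + 1) ^ K) :=
    fun hF y => (hF.continuous.comp ((continuous_act_right y).comp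
      (continuous_exp_smul z))).intervalIntegrable _ _
  have h1 := intervalIntegral.norm_integral_le_of_norm_le_const (C := B)
    (f := fun t : ℝ => f (act x (exp (t • z))) - f' (act x' (exp (t • z))))
    (a := n ^ K) (b := (n + 1) ^ K) fun t ht => by
      rw [Set.uIoc_of_le (by linarith)] at ht
      exact hB t ⟨ht.1.le, ht.2⟩
  rw [intervalIntegral.integral_sub (hc hf x) (hc hf' x'), abs_of_pos hlen, Real.norm_eq_abs] at h1
  have h2 : (discrepancy K z μ n f x + ∫ y, f y ∂μ) - (discrepancy K z μ n f' x' + ∫ y, f' y ∂μ)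
      = 1 / ((n + 1) ^ K - n ^ K) * ((∫ t in (n ^ K)..((n + 1) ^ K), f (act x (exp (t • z))))
        - ∫ t in (n ^ K)..((n + 1) ^ K), f' (act x' (exp (t • z)))) := by
    simp only [discrepancy]
    ring
  rw [h2, abs_mul, abs_of_pos (by positivity), one_div, inv_mul_le_iff₀ hlen, mul_comm]
  exact h1

/-- The Lipschitz bound is applied at `x exp(Y')` to `exp(Y')⁻¹ exp(Y)`, which differs from `1` by
`exp(Y')⁻¹ (exp Y - exp Y')`. -/
theorem IsInvariantMeasure.exists_abs_exp_sub_le {m : Measure (GG.Space Γ)}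
    (hm : IsInvariantMeasure m) (hss : LieAlgebra.IsSemisimple ℝ GG.lie) {d : ℕ}
    (hd : Module.finrank ℝ GG.lie + 1 ≤ d) (R : ℝ) : ∃ C : ℝ, 0 < C ∧
    ∀ f : GG.Space Γ → ℝ, IsTestFunction f → ∀ (x : GG.Space Γ) (Y Y' : GG.lie),
      ‖emb N Y‖ ≤ R → ‖emb N Y'‖ ≤ R →
      |f (act x (exp Y)) - f (act x (exp Y'))| ≤ C * ‖emb N Y - emb N Y'‖ * sobolev E b m d f := by
  obtain ⟨M, hM⟩ := exists_exp_mem_closedBall GG R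
  obtain ⟨C, hC, hlip⟩ := hm.exists_abs_act_sub_le E b hss hd
  obtain ⟨L, hL, hexp⟩ := exists_lipschitz_exp N R
  refine ⟨C * ((|M| + 1) * L), by positivity, fun f hf x Y Y' hY hY' => ?_⟩
  have hS := sobolev_nonneg E b m d f
  have h1 := hlip f hf (act x (exp Y')) ((exp Y')⁻¹ * exp Y)
  rw [← act_mul, mul_inv_cancel_left] at h1
  have h2 : mat ((exp Y')⁻¹ * exp Y) - 1 = mat (exp Y')⁻¹ * (mat (exp Y) - mat (exp Y')) := by
    rw [mul_sub, mat_inv_mul_mat, mat_mul]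
  have h3 : ‖mat (exp Y')⁻¹‖ ≤ |M| + 1 := by
    have h4 := hM (-Y') (by
      have : emb N ((-Y' : GG.lie) : Matrix (Fin N) (Fin N) ℝ) = -emb N Y' := map_neg (emb N) _
      rwa [this, norm_neg])
    rw [exp_neg, Metric.mem_closedBall, dist_eq, mat_one] at h4
    have h5 := norm_add_le (mat (exp Y')⁻¹ - 1) 1
    rw [sub_add_cancel] at h5
    linarith [EndN.norm_one_le (N := N), le_abs_self M]
  have h6 : ‖mat ((exp Y')⁻¹ * exp Y) - 1‖ ≤ (|M| + 1) * (L * ‖emb N Y - emb N Y'‖) := by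
    rw [h2]
    refine (norm_mul_le _ _).trans ?_
    have := hexp _ _ hY hY'
    rw [mat_exp, mat_exp]
    gcongr
  refine h1.trans ?_
  calc _ ≤ C * ((|M| + 1) * (L * ‖emb N Y - emb N Y'‖)) * sobolev E b m d f := by gcongr
    _ = _ := by ring

/-- Two generic points which differ by a slowly varying displacement give almost invariance. -/
theorem IsInvariantMeasure.exists_almostInvariant {m : Measure (GG.Space Γ)}
    (hm : IsInvariantMeasure m) (hss : LieAlgebra.IsSemisimple ℝ GG.lie) {d : ℕ}
    (hd : Module.finrank ℝ GG.lie + 1 ≤ d) (R : ℝ) : ∃ C : ℝ, 0 < C ∧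
    ∀ (μ : Measure (GG.Space Γ)) [IsProbabilityMeasure μ] (K : ℝ), 1 ≤ K → ∀ (z v Y : GG.lie)
      (x : GG.Space Γ) (n η : ℝ), 1 ≤ n → ‖emb N Y‖ ≤ R →
      (∀ t ∈ Set.Icc (n ^ K) ((n + 1) ^ K), ‖emb N (Ad (exp (t • z))⁻¹ v)‖ ≤ R ∧
        ‖emb N (Ad (exp (t • z))⁻¹ v) - emb N Y‖ ≤ η) →
      (∀ f : GG.Space Γ → ℝ, IsTestFunction f →
        |discrepancy K z μ n f x| ≤ 1 / n * sobolev E b m d f) →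
      (∀ f : GG.Space Γ → ℝ, IsTestFunction f →
        |discrepancy K z μ n f (act x (exp v))| ≤ 1 / n * sobolev E b m d f) →
      AlmostInvariant (sobolev E b m d) μ (C * (1 / n + η)) (exp Y) := by
  obtain ⟨M, hM⟩ := exists_exp_mem_closedBall GG R
  obtain ⟨C₁, hC₁, htr⟩ := hm.exists_sobolev_translate_le E b d
    (isCompact_closedBall (1 : GG.points ℝ) M)
  obtain ⟨C₂, hC₂, hlip⟩ := hm.exists_abs_exp_sub_le E b hss hd R
  refine ⟨1 + C₁ + C₂, by positivity, ?_⟩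
  intro μ _ K hK z v Y x n η hn hY hq h₁ h₂ f hf
  have hS := sobolev_nonneg E b m d f
  -- Genericity of `x` is used for `y ↦ f(y exp Y)` and that of `x exp v` for `f` itself. The two
  -- orbit averages are close pointwise in time, hence so are the two space averages.
  have hg := hf.translate (exp Y)
  have e1 := h₁ _ hg
  have e2 := h₂ f hf
  have e3 := htr (exp Y) (hM Y hY) f hf
  have e4 := abs_discrepancy_sub_le hK z μ hn hg hf x (act x (exp v))
    (B := C₂ * η * sobolev E b m d f) fun t ht => by
      -- The displacement at time `t`: `x exp(v) u_t = x u_t exp(Ad(u_t⁻¹) v)`.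
      have h3 : act (act x (exp v)) (exp (t • z))
          = act (act x (exp (t • z))) (exp (Ad (exp (t • z))⁻¹ v)) := by
        rw [exp_Ad_mul, ← act_mul, ← act_mul]
        congr 1
        group
      rw [h3, abs_sub_comm]
      refine (hlip f hf _ _ _ (hq t ht).1 hY).trans ?_
      have := (hq t ht).2
      gcongr
  have hn0 : 0 < 1 / n := by positivity
  have e5 : 1 / n * sobolev E b m d (fun x => f (act x (exp Y)))
      ≤ 1 / n * (C₁ * sobolev E b m d f) := mul_le_mul_of_nonneg_left e3 hn0.le
  have hη : 0 ≤ η := by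
    have hmem : n ^ K ∈ Set.Icc (n ^ K) ((n + 1) ^ K) :=
      ⟨le_rfl, Real.rpow_le_rpow (by linarith) (by linarith) (by linarith)⟩
    exact (norm_nonneg _).trans (hq _ hmem).2
  rw [abs_le] at e1 e2 e4 ⊢
  have e6 : (1 + C₁ + C₂) * (1 / n + η) * sobolev E b m d f
      = 1 / n * sobolev E b m d f + 1 / n * (C₁ * sobolev E b m d f) + C₂ * η * sobolev E b m d f
        + ((1 + C₁) * η * sobolev E b m d f + C₂ * (1 / n) * sobolev E b m d f) := by ring
  have e7 : 0 ≤ (1 + C₁) * η * sobolev E b m d f + C₂ * (1 / n) * sobolev E b m d f := by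
    positivity
  constructor <;> linarith [e1.1, e1.2, e2.1, e2.2, e4.1, e4.2]

/-- Iterating an almost invariance along a one-parameter group. -/
theorem IsInvariantMeasure.exists_lieAlmostInvariant {m : Measure (GG.Space Γ)}
    (hm : IsInvariantMeasure m) (hss : LieAlgebra.IsSemisimple ℝ GG.lie) {d : ℕ}
    (hd : Module.finrank ℝ GG.lie + 1 ≤ d) (R : ℝ) : ∃ C : ℝ, 0 < C ∧
    ∀ (μ : Measure (GG.Space Γ)) [IsProbabilityMeasure μ] (Y : GG.lie) (w δ : ℝ),
      ‖emb N Y‖ ≤ R → 0 < δ → δ = E.norm Y → 0 ≤ w →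
      AlmostInvariant (sobolev E b m d) μ w (exp Y) →
      LieAlmostInvariant (sobolev E b m d) μ (C * (w / δ + δ)) (δ⁻¹ • Y) := by
  have hκ := one_le_ratio E
  set R' : ℝ := max R (2 * E.ratio) with hR'
  obtain ⟨M, hM⟩ := exists_exp_mem_closedBall GG R'
  obtain ⟨C₁, hC₁, htr⟩ := hm.exists_sobolev_translate_le E b d
    (isCompact_closedBall (1 : GG.points ℝ) M)
  obtain ⟨C₂, hC₂, hlip⟩ := hm.exists_abs_exp_sub_le E b hss hd R'
  refine ⟨2 * C₁ + C₂ * E.ratio * C₁, by positivity, ?_⟩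
  intro μ _ Y w δ hY hδ hδY hw hinv
  have hnorm : ‖emb N Y‖ ≤ E.ratio * δ := hδY ▸ norm_emb_le_ratio E _
  -- one step in positive direction, at bounded distance
  have hstep : ∀ s : ℝ, |s| * δ ≤ 2 → ∀ f : GG.Space Γ → ℝ, IsTestFunction f →
      |(∫ x, f (act x (exp ((s + 1) • Y))) ∂μ) - ∫ x, f (act x (exp (s • Y))) ∂μ|
        ≤ w * (C₁ * sobolev E b m d f) := by
    intro s hs f hf
    have h1 := hinv _ (hf.translate (exp (s • Y)))
    have h2 : ∀ x : GG.Space Γ, act (act x (exp Y)) (exp (s • Y)) = act x (exp ((s + 1) • Y)) := by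
      intro x
      rw [← act_mul, add_comm, exp_add_smul, one_smul]
    simp only [h2] at h1
    refine h1.trans (mul_le_mul_of_nonneg_left (htr _ (hM _ ?_) f hf) hw)
    rw [emb_coe_smul, norm_smul, Real.norm_eq_abs]
    refine le_trans ?_ (le_max_right _ _)
    nlinarith [abs_nonneg s]
  have hup : ∀ k : ℕ, k * δ ≤ 2 → ∀ f : GG.Space Γ → ℝ, IsTestFunction f →
      |(∫ x, f (act x (exp ((k : ℝ) • Y))) ∂μ) - ∫ x, f x ∂μ|
        ≤ k * (w * (C₁ * sobolev E b m d f)) := by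
    intro k
    induction k with
    | zero =>
      intro _ f _
      simp [exp_zero]
    | succ k ih =>
      intro hk f hf
      push_cast at hk ⊢
      have hk' : (k : ℝ) * δ ≤ 2 := by nlinarith
      have h1 := ih hk' f hf
      have h2 := hstep k (by rwa [abs_of_nonneg (Nat.cast_nonneg k)]) f hf
      rw [abs_le] at h1 h2 ⊢
      constructor <;> linarith [h1.1, h1.2, h2.1, h2.2]
  -- Going backwards uses the same one-step estimate, read from `-(k+1)` to `-k`, with the
  -- translation moved to the test function. Almost invariance under `exp(-Y)` is not needed
  -- separately.
  have hdown : ∀ k : ℕ, k * δ ≤ 2 → ∀ f : GG.Space Γ → ℝ, IsTestFunction f →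
      |(∫ x, f (act x (exp ((-k : ℝ) • Y))) ∂μ) - ∫ x, f x ∂μ|
        ≤ k * (w * (C₁ * sobolev E b m d f)) := by
    intro k
    induction k with
    | zero =>
      intro _ f _
      simp [exp_zero]
    | succ k ih =>
      intro hk f hf
      push_cast at hk ⊢
      have hk' : (k : ℝ) * δ ≤ 2 := by nlinarith
      have h1 := ih hk' f hf
      have h2 := hstep (-(k + 1)) (by rwa [abs_neg, abs_of_nonneg (by positivity)]) f hf
      rw [show -((k : ℝ) + 1) + 1 = -k by ring] at h2
      rw [abs_le] at h1 h2 ⊢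
      constructor <;> linarith [h1.1, h1.2, h2.1, h2.2]
  intro t ht f hf
  have hS := sobolev_nonneg E b m d f
  set k : ℕ := ⌊|t| / δ⌋₊ with hk
  have hk1 : (k : ℝ) ≤ |t| / δ := Nat.floor_le (by positivity)
  have hk2 : |t| / δ < k + 1 := Nat.lt_floor_add_one _
  have hkδ : (k : ℝ) * δ ≤ 2 := by
    rw [le_div_iff₀ hδ] at hk1
    exact hk1.trans ht
  -- Since `|t| ≤ 2`, at most `2/δ` steps are made at cost `w` each. What then remains is a fraction
  -- of one step, whose cost `O(δ)` is the second term of the bound.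
  have hkw : (k : ℝ) * w ≤ 2 * (w / δ) := by
    rw [← mul_div_assoc, le_div_iff₀ hδ]
    nlinarith
  -- the closest multiple of `Y`
  obtain ⟨s, hs, hst, hsb⟩ : ∃ s : ℝ, |s| * δ ≤ 2 ∧ |t / δ - s| ≤ 1 ∧
      |(∫ x, f (act x (exp (s • Y))) ∂μ) - ∫ x, f x ∂μ|
        ≤ k * (w * (C₁ * sobolev E b m d f)) := by
    rcases le_total 0 t with h0 | h0
    · refine ⟨k, by rwa [abs_of_nonneg (Nat.cast_nonneg k)], ?_, hup k hkδ f hf⟩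
      rw [abs_of_nonneg h0] at hk1 hk2
      rw [abs_le]
      constructor <;> linarith
    · refine ⟨-k, by rwa [abs_neg, abs_of_nonneg (Nat.cast_nonneg k)], ?_, hdown k hkδ f hf⟩
      rw [abs_of_nonpos h0, neg_div] at hk1 hk2
      rw [abs_le]
      constructor <;> linarith
  have hrest : |(∫ x, f (act x (exp (t • δ⁻¹ • Y))) ∂μ) - ∫ x, f (act x (exp (s • Y))) ∂μ|
      ≤ C₂ * (E.ratio * δ) * (C₁ * sobolev E b m d f) := by
    have hst' : t • δ⁻¹ • Y = (t / δ - s + s) • Y := by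
      rw [smul_smul, sub_add_cancel, div_eq_mul_inv]
    have hg := hf.translate (exp (s • Y))
    have h2 : ∀ x : GG.Space Γ, act (act x (exp ((t / δ - s) • Y))) (exp (s • Y))
        = act x (exp (t • δ⁻¹ • Y)) := by
      intro x
      rw [← act_mul, ← exp_add_smul, hst']
    have hsm : ‖emb N (s • Y : GG.lie)‖ ≤ R' := by
      rw [emb_coe_smul, norm_smul, Real.norm_eq_abs]
      refine le_trans ?_ (le_max_right _ _)
      nlinarith [abs_nonneg s]
    have hdm : ‖emb N ((t / δ - s) • Y : GG.lie)‖ ≤ ‖emb N Y‖ := by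
      rw [emb_coe_smul, norm_smul, Real.norm_eq_abs]
      exact mul_le_of_le_one_left (norm_nonneg _) hst
    have he0 : emb N ((0 : GG.lie) : Matrix (Fin N) (Fin N) ℝ) = 0 := map_zero (emb N)
    have hR0 : ‖emb N Y‖ ≤ R' := hY.trans (le_max_left _ _)
    have h3 := abs_integral_act_sub_le (μ := μ) hg (exp ((t / δ - s) • Y)) (exp (0 : GG.lie))
      (B := C₂ * (E.ratio * δ) * (C₁ * sobolev E b m d f)) fun x => by
        refine (hlip _ hg x _ 0 (hdm.trans hR0) ?_).trans ?_
        · rw [he0, norm_zero]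
          exact (norm_nonneg _).trans hR0
        · rw [he0, sub_zero]
          have h4 := htr _ (hM _ hsm) f hf
          have h5 := hdm.trans hnorm
          have h6 := sobolev_nonneg E b m d fun x => f (act x (exp (s • Y)))
          gcongr
    simpa only [h2, exp_zero, act_one] using h3
  rw [abs_le] at hrest hsb ⊢
  have e1 : (k : ℝ) * (w * (C₁ * sobolev E b m d f))
      ≤ 2 * (w / δ) * (C₁ * sobolev E b m d f) := by
    rw [← mul_assoc]
    exact mul_le_mul_of_nonneg_right hkw (by positivity)
  have e2 : (2 * C₁ + C₂ * E.ratio * C₁) * (w / δ + δ) * sobolev E b m d f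
      = 2 * (w / δ) * (C₁ * sobolev E b m d f) + C₂ * (E.ratio * δ) * (C₁ * sobolev E b m d f)
        + (2 * C₁ * δ * sobolev E b m d f + C₂ * E.ratio * C₁ * (w / δ) * sobolev E b m d f) := by
    ring
  have e3 : 0 ≤ 2 * C₁ * δ * sobolev E b m d f
      + C₂ * E.ratio * C₁ * (w / δ) * sobolev E b m d f := by positivity
  constructor <;> linarith [hrest.1, hrest.2, hsb.1, hsb.2]

end EffEqui.QGroup

/-! ### Polynomial curves: growth, lower bounds and slow variation. -/

namespace EffEqui

open Filter Topology

section PolynomialCurve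

variable {F : Type*} [NormedAddCommGroup F]

/-- The sizes of the terms of the polynomial curve `∑ tʲ rⱼ` at time `T`. -/
noncomputable def termSum (D : ℕ) (r : ℕ → F) (T : ℝ) : ℝ := ∑ j ∈ Finset.range D, T ^ j * ‖r j‖

theorem termSum_mono (D : ℕ) (r : ℕ → F) {S T : ℝ} (hS : 0 ≤ S) (hST : S ≤ T) :
    termSum D r S ≤ termSum D r T :=
  Finset.sum_le_sum fun j _ => by gcongr

theorem termSum_nonneg (D : ℕ) (r : ℕ → F) {T : ℝ} (hT : 0 ≤ T) : 0 ≤ termSum D r T :=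
  Finset.sum_nonneg fun j _ => by positivity

theorem termSum_mul_le (D : ℕ) (r : ℕ → F) {a T : ℝ} (ha : 1 ≤ a) (hT : 0 ≤ T) :
    termSum D r (a * T) ≤ a ^ D * termSum D r T := by
  rw [termSum, termSum, Finset.mul_sum]
  refine Finset.sum_le_sum fun j hj => ?_
  rw [mul_pow, mul_assoc]
  have := pow_le_pow_right₀ ha (Finset.mem_range.1 hj).le
  gcongr

theorem norm_zero_le_termSum {D : ℕ} (hD : 0 < D) (r : ℕ → F) {T : ℝ} (hT : 0 ≤ T) :
    ‖r 0‖ ≤ termSum D r T := by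
  have := Finset.single_le_sum (f := fun j => T ^ j * ‖r j‖) (s := Finset.range D)
    (fun j _ => by positivity) (Finset.mem_range.2 hD)
  simpa [termSum] using this

/-- The largest time, up to `ρ⁻²`, at which a polynomial curve is of size at most `ρ ^ κ`. -/
theorem exists_time {D : ℕ} (hD : 0 < D) {K : ℝ} (hK : 1 ≤ K) {c₁ C₁ : ℝ} (hc₁ : 0 < c₁)
    (hC₁ : 0 < C₁) : ∃ c : ℝ, 0 < c ∧ ∀ (r : ℕ → F) (ρ : ℝ), 0 < ρ → ρ ≤ 1 → c₁ * ρ ≤ ‖r 0‖ →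
    (∀ j, ‖r j‖ ≤ C₁ * ρ) → ∃ n : ℕ, 1 ≤ n ∧ (n : ℝ) ≤ ρ ^ (-2 : ℝ) ∧
      1 / 2 * ρ ^ (-(3 * (1 / (4 * (D * K))))) ≤ n ∧
      termSum D r ((n : ℝ) ^ K) ≤ D * C₁ * ρ ^ (1 / (4 * (D * K))) ∧
      c * ρ ^ (-(2 * (1 / (4 * (D * K))))) ≤ n * termSum D r ((n : ℝ) ^ K) := by
  have hD1 : (1 : ℝ) ≤ D := by exact_mod_cast hD
  have hL : 1 ≤ D * K := by nlinarith
  obtain ⟨κ, hκ⟩ : ∃ κ : ℝ, κ = 1 / (4 * (D * K)) := ⟨_, rfl⟩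
  have hκ0 : 0 < κ := by rw [hκ]; positivity
  have hκ4 : κ ≤ 1 / 4 := by
    rw [hκ]
    exact one_div_le_one_div_of_le (by norm_num) (by linarith)
  have hκL : κ * 4 * (K * D) = 1 := by
    rw [hκ]
    field_simp
  rw [← hκ]
  -- One constant for each way in which the maximal time below can be stopped: by the cap `ρ⁻²`, or
  -- by the size of the curve.
  refine ⟨min (c₁ / 2) (1 / 2 * (((2 : ℝ) ^ K) ^ D)⁻¹ * (D * C₁)), by positivity, ?_⟩
  intro r ρ hρ hρ1 h0 hr
  have hanti : ∀ {a b : ℝ}, a ≤ b → ρ ^ b ≤ ρ ^ a :=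
    fun h => Real.rpow_le_rpow_of_exponent_ge hρ hρ1 h
  have hS1 : termSum D r 1 ≤ D * C₁ * ρ := by
    have := Finset.sum_le_card_nsmul (Finset.range D) (fun j => (1 : ℝ) ^ j * ‖r j‖) (C₁ * ρ)
      fun j _ => by simpa using hr j
    simpa [termSum, mul_assoc] using this
  classical
  -- `n` will be the largest integer with `P n`, and `P 1` holds since `κ ≤ 1`. The cap makes the
  -- maximum exist when the curve does not grow, and keeps the time well inside a window reaching to
  -- `ρ⁻⁴`.
  let P : ℕ → Prop := fun n => (n : ℝ) ≤ ρ ^ (-2 : ℝ) ∧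
    termSum D r ((n : ℝ) ^ K) ≤ D * C₁ * ρ ^ κ
  have hP1 : P 1 := by
    refine ⟨?_, ?_⟩
    · have := hanti (show (-2 : ℝ) ≤ 0 by norm_num)
      simpa using this
    · rw [Nat.cast_one, Real.one_rpow]
      refine hS1.trans ?_
      have := hanti (show κ ≤ 1 by linarith)
      rw [Real.rpow_one] at this
      gcongr
  have hbd : ∀ k, P k → k ≤ ⌊ρ ^ (-2 : ℝ)⌋₊ := fun k hk => Nat.le_floor hk.1
  obtain ⟨n, hn⟩ : ∃ n, n = Nat.findGreatest P ⌊ρ ^ (-2 : ℝ)⌋₊ := ⟨_, rfl⟩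
  have hn1 : 1 ≤ n := hn ▸ Nat.le_findGreatest (hbd 1 hP1) hP1
  have hPn : P n := hn ▸ Nat.findGreatest_spec (hbd 1 hP1) hP1
  have hnot : ¬ P (n + 1) := fun h => by
    have := Nat.le_findGreatest (hbd _ h) h
    omega
  have hnR : (1 : ℝ) ≤ n := by exact_mod_cast hn1
  have hSn := termSum_nonneg D r (T := (n : ℝ) ^ K) (by positivity)
  refine ⟨n, hn1, hPn.1, ?_⟩
  suffices h : 1 / 2 * ρ ^ (-(3 * κ)) ≤ n ∧ min (c₁ / 2) (1 / 2 * (((2 : ℝ) ^ K) ^ D)⁻¹ * (D * C₁))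
      * ρ ^ (-(2 * κ)) ≤ n * termSum D r ((n : ℝ) ^ K) from ⟨h.1, hPn.2, h.2⟩
  -- If the cap is not the obstruction, the curve exceeds its permitted size at `n + 1`, hence
  -- nearly so at `n`. If it is, then `n ≥ ρ⁻²/2`, and the constant term, at least `c₁ρ`, already
  -- makes `n` times the size large.
  by_cases hcase : ((n + 1 : ℕ) : ℝ) ≤ ρ ^ (-2 : ℝ)
  · have hbig : D * C₁ * ρ ^ κ < termSum D r (((n + 1 : ℕ) : ℝ) ^ K) := by
      by_contra h
      exact hnot ⟨hcase, not_lt.1 h⟩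
    push_cast at hbig
    have h1 : (1 : ℝ) ≤ ((n : ℝ) + 1) ^ K := Real.one_le_rpow (by linarith) (by linarith)
    have h2 := termSum_mul_le D r h1 zero_le_one
    rw [mul_one] at h2
    have h3 : ρ ^ κ ≤ (((n : ℝ) + 1) ^ K) ^ D * ρ := by
      have h4 : D * C₁ * ρ ^ κ ≤ (((n : ℝ) + 1) ^ K) ^ D * (D * C₁ * ρ) :=
        hbig.le.trans (h2.trans (mul_le_mul_of_nonneg_left hS1 (by positivity)))
      have h5 : (((n : ℝ) + 1) ^ K) ^ D * (D * C₁ * ρ)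
          = D * C₁ * ((((n : ℝ) + 1) ^ K) ^ D * ρ) := by ring
      rw [h5] at h4
      exact le_of_mul_le_mul_left h4 (by positivity)
    have h6 : ρ ^ (κ - 1) ≤ ((n : ℝ) + 1) ^ (K * D) := by
      rw [Real.rpow_sub_one hρ.ne', div_le_iff₀ hρ, Real.rpow_mul (by linarith), Real.rpow_natCast]
      exact h3
    -- The exponent `4κ` is `1/(KD)`, so it undoes the power `K * D`. The inequality `4κ(κ-1) ≤ -3κ`
    -- is `κ ≤ 1/4`.
    have h7 : ρ ^ (-(3 * κ)) ≤ (n : ℝ) + 1 := by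
      have h8 := Real.rpow_le_rpow (by positivity) h6 (show 0 ≤ κ * 4 by positivity)
      rw [← Real.rpow_mul hρ.le, ← Real.rpow_mul (by linarith), mul_comm (K * D), hκL,
        Real.rpow_one] at h8
      refine (hanti ?_).trans h8
      nlinarith
    have h9 : 1 / 2 * ρ ^ (-(3 * κ)) ≤ n := by linarith
    refine ⟨h9, ?_⟩
    have h10 : termSum D r (((n : ℝ) + 1) ^ K) ≤ ((2 : ℝ) ^ K) ^ D * termSum D r ((n : ℝ) ^ K) := by
      refine le_trans (termSum_mono D r (by positivity) ?_) (termSum_mul_le D r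
        (Real.one_le_rpow one_le_two (by linarith)) (by positivity))
      rw [← Real.mul_rpow (by norm_num) (by linarith)]
      exact Real.rpow_le_rpow (by linarith) (by linarith) (by linarith)
    have h11 : (((2 : ℝ) ^ K) ^ D)⁻¹ * (D * C₁ * ρ ^ κ) ≤ termSum D r ((n : ℝ) ^ K) := by
      rw [inv_mul_le_iff₀ (by positivity)]
      exact hbig.le.trans h10
    have h12 : ρ ^ (-(2 * κ)) = ρ ^ (-(3 * κ)) * ρ ^ κ := by
      rw [← Real.rpow_add hρ]
      congr 1
      ring
    calc _ ≤ 1 / 2 * (((2 : ℝ) ^ K) ^ D)⁻¹ * (D * C₁) * ρ ^ (-(2 * κ)) :=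
          mul_le_mul_of_nonneg_right (min_le_right _ _) (by positivity)
      _ = (1 / 2 * ρ ^ (-(3 * κ))) * ((((2 : ℝ) ^ K) ^ D)⁻¹ * (D * C₁ * ρ ^ κ)) := by
          rw [h12]
          ring
      _ ≤ _ := mul_le_mul h9 h11 (by positivity) (by positivity)
  · push_cast at hcase
    rw [not_le] at hcase
    have h1 := hanti (show (-2 : ℝ) ≤ -(3 * κ) by linarith)
    refine ⟨by linarith, ?_⟩
    have h2 : c₁ * ρ ≤ termSum D r ((n : ℝ) ^ K) :=
      h0.trans (norm_zero_le_termSum hD r (by positivity))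
    have h3 : ρ ^ (-2 : ℝ) * ρ = ρ ^ (-1 : ℝ) := by
      rw [← Real.rpow_add_one hρ.ne']
      norm_num
    have h4 := hanti (show (-1 : ℝ) ≤ -(2 * κ) by linarith)
    calc _ ≤ c₁ / 2 * ρ ^ (-(2 * κ)) :=
          mul_le_mul_of_nonneg_right (min_le_left _ _) (by positivity)
      _ ≤ c₁ / 2 * ρ ^ (-1 : ℝ) := by gcongr
      _ = (1 / 2 * ρ ^ (-2 : ℝ)) * (c₁ * ρ) := by rw [← h3]; ring
      _ ≤ _ := mul_le_mul (by linarith) h2 (by positivity) (by positivity)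

variable [NormedSpace ℝ F]

/-- The polynomial curve `∑ tʲ rⱼ`. -/
noncomputable def polyCurve (D : ℕ) (r : ℕ → F) (t : ℝ) : F := ∑ j ∈ Finset.range D, t ^ j • r j

theorem norm_polyCurve_le (D : ℕ) (r : ℕ → F) {T : ℝ} (hT : 0 ≤ T) :
    ‖polyCurve D r T‖ ≤ termSum D r T := by
  refine (norm_sum_le _ _).trans (Finset.sum_le_sum fun j _ => ?_)
  rw [norm_smul, Real.norm_of_nonneg (pow_nonneg hT j)]

/-- A polynomial curve cannot be small at all of `D` comparable times. -/
theorem exists_termSum_le (D : ℕ) (hD : 0 < D) {K : ℝ} (hK : 0 < K) : ∃ C : ℝ, 0 < C ∧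
    ∀ (r : ℕ → F) (T : ℝ), 0 ≤ T → ∃ i : ℕ, 1 ≤ i ∧ i ≤ D ∧
      termSum D r T ≤ C * ‖polyCurve D r ((i : ℝ) ^ K * T)‖ := by
  -- Distinct nodes make the Vandermonde matrix invertible, so the `D` values determine the
  -- coefficients and not all of them can be small. Choosing `K`-th powers as nodes keeps the times
  -- `K`-th powers of integers when `T` is one.
  set node : Fin D → ℝ := fun i => ((i : ℕ) + 1 : ℝ) ^ K with hnode
  have hinj : Function.Injective node := by
    intro i j hij
    have h1 := (Real.rpow_left_inj (by positivity) (by positivity) hK.ne').1 hij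
    have h2 : ((i : ℕ) : ℝ) = (j : ℕ) := by linarith
    exact Fin.ext (by exact_mod_cast h2)
  set V := Matrix.vandermonde node with hV
  have hdet : IsUnit V.det := (Matrix.det_vandermonde_ne_zero_iff.2 hinj).isUnit
  set B : ℝ := ∑ j, ∑ i, |V⁻¹ j i| with hB
  have hB0 : 0 ≤ B := Finset.sum_nonneg fun j _ => Finset.sum_nonneg fun i _ => abs_nonneg _
  refine ⟨B + 1, by linarith, fun r T hT => ?_⟩
  have hne : Nonempty (Fin D) := ⟨⟨0, hD⟩⟩
  obtain ⟨i₀, hi₀⟩ := Finite.exists_max fun i : Fin D => ‖polyCurve D r (node i * T)‖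
  refine ⟨i₀ + 1, by omega, i₀.2, ?_⟩
  have hval : ∀ i, polyCurve D r (node i * T) = ∑ j : Fin D, V i j • T ^ (j : ℕ) • r j := by
    intro i
    rw [polyCurve, ← Fin.sum_univ_eq_sum_range (fun j => (node i * T) ^ j • r j) D]
    refine Finset.sum_congr rfl fun j _ => ?_
    rw [mul_pow, mul_smul, hV, Matrix.vandermonde_apply]
  have hinv : ∀ j : Fin D, T ^ (j : ℕ) • r j = ∑ i, V⁻¹ j i • polyCurve D r (node i * T) := by
    intro j
    simp only [hval, Finset.smul_sum]
    rw [Finset.sum_comm]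
    have h1 : ∀ k : Fin D, ∑ i, V⁻¹ j i • V i k • T ^ (k : ℕ) • r k
        = (1 : Matrix (Fin D) (Fin D) ℝ) j k • T ^ (k : ℕ) • r k := by
      intro k
      rw [← Matrix.nonsing_inv_mul V hdet, Matrix.mul_apply, Finset.sum_smul]
      exact Finset.sum_congr rfl fun i _ => smul_smul _ _ _
    simp only [h1, Matrix.one_apply, ite_smul, one_smul, zero_smul, Finset.sum_ite_eq,
      Finset.mem_univ, if_true]
  have hterm : ∀ j : Fin D, T ^ (j : ℕ) * ‖r j‖
      ≤ (∑ i, |V⁻¹ j i|) * ‖polyCurve D r (node i₀ * T)‖ := by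
    intro j
    have h1 : T ^ (j : ℕ) * ‖r j‖ = ‖T ^ (j : ℕ) • r j‖ := by
      rw [norm_smul, Real.norm_of_nonneg (pow_nonneg hT _)]
    rw [h1, hinv, Finset.sum_mul]
    refine (norm_sum_le _ _).trans (Finset.sum_le_sum fun i _ => ?_)
    rw [norm_smul, Real.norm_eq_abs]
    exact mul_le_mul_of_nonneg_left (hi₀ i) (abs_nonneg _)
  have hsum : termSum D r T ≤ B * ‖polyCurve D r (node i₀ * T)‖ := by
    rw [termSum, ← Fin.sum_univ_eq_sum_range (fun j => T ^ j * ‖r j‖) D, hB, Finset.sum_mul]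
    exact Finset.sum_le_sum fun j _ => hterm j
  have hcast : (((i₀ : ℕ) + 1 : ℕ) : ℝ) ^ K = node i₀ := by
    rw [hnode]
    push_cast
    rfl
  rw [hcast]
  refine hsum.trans ?_
  gcongr
  linarith

theorem one_add_pow_le {x : ℝ} (h0 : 0 ≤ x) (h1 : x ≤ 1) (M : ℕ) :
    (1 + x) ^ M ≤ 1 + 3 ^ M * x := by
  induction M with
  | zero => simp [h0]
  | succ M ih =>
    have h3 : (1 : ℝ) ≤ 3 ^ M := one_le_pow₀ (by norm_num)
    have h4 := mul_le_mul_of_nonneg_right ih (by linarith : 0 ≤ 1 + x)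
    rw [pow_succ, pow_succ]
    nlinarith [mul_nonneg (by linarith : (0 : ℝ) ≤ 3 ^ M) (mul_nonneg h0 (sub_nonneg.2 h1)),
      mul_nonneg (sub_nonneg.2 h3) h0]

/-- Polynomial curves vary slowly over the intervals `[n ^ K, (n + 1) ^ K]`. -/
theorem norm_polyCurve_sub_le (D : ℕ) {K : ℝ} (hK : 0 ≤ K) {M : ℕ} (hM : K * D ≤ M) (r : ℕ → F)
    {n : ℝ} (hn : 1 ≤ n) {t : ℝ} (ht : t ∈ Set.Icc (n ^ K) ((n + 1) ^ K)) :
    ‖polyCurve D r t - polyCurve D r (n ^ K)‖ ≤ 3 ^ M / n * termSum D r (n ^ K) := by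
  have hn0 : 0 < n := by linarith
  have hnK : 0 < n ^ K := Real.rpow_pos_of_pos hn0 K
  rw [polyCurve, polyCurve, ← Finset.sum_sub_distrib, termSum, Finset.mul_sum]
  refine (norm_sum_le _ _).trans (Finset.sum_le_sum fun j hj => ?_)
  have hjD : (j : ℝ) ≤ D := by exact_mod_cast (Finset.mem_range.1 hj).le
  have h1 : (n ^ K) ^ j ≤ t ^ j := by
    have := ht.1
    gcongr
  -- The endpoints of the interval have ratio `(1 + 1/n)^K`, so each monomial changes by a relative
  -- amount `O(1/n)`.
  have h2 : t ^ j ≤ (1 + 3 ^ M * (1 / n)) * (n ^ K) ^ j := by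
    have hx : (1 : ℝ) / n ≤ 1 := by rw [div_le_one hn0]; exact hn
    have hx0 : (0 : ℝ) ≤ 1 / n := by positivity
    have h3 : (n + 1) ^ K = n ^ K * (1 + 1 / n) ^ K := by
      rw [← Real.mul_rpow hn0.le (by positivity)]
      congr 1
      field_simp
    have h4 : ((1 + 1 / n) ^ K) ^ j ≤ 1 + 3 ^ M * (1 / n) := by
      refine le_trans ?_ (one_add_pow_le hx0 hx M)
      rw [← Real.rpow_natCast, ← Real.rpow_mul (by positivity), ← Real.rpow_natCast]
      refine Real.rpow_le_rpow_of_exponent_le (by linarith) (le_trans ?_ hM)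
      gcongr
    calc t ^ j ≤ ((n + 1) ^ K) ^ j := pow_le_pow_left₀ (hnK.le.trans ht.1) ht.2 j
      _ = ((1 + 1 / n) ^ K) ^ j * (n ^ K) ^ j := by rw [h3, mul_pow, mul_comm]
      _ ≤ _ := by gcongr
  rw [← sub_smul, norm_smul, Real.norm_of_nonneg (sub_nonneg.2 h1), ← mul_assoc]
  refine mul_le_mul_of_nonneg_right ?_ (norm_nonneg _)
  calc t ^ j - (n ^ K) ^ j ≤ (1 + 3 ^ M * (1 / n)) * (n ^ K) ^ j - (n ^ K) ^ j := by linarith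
    _ = _ := by ring

/-- A polynomial curve with small initial value has a slowly varying stretch on which it is small,
but not too small. -/
theorem exists_slow_time {D : ℕ} (hD : 0 < D) {K : ℝ} (hK : 1 ≤ K) {c₁ C₁ : ℝ} (hc₁ : 0 < c₁)
    (hC₁ : 0 < C₁) : ∃ C : ℝ, 1 ≤ C ∧ ∀ (r : ℕ → F) (ρ : ℝ), 0 < ρ → ρ ≤ 1 → c₁ * ρ ≤ ‖r 0‖ →
    (∀ j, ‖r j‖ ≤ C₁ * ρ) → ∃ n : ℕ, 1 ≤ n ∧ (n : ℝ) ≤ D * ρ ^ (-2 : ℝ) ∧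
      1 / 2 * ρ ^ (-(3 * (1 / (4 * (D * K))))) ≤ n ∧
      ‖polyCurve D r ((n : ℝ) ^ K)‖ ≤ C * ρ ^ (1 / (4 * (D * K))) ∧
      1 ≤ C * ρ ^ (1 / (4 * (D * K))) * (n * ‖polyCurve D r ((n : ℝ) ^ K)‖) ∧
      ∀ t ∈ Set.Icc ((n : ℝ) ^ K) (((n : ℝ) + 1) ^ K),
        ‖polyCurve D r t - polyCurve D r ((n : ℝ) ^ K)‖
          ≤ C / n * ‖polyCurve D r ((n : ℝ) ^ K)‖ := by
  obtain ⟨c, hc, htime⟩ := exists_time (F := F) hD hK hc₁ hC₁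
  obtain ⟨B, hB, hvan⟩ := exists_termSum_le (F := F) D hD (K := K) (by linarith)
  have hD1 : (1 : ℝ) ≤ D := by exact_mod_cast hD
  obtain ⟨κ, hκ⟩ : ∃ κ : ℝ, κ = 1 / (4 * (D * K)) := ⟨_, rfl⟩
  have hκ0 : 0 < κ := by rw [hκ]; positivity
  rw [← hκ] at htime ⊢
  obtain ⟨Q, hQ⟩ : ∃ Q : ℝ, Q = ((D : ℝ) ^ K) ^ D := ⟨_, rfl⟩
  have hQ0 : 0 < Q := by rw [hQ]; positivity
  obtain ⟨M, hM⟩ := exists_nat_ge (K * D)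
  refine ⟨1 + Q * (D * C₁) + B * c⁻¹ + 3 ^ M * Q * B,
    by linarith [show 0 ≤ Q * (D * C₁) + B * c⁻¹ + 3 ^ M * Q * B by positivity], ?_⟩
  intro r ρ hρ hρ1 h0 hr
  obtain ⟨n₀, hn₀, hle, hge, hsmall, hlarge⟩ := htime r ρ hρ hρ1 h0 hr
  -- At time `n₀^K` the terms may cancel. Passing to `n = i n₀` with `i ≤ D` makes the value
  -- comparable to the sum of its terms, while `n` and that sum grow at most by constant factors.
  obtain ⟨i, hi1, hiD, hi⟩ := hvan r ((n₀ : ℝ) ^ K) (by positivity)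
  have hiR : (1 : ℝ) ≤ i := by exact_mod_cast hi1
  have hiDR : (i : ℝ) ≤ D := by exact_mod_cast hiD
  have hnR : (1 : ℝ) ≤ n₀ := by exact_mod_cast hn₀
  have hn1 : 1 ≤ i * n₀ := Nat.mul_pos hi1 hn₀
  have hpow : (((i * n₀ : ℕ) : ℝ)) ^ K = (i : ℝ) ^ K * (n₀ : ℝ) ^ K := by
    rw [Nat.cast_mul, Real.mul_rpow (by linarith) (by linarith)]
  have hle' : (n₀ : ℝ) ≤ ((i * n₀ : ℕ) : ℝ) := by
    rw [Nat.cast_mul]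
    nlinarith
  rw [← hpow] at hi
  have hS : termSum D r (((i * n₀ : ℕ) : ℝ) ^ K) ≤ Q * termSum D r ((n₀ : ℝ) ^ K) := by
    rw [hpow, hQ]
    refine (termSum_mul_le D r (Real.one_le_rpow hiR (by linarith)) (by positivity)).trans ?_
    have h1 : (i : ℝ) ^ K ≤ (D : ℝ) ^ K := Real.rpow_le_rpow (by linarith) hiDR (by linarith)
    have h2 := termSum_nonneg D r (T := (n₀ : ℝ) ^ K) (by positivity)
    gcongr
  obtain ⟨n, hn⟩ : ∃ n, n = i * n₀ := ⟨_, rfl⟩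
  rw [← hn] at hn1 hle' hi hS
  have hnR' : (1 : ℝ) ≤ n := by exact_mod_cast hn1
  obtain ⟨p, hp⟩ : ∃ p, p = ‖polyCurve D r ((n : ℝ) ^ K)‖ := ⟨_, rfl⟩
  have hp0 : 0 ≤ p := hp ▸ norm_nonneg _
  have hT0 := termSum_nonneg D r (T := (n₀ : ℝ) ^ K) (by positivity)
  have hρκ : 0 < ρ ^ κ := Real.rpow_pos_of_pos hρ κ
  refine ⟨n, hn1, ?_, hge.trans hle', ?_, ?_, fun t ht => ?_⟩
  · rw [hn, Nat.cast_mul]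
    exact mul_le_mul hiDR hle (by linarith) (by linarith)
  · refine (norm_polyCurve_le D r (by positivity)).trans (hS.trans ?_)
    calc Q * termSum D r ((n₀ : ℝ) ^ K) ≤ Q * (D * C₁ * ρ ^ κ) := by gcongr
      _ = Q * (D * C₁) * ρ ^ κ := by ring
      _ ≤ _ := by
        gcongr
        linarith [show 0 ≤ B * c⁻¹ + 3 ^ M * Q * B by positivity]
  · rw [← hp] at hi ⊢
    have h1 : c * ρ ^ (-(2 * κ)) ≤ B * (n * p) := by
      calc _ ≤ n₀ * termSum D r ((n₀ : ℝ) ^ K) := hlarge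
        _ ≤ n * (B * p) := mul_le_mul hle' hi hT0 (by linarith)
        _ = _ := by ring
    have h2 : 1 ≤ ρ ^ κ * ρ ^ (-(2 * κ)) := by
      rw [← Real.rpow_add hρ]
      exact Real.one_le_rpow_of_pos_of_le_one_of_nonpos hρ hρ1 (by linarith)
    calc (1 : ℝ) ≤ ρ ^ κ * ρ ^ (-(2 * κ)) := h2
      _ = c⁻¹ * ρ ^ κ * (c * ρ ^ (-(2 * κ))) := by field_simp
      _ ≤ c⁻¹ * ρ ^ κ * (B * (n * p)) := by gcongr
      _ = B * c⁻¹ * ρ ^ κ * (n * p) := by ring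
      _ ≤ _ := by
        gcongr
        linarith [show 0 ≤ Q * (D * C₁) + 3 ^ M * Q * B by positivity]
  · refine (norm_polyCurve_sub_le D (by linarith) hM r hnR' ht).trans ?_
    rw [← hp] at hi ⊢
    calc 3 ^ M / n * termSum D r ((n : ℝ) ^ K) ≤ 3 ^ M / n * (Q * (B * p)) := by
          gcongr
          exact hS.trans (by gcongr)
      _ = 3 ^ M * Q * B / n * p := by ring
      _ ≤ _ := by
        gcongr
        linarith [show 0 ≤ Q * (D * C₁) + B * c⁻¹ by positivity]

end PolynomialCurve

end EffEqui

/-! ### Unipotency of the flow and the polynomial form of the displacement. -/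

namespace EffEqui.QGroup

open scoped ContDiff ENNReal NNReal
open Filter Topology MeasureTheory

variable {N : ℕ} {GG : QGroup N} {Γ : Subgroup (SL N ℤ)}

theorem charpoly_mul_mul_inv (g a : GG.points ℝ) :
    ((g * a * g⁻¹ : GG.points ℝ) : SL N ℝ).1.charpoly = (a : SL N ℝ).1.charpoly := by
  have h1 : ((g * a * g⁻¹ : GG.points ℝ) : SL N ℝ).1
      = (g : SL N ℝ).1 * (a : SL N ℝ).1 * ((g : SL N ℝ)⁻¹).1 := rfl
  have h2 : ((g : SL N ℝ)⁻¹).1 * (g : SL N ℝ).1 = 1 := by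
    rw [← Matrix.SpecialLinearGroup.coe_mul, inv_mul_cancel]
    rfl
  rw [h1, mul_assoc, Matrix.charpoly_mul_comm, mul_assoc, h2, mul_one]

/-- Conjugation by `diag(√2, 1/√2)` doubles the upper right entry, as squaring does. -/
theorem exists_mul_self_eq_conj {a : SL 2 ℝ} (h00 : a.1 0 0 = 1) (h10 : a.1 1 0 = 0)
    (h11 : a.1 1 1 = 1) : ∃ g : SL 2 ℝ, a * a = g * a * g⁻¹ := by
  have h2 : √(2 : ℝ) ≠ 0 := by positivity
  have hsq : √(2 : ℝ) * √2 = 2 := Real.mul_self_sqrt (by norm_num)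
  obtain ⟨g, hg⟩ : ∃ g : SL 2 ℝ, g.1 = !![√2, 0; 0, (√2)⁻¹] :=
    ⟨⟨_, by simp [Matrix.det_fin_two, h2]⟩, rfl⟩
  refine ⟨g, ?_⟩
  rw [eq_mul_inv_iff_mul_eq]
  ext i j
  fin_cases i <;> fin_cases j <;>
    simp [Matrix.mul_apply, Fin.sum_univ_two, hg, h00, h10, h11]
  field_simp
  rw [sq, hsq]
  ring

/-- By the conjugacy in `SL₂`, `exp(sz)` is conjugate to `exp((s/2)z)`. The characteristic
polynomial is therefore unchanged by halving the time, and by continuity equals the one at time `0`.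
How the homomorphism parametrizes the one-parameter group plays no role. -/
theorem IsUnipotentDirection.charpoly_exp {E : EuclideanNorm N} {h : LieSubalgebra ℝ GG.lie}
    {z : GG.lie} (hz : IsUnipotentDirection E h z) (t : ℝ) :
    (exp (t • z) : SL N ℝ).1.charpoly = (1 : Matrix (Fin N) (Fin N) ℝ).charpoly := by
  obtain ⟨-, φ, -, -, -, hrange⟩ := hz
  refine Polynomial.funext fun x => ?_
  set F : ℝ → ℝ := fun s => (exp (s • z) : SL N ℝ).1.charpoly.eval x with hF
  have hhalf : ∀ s, F s = F (s / 2) := by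
    intro s
    obtain ⟨a, ⟨h00, h10, h11⟩, ha⟩ : exp ((s / 2) • z) ∈ φ '' {a : SL 2 ℝ | a.1 0 0 = 1 ∧
        a.1 1 0 = 0 ∧ a.1 1 1 = 1} := hrange ▸ ⟨s / 2, rfl⟩
    obtain ⟨g, hg⟩ := exists_mul_self_eq_conj h00 h10 h11
    have h1 : exp (s • z) = φ g * exp ((s / 2) • z) * (φ g)⁻¹ := by
      rw [← add_halves s, exp_add_smul, add_halves, ← ha, ← map_mul, hg, map_mul, map_mul, map_inv]
    rw [hF]
    dsimp only
    rw [h1, charpoly_mul_mul_inv]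
  have hpow : ∀ k : ℕ, F t = F (t / 2 ^ k) := by
    intro k
    induction k with
    | zero => simp
    | succ k ih => rw [ih, hhalf, pow_succ, div_div]
  have hcont : Continuous F := by
    have h1 : Continuous fun s : ℝ => (exp (s • z) : SL N ℝ).1 :=
      continuous_emb_symm.comp (continuous_mat.comp (continuous_exp_smul z))
    simp only [hF, Matrix.eval_charpoly]
    exact (continuous_const.sub h1).matrix_det
  have hlim : Tendsto (fun k : ℕ => t / (2 : ℝ) ^ k) atTop (𝓝 0) := by
    have := (tendsto_pow_atTop_nhds_zero_of_lt_one (r := (1 / 2 : ℝ)) (by norm_num)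
      (by norm_num)).const_mul t
    simpa [div_eq_mul_inv] using this
  have h2 := (hcont.tendsto 0).comp hlim
  have h3 : F ∘ (fun k : ℕ => t / (2 : ℝ) ^ k) = fun _ => F t := by
    funext k
    exact (hpow k).symm
  rw [h3] at h2
  have h4 : F t = F 0 := tendsto_nhds_unique tendsto_const_nhds h2
  have h5 : F 0 = (1 : Matrix (Fin N) (Fin N) ℝ).charpoly.eval x := by
    rw [hF]
    dsimp only
    rw [zero_smul, exp_zero]
    rfl
  rw [← h5, ← h4]

/-- By Cayley–Hamilton `(exp(tz) - 1)^N = 0`. Dividing by `t^N` and letting `t → 0` turns the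
difference quotient into `z`. -/
theorem IsUnipotentDirection.pow_eq_zero {E : EuclideanNorm N} {h : LieSubalgebra ℝ GG.lie}
    {z : GG.lie} (hz : IsUnipotentDirection E h z) : emb N z ^ N = 0 := by
  have h1 : ∀ t : ℝ, (NormedSpace.exp (t • emb N z) - 1) ^ N = 0 := by
    intro t
    have h2 := Matrix.aeval_self_charpoly (exp (t • z) : SL N ℝ).1
    rw [hz.charpoly_exp, Matrix.charpoly_one] at h2
    have h3 := congrArg (emb N) h2
    have h4 : emb N (exp (t • z) : SL N ℝ).1 = NormedSpace.exp (t • emb N z) := by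
      rw [← emb_coe_smul]
      exact mat_exp _
    simpa [h4] using h3
  have h2 : HasDerivAt (fun t : ℝ => NormedSpace.exp (t • emb N z)) (emb N z) 0 := by
    have := hasDerivAt_exp_smul_const (𝕂 := ℝ) (emb N z : EndN N) 0
    simpa using this
  have h3 := (h2.tendsto_slope_zero).pow N
  have h4 : ∀ t : ℝ, (t⁻¹ • (NormedSpace.exp ((0 + t) • emb N z)
      - NormedSpace.exp ((0 : ℝ) • emb N z))) ^ N = 0 := by
    intro t
    have := h1 t
    rw [zero_add, zero_smul, NormedSpace.exp_zero, smul_pow, this, smul_zero]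
  simp only [h4] at h3
  exact (tendsto_nhds_unique tendsto_const_nhds h3).symm

theorem IsUnipotentDirection.exp_smul_mem {E : EuclideanNorm N} {h : LieSubalgebra ℝ GG.lie}
    {z : GG.lie} (hz : IsUnipotentDirection E h z) (t : ℝ) :
    exp (t • z) ∈ connectedSubgroup h := by
  obtain ⟨-, φ, -, hφ, -, hrange⟩ := hz
  obtain ⟨a, -, ha⟩ : exp (t • z) ∈ φ '' {a : SL 2 ℝ | a.1 0 0 = 1 ∧
    a.1 1 0 = 0 ∧ a.1 1 1 = 1} := hrange ▸ ⟨t, rfl⟩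
  exact ha ▸ hφ a

theorem exp_eq_sum_of_pow_eq_zero {X : EndN N} (hX : X ^ N = 0) (t : ℝ) :
    NormedSpace.exp (t • X) = ∑ k ∈ Finset.range N, (t ^ k * ((k.factorial : ℝ))⁻¹) • X ^ k := by
  rw [NormedSpace.exp_eq_tsum ℝ]
  dsimp only
  rw [tsum_eq_sum (s := Finset.range N)]
  · refine Finset.sum_congr rfl fun k _ => ?_
    rw [smul_pow, smul_smul, mul_comm]
  · intro k hk
    rw [smul_pow, pow_eq_zero_of_le (by simpa using hk) hX, smul_zero, smul_zero]

/-- The coefficients of the polynomial curve `exp(-tX) V exp(tX)` for nilpotent `X`. -/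
noncomputable def conjCoeff (X V : EndN N) (j : ℕ) : EndN N :=
  ∑ p ∈ Finset.range N ×ˢ Finset.range N, if p.1 + p.2 = j then
    ((-1) ^ p.1 * ((p.1.factorial : ℝ))⁻¹ * ((p.2.factorial : ℝ))⁻¹) • (X ^ p.1 * V * X ^ p.2) else 0

/-- Both exponentials are polynomials of degree below `N`. The count `2N + 1` of coefficients is
generous, and positive also for `N = 0`. -/
theorem polyCurve_conjCoeff {X : EndN N} (hX : X ^ N = 0) (V : EndN N) (t : ℝ) :
    polyCurve (2 * N + 1) (conjCoeff X V) t
      = NormedSpace.exp (-(t • X)) * V * NormedSpace.exp (t • X) := by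
  rw [← neg_smul, exp_eq_sum_of_pow_eq_zero hX, exp_eq_sum_of_pow_eq_zero hX, Finset.sum_mul,
    Finset.sum_mul_sum, ← Finset.sum_product', polyCurve]
  simp only [conjCoeff, Finset.smul_sum]
  rw [Finset.sum_comm]
  refine Finset.sum_congr rfl fun p hp => ?_
  rw [Finset.mem_product, Finset.mem_range, Finset.mem_range] at hp
  simp only [smul_ite, smul_zero]
  rw [Finset.sum_ite_eq, if_pos (Finset.mem_range.2 (by omega)), smul_smul, smul_mul_assoc,
    smul_mul_smul_comm]
  congr 1
  rw [neg_pow, pow_add]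
  ring

theorem conjCoeff_zero {X : EndN N} (hX : X ^ N = 0) (V : EndN N) : conjCoeff X V 0 = V := by
  have h := polyCurve_conjCoeff hX V 0
  rw [zero_smul, neg_zero, NormedSpace.exp_zero, one_mul, mul_one, polyCurve,
    Finset.sum_range_succ'] at h
  simpa using h

theorem exists_norm_conjCoeff_le (X : EndN N) : ∃ C : ℝ, 0 < C ∧ ∀ (V : EndN N) (j : ℕ),
    ‖conjCoeff X V j‖ ≤ C * ‖V‖ := by
  refine ⟨∑ p ∈ Finset.range N ×ˢ Finset.range N, ‖X ^ p.1‖ * ‖X ^ p.2‖ + 1, by positivity,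
    fun V j => ?_⟩
  refine (norm_sum_le _ _).trans ?_
  rw [add_mul, Finset.sum_mul]
  refine le_add_of_le_of_nonneg (Finset.sum_le_sum fun p _ => ?_) (by positivity)
  split_ifs
  · rw [norm_smul, norm_mul, norm_mul, norm_pow, norm_neg, norm_one, one_pow, one_mul, norm_inv,
      norm_inv, Real.norm_natCast, Real.norm_natCast]
    have h1 : ∀ k : ℕ, ((k.factorial : ℝ))⁻¹ ≤ 1 := fun k =>
      inv_le_one_of_one_le₀ (by exact_mod_cast Nat.one_le_iff_ne_zero.2 k.factorial_ne_zero)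
    have h2 : ((p.1.factorial : ℝ))⁻¹ * ((p.2.factorial : ℝ))⁻¹ ≤ 1 :=
      mul_le_one₀ (h1 _) (by positivity) (h1 _)
    refine (mul_le_of_le_one_left (norm_nonneg _) h2).trans ?_
    calc ‖X ^ p.1 * V * X ^ p.2‖ ≤ ‖X ^ p.1‖ * ‖V‖ * ‖X ^ p.2‖ :=
          (norm_mul_le _ _).trans (by gcongr; exact norm_mul_le _ _)
      _ = _ := by ring
  · rw [norm_zero]
    positivity

theorem IsUnipotentDirection.polyCurve_eq {E : EuclideanNorm N} {h : LieSubalgebra ℝ GG.lie}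
    {z : GG.lie} (hz : IsUnipotentDirection E h z) (v : GG.lie) (t : ℝ) :
    polyCurve (2 * N + 1) (conjCoeff (emb N z) (emb N v)) t
      = emb N (Ad (exp (t • z))⁻¹ v) := by
  rw [polyCurve_conjCoeff hz.pow_eq_zero, emb_Ad, inv_inv, ← exp_neg, mat_exp, mat_exp,
    emb_coe_smul, ← neg_smul, ← neg_smul, emb_coe_smul]

/-- Every measure is almost invariant with a constant that depends only on the Sobolev norm. -/
theorem IsInvariantMeasure.exists_trivial_almostInvariant (E : EuclideanNorm N)
    (b : Module.Basis (Fin (Module.finrank ℝ GG.lie)) ℝ GG.lie) {m : Measure (GG.Space Γ)}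
    (hm : IsInvariantMeasure m) (hss : LieAlgebra.IsSemisimple ℝ GG.lie) {d : ℕ}
    (hd : Module.finrank ℝ GG.lie ≤ d) : ∃ C : ℝ, 0 < C ∧ ∀ (μ : Measure (GG.Space Γ))
      [IsProbabilityMeasure μ] (Z : GG.lie), LieAlmostInvariant (sobolev E b m d) μ C Z := by
  obtain ⟨C, hC, hsup⟩ := hm.exists_abs_le_sobolev E b hss hd
  refine ⟨2 * C, by positivity, fun μ _ Z t _ f hf => ?_⟩
  have h1 := abs_integral_act_sub_le (μ := μ) hf (exp (t • Z)) 1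
    (B := 2 * C * sobolev E b m d f) fun x => by
      have e1 := hsup f hf (act x (exp (t • Z)))
      have e2 := hsup f hf (act x 1)
      rw [abs_le] at e1 e2 ⊢
      constructor <;> linarith [e1.1, e1.2, e2.1, e2.2]
  simpa only [act_one] using h1

end EffEqui.QGroup

/-! ### Additional almost invariance from two generic points. -/

namespace EffEqui.QGroup

open scoped ContDiff ENNReal NNReal
open Filter Topology MeasureTheory

variable {N : ℕ} {GG : QGroup N} {Γ : Subgroup (SL N ℤ)}

theorem finrank_lie_le (GG : QGroup N) : Module.finrank ℝ GG.lie ≤ N * N := by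
  have h := Submodule.finrank_le GG.lie.toSubmodule
  rw [Module.finrank_matrix, Fintype.card_fin, Module.finrank_self, mul_one] at h
  exact h

theorem LieAlmostInvariant.mono {S : (GG.Space Γ → ℝ) → ℝ} (hS : ∀ f, 0 ≤ S f)
    {μ : Measure (GG.Space Γ)} {a c : ℝ} {Z : GG.lie} (h : LieAlmostInvariant S μ a Z)
    (hac : a ≤ c) : LieAlmostInvariant S μ c Z :=
  fun t ht f hf => (h t ht f hf).trans (mul_le_mul_of_nonneg_right hac (hS f))

/-- The case outside the window. If `n < k`, then `k ≥ ρ^(-3κ)/2`. Otherwise `ε⁻¹ < D ρ⁻²`, whereas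
`ε⁻¹ ≥ ρ⁻⁴`, so `ρ` is bounded below. Either way `k ρ^κ` is at least a constant. -/
theorem one_le_mul_rpow {D k ε ρ κ n : ℝ} (hD1 : 1 ≤ D) (hk₀ : 1 ≤ k) (hε : 0 < ε) (hρ : 0 < ρ)
    (hεv : ε ^ (1 / 4 : ℝ) ≤ ρ) (hρ1 : ρ ≤ 1) (hκ0 : 0 < κ) (hκ1 : κ ≤ 1)
    (hnge : 1 / 2 * ρ ^ (-(3 * κ)) ≤ n) (hcase : ¬ (k ≤ n ∧ D * ρ ^ (-2 : ℝ) ≤ ε⁻¹)) :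
    1 ≤ 2 * D * (k * ρ ^ κ) := by
  have hρκ : 0 < ρ ^ κ := Real.rpow_pos_of_pos hρ κ
  by_cases hk : k ≤ n
  · have h2 : ε⁻¹ < D * ρ ^ (-2 : ℝ) := not_le.1 fun h => hcase ⟨hk, h⟩
    have h3 : ε ≤ ρ ^ 4 := by
      have h4 := pow_le_pow_left₀ (by positivity) hεv 4
      rw [← Real.rpow_natCast, ← Real.rpow_mul hε.le] at h4
      norm_num at h4
      exact h4
    have h5 : ρ ^ (-2 : ℝ) = (ρ ^ 2)⁻¹ := by
      rw [Real.rpow_neg hρ.le]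
      norm_num
    have h6 : 1 ≤ D * ρ ^ 2 := by
      have h7 : (ρ ^ 4)⁻¹ ≤ D * (ρ ^ 2)⁻¹ := by
        rw [← h5]
        exact (inv_anti₀ hε h3).trans h2.le
      have h8 := mul_le_mul_of_nonneg_right h7 (show 0 ≤ ρ ^ 4 by positivity)
      rw [inv_mul_cancel₀ (by positivity)] at h8
      refine h8.trans_eq ?_
      field_simp
    have h9 : ρ ^ 2 ≤ ρ ^ κ := by
      rw [← Real.rpow_natCast]
      exact Real.rpow_le_rpow_of_exponent_ge hρ hρ1 (by norm_num; linarith)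
    have h10 : D * ρ ^ 2 ≤ D * ρ ^ κ := by gcongr
    have h11 : ρ ^ κ ≤ k * ρ ^ κ := le_mul_of_one_le_left hρκ.le hk₀
    nlinarith
  · rw [not_le] at hk
    have h2 : 1 ≤ ρ ^ (-(3 * κ)) * ρ ^ κ := by
      rw [← Real.rpow_add hρ]
      exact Real.one_le_rpow_of_pos_of_le_one_of_nonpos hρ hρ1 (by linarith)
    have h3 : 1 / 2 * ρ ^ (-(3 * κ)) * ρ ^ κ ≤ k * ρ ^ κ :=
      mul_le_mul_of_nonneg_right (hnge.trans hk.le) hρκ.le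
    nlinarith

/-- Two generic points that differ by a small displacement produce additional almost invariance,
in a direction conjugate to that of the displacement. -/
theorem IsInvariantMeasure.exists_additional_invariance (E : EuclideanNorm N)
    (b : Module.Basis (Fin (Module.finrank ℝ GG.lie)) ℝ GG.lie) {m : Measure (GG.Space Γ)}
    (hm : IsInvariantMeasure m) (hss : LieAlgebra.IsSemisimple ℝ GG.lie) {d : ℕ}
    (hd : Module.finrank ℝ GG.lie + 1 ≤ d) {h : LieSubalgebra ℝ GG.lie} {z : GG.lie}
    (hz : IsUnipotentDirection E h z) {K : ℝ} (hK : 1 ≤ K) : ∃ C : ℝ, 0 < C ∧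
    ∀ (k₀ ε : ℝ), 1 ≤ k₀ → 0 < ε → ∀ (μ : Measure (GG.Space Γ)) [IsProbabilityMeasure μ]
      (x : GG.Space Γ) (v : GG.lie), ε ^ (1 / 4 : ℝ) ≤ E.norm v → E.norm v ≤ 1 →
      IsGeneric K z (sobolev E b m d) μ k₀ ε⁻¹ x →
      IsGeneric K z (sobolev E b m d) μ k₀ ε⁻¹ (act x (exp v)) →
      ∃ (g : GG.points ℝ) (c : ℝ), g ∈ connectedSubgroup h ∧ E.norm (c • Ad g v : GG.lie) = 1 ∧
        LieAlmostInvariant (sobolev E b m d) μ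
          (C * k₀ * E.norm v ^ (1 / (4 * (((2 * N + 1 : ℕ) : ℝ) * K)))) (c • Ad g v) := by
  have hD : 0 < 2 * N + 1 := by omega
  have hratio := one_le_ratio E
  obtain ⟨C₁, hC₁, hcoeff⟩ := exists_norm_conjCoeff_le (emb N z)
  obtain ⟨Cs, hCs, hslow⟩ := exists_slow_time (F := EndN N) hD hK
    (c₁ := E.ratio⁻¹) (C₁ := C₁ * E.ratio) (by positivity) (by positivity)
  obtain ⟨D, hDdef⟩ : ∃ D : ℝ, D = ((2 * N + 1 : ℕ) : ℝ) := ⟨_, rfl⟩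
  have hD1 : 1 ≤ D := by
    rw [hDdef]
    exact_mod_cast hD
  obtain ⟨κ, hκ⟩ : ∃ κ : ℝ, κ = 1 / (4 * (D * K)) := ⟨_, rfl⟩
  have hDK : 1 ≤ D * K := by nlinarith
  have hκ0 : 0 < κ := by rw [hκ]; positivity
  have hκ1 : κ ≤ 1 := by
    rw [hκ, div_le_one (by positivity)]
    linarith
  -- `(1 + Cs) * Cs` bounds the displacement on the whole stretch: at most `Cs` at time `n^K`, plus
  -- a variation of at most `Cs * Cs`.
  obtain ⟨Ca, hCa, halmost⟩ := hm.exists_almostInvariant E b hss hd ((1 + Cs) * Cs)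
  obtain ⟨Cl, hCl, hlie⟩ := hm.exists_lieAlmostInvariant E b hss hd ((1 + Cs) * Cs)
  obtain ⟨Ct, hCt, htriv⟩ := hm.exists_trivial_almostInvariant E b hss
    (show Module.finrank ℝ GG.lie ≤ d by omega)
  obtain ⟨B, hB⟩ : ∃ B : ℝ, B = Cl * ((Ca * (1 + Cs * Cs)) * (E.ratio * Cs) + E.ratio * Cs) :=
    ⟨_, rfl⟩
  have hB0 : 0 < B := by rw [hB]; positivity
  refine ⟨B + 2 * D * Ct, by positivity, ?_⟩
  intro k₀ ε hk₀ hε μ _ x v hεv hv1 hx₁ hx₂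
  obtain ⟨ρ, hρdef⟩ : ∃ ρ, ρ = E.norm (v : Matrix (Fin N) (Fin N) ℝ) := ⟨_, rfl⟩
  have hρ : 0 < ρ := hρdef ▸ (Real.rpow_pos_of_pos hε _).trans_le hεv
  have hρ1 : ρ ≤ 1 := hρdef ▸ hv1
  rw [← hDdef] at hslow ⊢
  rw [← hκ] at hslow ⊢
  have hρκ : 0 < ρ ^ κ := Real.rpow_pos_of_pos hρ κ
  have hρκ1 : ρ ^ κ ≤ 1 := Real.rpow_le_one hρ.le hρ1 hκ0.le
  have hS := sobolev_nonneg E b m d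
  obtain ⟨n, hn1, hnle, hnge, hsmall, hlarge, hvar⟩ := hslow (conjCoeff (emb N z) (emb N v)) ρ hρ
    hρ1 (by
      rw [conjCoeff_zero hz.pow_eq_zero, inv_mul_le_iff₀ (by positivity), hρdef]
      exact norm_le_ratio E _) (fun j => by
      refine (hcoeff _ j).trans ?_
      rw [mul_assoc, hρdef]
      exact mul_le_mul_of_nonneg_left (norm_emb_le_ratio E _) hC₁.le)
  simp only [hz.polyCurve_eq] at hsmall hlarge hvar
  have hnR : (1 : ℝ) ≤ n := by exact_mod_cast hn1
  rw [← hρdef]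
  -- The second condition gives `n ≤ ε⁻¹`, so genericity applies at `n`. If either fails, the
  -- asserted error exceeds the trivial one and the direction of `v` itself will do.
  by_cases hcase : k₀ ≤ n ∧ D * ρ ^ (-2 : ℝ) ≤ ε⁻¹
  · obtain ⟨g, hg⟩ : ∃ g, g = (exp (((n : ℝ) ^ K) • z))⁻¹ := ⟨_, rfl⟩
    rw [← hg] at hsmall hlarge hvar
    obtain ⟨p, hp⟩ : ∃ p, p = ‖emb N (Ad g v)‖ := ⟨_, rfl⟩
    rw [← hp] at hsmall hlarge hvar
    have hp0 : 0 < p := by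
      rcases (show 0 ≤ p from hp ▸ norm_nonneg _).lt_or_eq with h0 | h0
      · exact h0
      · rw [← h0] at hlarge
        norm_num at hlarge
    have hpCs : p ≤ Cs := hsmall.trans (mul_le_of_le_one_right (by linarith) hρκ1)
    have hCsn : Cs / n ≤ Cs := div_le_self (by linarith) hnR
    have hR1 : ‖emb N (Ad g v)‖ ≤ (1 + Cs) * Cs := by
      rw [← hp]
      nlinarith
    have hinv := halmost μ K hK z v (Ad g v) x n (Cs / n * p) hnR hR1
      (fun t ht => ⟨by
        have h1 := hvar t ht
        have h2 := norm_add_le (emb N (Ad (exp (t • z))⁻¹ v) - emb N (Ad g v)) (emb N (Ad g v))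
        rw [sub_add_cancel, ← hp] at h2
        have h3 : Cs / n * p ≤ Cs * Cs := mul_le_mul hCsn hpCs hp0.le (by linarith)
        linarith, hvar t ht⟩)
      (by simpa using hx₁ n (by exact_mod_cast hcase.1) (by exact_mod_cast hnle.trans hcase.2))
      (by simpa using hx₂ n (by exact_mod_cast hcase.1) (by exact_mod_cast hnle.trans hcase.2))
    obtain ⟨δ, hδ⟩ : ∃ δ, δ = E.norm (Ad g v : Matrix (Fin N) (Fin N) ℝ) := ⟨_, rfl⟩
    have hpδ : p ≤ E.ratio * δ := by
      rw [hp, hδ]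
      exact norm_emb_le_ratio E _
    have hδp : δ ≤ E.ratio * p := by
      rw [hp, hδ]
      exact norm_le_ratio E _
    have hδ0 : 0 < δ := by
      by_contra h0
      nlinarith
    have hn0 : (0 : ℝ) < n := by linarith
    refine ⟨g, δ⁻¹, hg ▸ inv_mem (hz.exp_smul_mem _), ?_, (hlie μ (Ad g v) _ δ hR1 hδ0 hδ
      (by positivity) hinv).mono hS ?_⟩
    · have h1 : ((δ⁻¹ • Ad g v : GG.lie) : Matrix (Fin N) (Fin N) ℝ)
          = δ⁻¹ • (Ad g v : Matrix (Fin N) (Fin N) ℝ) := rfl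
      rw [h1, E.norm_smul, ← hδ, abs_of_pos (inv_pos.2 hδ0), inv_mul_cancel₀ hδ0.ne']
    · have h1 : 1 / n + Cs / n * p ≤ (1 + Cs * Cs) * (1 / n) := by
        rw [div_mul_eq_mul_div, add_mul, one_mul, mul_one_div]
        gcongr
      -- The two errors of the iteration, `1/(nδ)` and `δ`, are balanced: the lower bound for `n`
      -- times the displacement controls the first, and its smallness the second.
      have h2 : 1 / (n : ℝ) / δ ≤ E.ratio * Cs * ρ ^ κ := by
        rw [div_div, div_le_iff₀ (by positivity)]
        calc (1 : ℝ) ≤ Cs * ρ ^ κ * (n * p) := hlarge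
          _ ≤ Cs * ρ ^ κ * (n * (E.ratio * δ)) := by gcongr
          _ = _ := by ring
      have h3 : δ ≤ E.ratio * Cs * ρ ^ κ := by
        rw [mul_assoc]
        exact hδp.trans (by gcongr)
      have h4 : Ca * (1 / n + Cs / n * p) / δ
          ≤ Ca * (1 + Cs * Cs) * (E.ratio * Cs * ρ ^ κ) := by
        calc _ ≤ Ca * ((1 + Cs * Cs) * (1 / n)) / δ := by gcongr
          _ = Ca * (1 + Cs * Cs) * (1 / n / δ) := by ring
          _ ≤ _ := by gcongr
      calc Cl * (Ca * (1 / n + Cs / n * p) / δ + δ)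
          ≤ Cl * (Ca * (1 + Cs * Cs) * (E.ratio * Cs * ρ ^ κ) + E.ratio * Cs * ρ ^ κ) := by gcongr
        _ = B * 1 * ρ ^ κ := by rw [hB]; ring
        _ ≤ (B + 2 * D * Ct) * k₀ * ρ ^ κ := by
          gcongr
          linarith [show 0 ≤ 2 * D * Ct by positivity]
  · refine ⟨1, ρ⁻¹, one_mem _, ?_, (htriv μ _).mono hS ?_⟩
    · have h1 : ((ρ⁻¹ • Ad 1 v : GG.lie) : Matrix (Fin N) (Fin N) ℝ)
          = ρ⁻¹ • (v : Matrix (Fin N) (Fin N) ℝ) := by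
        rw [Ad_one]
        rfl
      rw [h1, E.norm_smul, ← hρdef, abs_of_pos (inv_pos.2 hρ), inv_mul_cancel₀ hρ.ne']
    · have h1 : 1 ≤ 2 * D * (k₀ * ρ ^ κ) := by
        exact one_le_mul_rpow hD1 hk₀ hε hρ (hρdef ▸ hεv) hρ1 hκ0 hκ1 hnge hcase
      calc Ct = Ct * 1 := (mul_one _).symm
        _ ≤ Ct * (2 * D * (k₀ * ρ ^ κ)) := by gcongr
        _ ≤ Ct * (2 * D * (k₀ * ρ ^ κ)) + B * (k₀ * ρ ^ κ) := by
          linarith [show 0 ≤ B * (k₀ * ρ ^ κ) by positivity]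
        _ = _ := by ring

end EffEqui.QGroup

/-! ### The proposition. -/

open EffEqui EffEqui.QGroup MeasureTheory in
theorem proposition5p1 (N : ℕ) (pG : ℝ) (hpG : 1 < pG) :
    ∃ (d₀ : ℕ) (A κ : ℝ), 0 < A ∧ 0 < κ ∧
    ∀ (GG : QGroup N), GG.IsConnected → LieAlgebra.IsSemisimple ℝ GG.lie →
    ∀ (Γ : Subgroup (SL N ℤ)), GG.IsCongruence Γ →
    ∀ (E : EuclideanNorm N)
      (b : Module.Basis (Fin (Module.finrank ℝ GG.lie)) ℝ GG.lie), IsOrthonormal E b →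
    ∀ (m : Measure (GG.Space Γ)), IsInvariantMeasure m →
    ∀ (h : LieSubalgebra ℝ GG.lie), LieAlgebra.IsSemisimple ℝ h →
      NoCompactFactors (connectedSubgroup h) →
    ∀ (z : GG.lie), IsUnipotentDirection E h z →
    ∀ (κ₁ : ℝ), 0 < κ₁ →
    ∀ (d : ℕ), d₀ + 1 ≤ d →
    ∃ C : ℝ, 0 < C ∧
    ∀ (k₀ ε : ℝ), 1 ≤ k₀ → 0 < ε →
    ∀ (μ : Measure (GG.Space Γ)), IsPeriodicOrbitMeasure (connectedSubgroup h) μ →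
    ∀ (s : LieSubalgebra ℝ GG.lie), h ≤ s →
      SubalgebraAlmostInvariant E (sobolev E b m d) μ ε s →
    ∀ (r : Submodule ℝ GG.lie),
      IsUndistortedComplement E κ₁ (connectedSubgroup h) s.toSubmodule r →
    ∀ (x₁ x₂ : GG.Space Γ) (v : GG.lie), v ∈ r → x₂ = act x₁ (QGroup.exp v) →
      ε ^ (1 / 4 : ℝ) ≤ E.norm v → E.norm v ≤ 1 →
      IsGeneric (20 * (pG + 1)) z (sobolev E b m d) μ k₀ ε⁻¹ x₁ →
      IsGeneric (20 * (pG + 1)) z (sobolev E b m d) μ k₀ ε⁻¹ x₂ →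
    ∃ Z ∈ r, E.norm Z = 1 ∧
      LieAlmostInvariant (sobolev E b m d) μ (C * k₀ ^ A * E.norm v ^ κ) Z := by
  -- `N²` bounds `dim 𝔤`, and the Lipschitz bound needs degree `dim 𝔤 + 1`. The dependence on `k₀`
  -- is linear. In `κ`, `2N + 1` counts the coefficients of the displacement, polynomial in a time
  -- of size `n^K`.
  refine ⟨N * N, 1, 1 / (4 * (((2 * N + 1 : ℕ) : ℝ) * (20 * (pG + 1)))), one_pos, ?_, ?_⟩
  · have : 0 < pG := by linarith
    positivity
  intro GG _ hss Γ _ E b _ m hm h _ _ z hz κ₁ _ d hd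
  have hfin := finrank_lie_le GG
  obtain ⟨C, hC, hmain⟩ := hm.exists_additional_invariance E b hss
    (show Module.finrank ℝ GG.lie + 1 ≤ d by omega) hz
    (K := 20 * (pG + 1)) (by linarith)
  refine ⟨C, hC, ?_⟩
  intro k₀ ε hk₀ hε μ hμ s _ _ r hr x₁ x₂ v hv hx hεv hv1 hg₁ hg₂
  have := hμ.isProbability
  rw [hx] at hg₂
  obtain ⟨g, c, hg, hnorm, hinv⟩ := hmain k₀ ε hk₀ hε μ x₁ v hεv hv1 hg₁ hg₂
  -- The conjugating element lies in `H`, so the new direction stays in the `H`-invariant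
  -- complement.
  refine ⟨c • Ad g v, r.smul_mem c (hr.invariant g hg v hv), hnorm, ?_⟩
  rwa [Real.rpow_one]
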